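/- Let $n\ge 1$ and $0\le k\le n-1$. Let $\mathcal H$ be the Hecke algebra of the symmetric group $S_n$ over $\mathbb Q(v)$, generated by $T_1,\dots,T_{n-1}$ subject to the braid relations and $(T_i-v)(T_i+v^{-1})=0$, with standard basis $T_w$ ($w\in S_n$) and with the bar involution, the ring automorphism given by $\overline v=v^{-1}$, $\overline{T_i}=T_i^{-1}$. For $w\in S_n$ let $C_w\in\mathcal H$ be the Kazhdan–Lusztig element, that is, the unique element with $\overline{C_w}=C_w$ and $C_w-T_w\in\bigoplus_{y} v\mathbb Z[v]\,T_y$. Let $J=\{1,\dots,n-1\}\setminus\{k\}$, let $W_J=\langle s_j: j\in J\rangle\subseteq S_n$, where $s_j$ is the transposition of $j$ and $j+1$, let $w_0^J$ be the longest element of $W_J$, and put $C_J=C_{w_0^J}$. Let $W^J$ be the set of elements $y\in S_n$ of minimal length in their coset $yW_J$. Let $M^J$ be the $\mathcal H$-module induced from the one-dimensional representation $T_j\mapsto -v^{-1}$ ($j\in J$) of the Hecke algebra of $W_J$, with generating vector $\mathbf 1=m_1$, basis $m_y=T_y\mathbf 1$ ($y\in W^J$), and bar involution $\overline{h\mathbf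 1}=\overline h\,\mathbf 1$ ($h\in\mathcal H$). For $y\in W^J$ let $C^J_y\in M^J$ be the parabolic Kazhdan–Lusztig element, that is, the unique element with $\overline{C^J_y}=C^J_y$ and $C^J_y-m_y\in\bigoplus_{z\in W^J} v\mathbb Z[v]\,m_z$. Let $\lambda$ be a Young diagram contained in the $k\times(n-k)$ rectangle ($k$ rows, $n-k$ columns), and let $(i,j)$, with $i,j\ge 1$, denote the box in row $i$ and column $j$. Define $r_{ij}=0$ if $(i,j)\notin\lambda$ and $r_{ij}=\max(r_{i,j+1},r_{i+1,j})+1$ if $(i,j)\in\lambda$. Put $[r]=(v^r-v^{-r})/(v-v^{-1})$ and $$w_\lambda=\prod_{(i,j)\in\lambda}s_{k+j-i}\in S_n,\qquad X_\lambda=\prod_{(i,j)\in\lambda}\Bigl(T_{k+j-i}-\frac{v^{r_{ij}}}{[r_{ij}]}\Bigr)\in\mathcal H,$$ where in both products the factors are written from left to right in the following order of the boxes: the rows are taken from the bottom row to the top row, and each row is read from right to left. Then $w_\lambda\in W^J$, the elements $C^J_{w_\lambda}$, $C_{w_0^J}$ and $C_{w_\lambda w_0^J}$ exist and are uniquely determined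 by the conditions above, and $$X_\lambda\mathbf 1=C^J_{w_\lambda}\quad\text{in } M^J,\qquad X_\lambda C_J=C_{w_\lambda w_0^J}\quad\text{in }\mathcal H.$$ -/

import Mathlib

namespace Grassmannian

/-! ### The field of scalars -/

/-- The field `ℚ(v)`. -/
abbrev Qv : Type := RatFunc ℚ

/-- The variable `v`. -/
noncomputable def v : Qv := RatFunc.X

theorem v_ne_zero : v ≠ 0 := RatFunc.X_ne_zero

theorem transcendental_X_inv (F : Type) [Field F] :
    Transcendental F ((RatFunc.X : RatFunc F)⁻¹) := by
  intro h
  have h2 := h.inv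
  rw [inv_inv] at h2
  exact RatFunc.transcendental_X h2

/-- The field endomorphism of `F(X)` over `F` with `X ↦ X⁻¹`. -/
noncomputable def invVar (F : Type) [Field F] : RatFunc F →ₐ[F] RatFunc F :=
  RatFunc.liftAlgHom (Polynomial.aeval ((RatFunc.X : RatFunc F)⁻¹))
    (nonZeroDivisors_le_comap_nonZeroDivisors_of_injective _
      (transcendental_iff_injective.mp (transcendental_X_inv F)))

theorem invVar_X (F : Type) [Field F] : invVar F RatFunc.X = (RatFunc.X : RatFunc F)⁻¹ := by
  rw [← RatFunc.algebraMap_X, invVar, RatFunc.liftAlgHom_apply]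
  simp

/-- The field automorphism of `ℚ(v)` with `v ↦ v⁻¹`. -/
noncomputable def barQv : Qv →+* Qv := (invVar ℚ : RatFunc ℚ →+* RatFunc ℚ)

theorem barQv_v : barQv v = v⁻¹ := invVar_X ℚ

/-- The quantum integer `[r] = (v^r - v^{-r}) / (v - v^{-1})`. -/
noncomputable def qInt (r : ℕ) : Qv := (v ^ r - (v⁻¹) ^ r) / (v - v⁻¹)

/-- The element `v p(v)` of `v ℤ[v]` attached to `p ∈ ℤ[v]`; the set `v ℤ[v] ⊆ ℚ(v)` is the range
of this function. -/
noncomputable def vMul (p : Polynomial ℤ) : Qv := v * Polynomial.aeval v p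

/-! ### The symmetric group `S_n` as a Coxeter group -/

/-- The indices `1, …, n - 1` of the simple transpositions. -/
abbrev Gen (n : ℕ) : Type := {i : ℕ // 1 ≤ i ∧ i < n}

/-- The simple transposition `s_i`, exchanging the places `i` and `i + 1`
(the place `p ∈ {1, …, n}` is the element `p - 1` of `Fin n`). -/
def simple {n : ℕ} (i : Gen n) : Equiv.Perm (Fin n) :=
  Equiv.swap ⟨i.1 - 1, lt_of_le_of_lt (Nat.sub_le _ _) i.2.2⟩ ⟨i.1, i.2.2⟩

/-- The product in `S_n` of a word in the simple transpositions. -/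
def wordProd {n : ℕ} (l : List (Gen n)) : Equiv.Perm (Fin n) := (l.map simple).prod

theorem exists_word {n : ℕ} (w : Equiv.Perm (Fin n)) : ∃ l : List (Gen n), wordProd l = w := by
  rcases n with _ | n
  · exact ⟨[], Subsingleton.elim _ _⟩
  have hw : w ∈ Submonoid.closure
      (Set.range fun i : Fin n => Equiv.swap i.castSucc i.succ) := by
    rw [Equiv.Perm.mclosure_swap_castSucc_succ]; trivial
  induction hw using Submonoid.closure_induction with
  | mem x hx =>
    obtain ⟨i, rfl⟩ := hx
    refine ⟨[⟨i.1 + 1, by omega, by omega⟩], ?_⟩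
    simp only [wordProd, simple, List.map_cons, List.map_nil, List.prod_cons, List.prod_nil,
      mul_one]
    rfl
  | one => exact ⟨[], rfl⟩
  | mul x y _ _ hx hy =>
    obtain ⟨a, rfl⟩ := hx
    obtain ⟨b, rfl⟩ := hy
    exact ⟨a ++ b, by simp [wordProd]⟩

theorem exists_length {n : ℕ} (w : Equiv.Perm (Fin n)) :
    ∃ m : ℕ, ∃ l : List (Gen n), wordProd l = w ∧ l.length = m :=
  let ⟨l, hl⟩ := exists_word w
  ⟨l.length, l, hl, rfl⟩

open Classical in
/-- The length `l(w)`: the least length of a word in the simple transpositions with product `w`. -/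
noncomputable def len {n : ℕ} (w : Equiv.Perm (Fin n)) : ℕ := Nat.find (exists_length w)

open Classical in
theorem exists_reducedWord {n : ℕ} (w : Equiv.Perm (Fin n)) :
    ∃ l : List (Gen n), wordProd l = w ∧ l.length = len w := Nat.find_spec (exists_length w)

/-- A reduced expression of `w`. -/
noncomputable def reducedWord {n : ℕ} (w : Equiv.Perm (Fin n)) : List (Gen n) :=
  Classical.choose (exists_reducedWord w)

/-- The parabolic subgroup `W_J`, generated by the `s_j` with `j ∈ J`. -/
def parabolic {n : ℕ} (J : Set (Gen n)) : Subgroup (Equiv.Perm (Fin n)) :=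
  Subgroup.closure (simple '' J)

/-- `W^J`: the elements `w` of minimal length in their coset `w W_J`. -/
def minReps {n : ℕ} (J : Set (Gen n)) : Set (Equiv.Perm (Fin n)) :=
  {w | ∀ u ∈ parabolic J, len w ≤ len (w * u)}

theorem exists_longest {n : ℕ} (J : Set (Gen n)) :
    ∃ w ∈ parabolic J, ∀ u ∈ parabolic J, len u ≤ len w :=
  Set.exists_max_image (parabolic J : Set (Equiv.Perm (Fin n))) len (Set.toFinite _)
    ⟨1, (parabolic J).one_mem⟩

/-- `w_0^J`: the element of maximal length in `W_J`. -/
noncomputable def longest {n : ℕ} (J : Set (Gen n)) : Equiv.Perm (Fin n) :=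
  Classical.choose (exists_longest J)

/-! ### The Hecke algebra of `S_n` -/

/-- The defining relations of the Hecke algebra: the quadratic relation
`(T_i - v)(T_i + v⁻¹) = 0` and the braid relations. -/
inductive HeckeRel (n : ℕ) : FreeAlgebra Qv (Gen n) → FreeAlgebra Qv (Gen n) → Prop
  | quad (i : Gen n) : HeckeRel n
      ((FreeAlgebra.ι Qv i - algebraMap Qv _ v) * (FreeAlgebra.ι Qv i + algebraMap Qv _ (v⁻¹))) 0
  | braid (i j : Gen n) (h : i.1 + 1 = j.1) : HeckeRel n
      (FreeAlgebra.ι Qv i * FreeAlgebra.ι Qv j * FreeAlgebra.ι Qv i)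
      (FreeAlgebra.ι Qv j * FreeAlgebra.ι Qv i * FreeAlgebra.ι Qv j)
  | comm (i j : Gen n) (h : i.1 + 1 < j.1) : HeckeRel n
      (FreeAlgebra.ι Qv i * FreeAlgebra.ι Qv j) (FreeAlgebra.ι Qv j * FreeAlgebra.ι Qv i)

/-- The Hecke algebra of `S_n` over `ℚ(v)`. -/
abbrev Hecke (n : ℕ) : Type := RingQuot (HeckeRel n)

/-- The scalar `f ∈ ℚ(v)`, as an element of the Hecke algebra. -/
noncomputable abbrev scal {n : ℕ} (f : Qv) : Hecke n := algebraMap Qv (Hecke n) f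

theorem scal_sub {n : ℕ} (f g : Qv) : scal (n := n) (f - g) = scal f - scal g := map_sub _ f g

/-- The generator `T_i`. -/
noncomputable def gen {n : ℕ} (i : Gen n) : Hecke n :=
  RingQuot.mkAlgHom Qv (HeckeRel n) (FreeAlgebra.ι Qv i)

/-- The standard basis element `T_w = T_{i_1} ⋯ T_{i_l}`, where `w = s_{i_1} ⋯ s_{i_l}` is a
reduced expression. -/
noncomputable def stdT {n : ℕ} (w : Equiv.Perm (Fin n)) : Hecke n :=
  ((reducedWord w).map gen).prod

theorem gen_quad {n : ℕ} (i : Gen n) :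
    (gen i - scal v) * (gen i + scal (v⁻¹)) = 0 := by
  have h := RingQuot.mkAlgHom_rel Qv (HeckeRel.quad i)
  simpa [gen] using h

theorem gen_braid {n : ℕ} (i j : Gen n) (h : i.1 + 1 = j.1) :
    gen i * gen j * gen i = gen j * gen i * gen j := by
  have h := RingQuot.mkAlgHom_rel Qv (HeckeRel.braid i j h)
  simpa [gen] using h

theorem gen_comm {n : ℕ} (i j : Gen n) (h : i.1 + 1 < j.1) :
    gen i * gen j = gen j * gen i := by
  have h := RingQuot.mkAlgHom_rel Qv (HeckeRel.comm i j h)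
  simpa [gen] using h

/-- The inverse `T_i⁻¹ = T_i - (v - v⁻¹)`. -/
noncomputable def genInv {n : ℕ} (i : Gen n) : Hecke n := gen i - scal (v - v⁻¹)

theorem gen_sq {n : ℕ} (i : Gen n) : gen i * gen i = scal (v - v⁻¹) * gen i + 1 := by
  have h := gen_quad i
  have hc : gen i * scal (v⁻¹) = scal (v⁻¹) * gen i := (Algebra.commutes (v⁻¹) (gen i)).symm
  have h1 : scal (n := n) v * scal (v⁻¹) = 1 := by
    rw [← map_mul, mul_inv_cancel₀ v_ne_zero, map_one]
  rw [sub_mul, mul_add, mul_add, hc, h1] at h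
  rw [scal_sub, sub_mul, ← sub_eq_zero, ← h]
  abel

theorem gen_mul_genInv {n : ℕ} (i : Gen n) : gen i * genInv i = 1 := by
  rw [genInv, mul_sub, gen_sq, ← Algebra.commutes]; simp

theorem genInv_mul_gen {n : ℕ} (i : Gen n) : genInv i * gen i = 1 := by
  rw [genInv, sub_mul, gen_sq]; simp

/-- `T_i` as a unit. -/
noncomputable def genUnit {n : ℕ} (i : Gen n) : (Hecke n)ˣ :=
  ⟨gen i, genInv i, gen_mul_genInv i, genInv_mul_gen i⟩

/-! ### The bar involution -/

/-- The Hecke algebra, with `f ∈ ℚ(v)` acting as its image under `v ↦ v⁻¹`. -/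
def HeckeBar (n : ℕ) : Type := Hecke n

noncomputable instance instRingHeckeBar (n : ℕ) : Ring (HeckeBar n) := inferInstanceAs (Ring (Hecke n))

noncomputable instance instAlgebraHeckeBar (n : ℕ) : Algebra Qv (HeckeBar n) :=
  RingHom.toAlgebra' (((algebraMap Qv (Hecke n)).comp barQv : Qv →+* Hecke n) : Qv →+* HeckeBar n)
    (fun c x => Algebra.commutes (A := Hecke n) (barQv c) x)

/-- The semilinear homomorphism from the free algebra with `v ↦ v⁻¹` and `T_i ↦ T_i⁻¹`. -/
noncomputable def freeBar (n : ℕ) : FreeAlgebra Qv (Gen n) →ₐ[Qv] HeckeBar n :=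
  FreeAlgebra.lift Qv (fun i => (genInv i : Hecke n))

theorem freeBar_ι {n : ℕ} (i : Gen n) : freeBar n (FreeAlgebra.ι Qv i) = (genInv i : Hecke n) :=
  FreeAlgebra.lift_ι_apply _ _

theorem freeBar_algebraMap {n : ℕ} (f : Qv) :
    freeBar n (algebraMap Qv _ f) = (scal (barQv f) : Hecke n) :=
  (freeBar n).commutes f

theorem freeBar_rel {n : ℕ} ⦃x y : FreeAlgebra Qv (Gen n)⦄ (h : HeckeRel n x y) :
    freeBar n x = freeBar n y := by
  cases h with
  | quad i =>
    rw [map_mul, map_sub, map_add, map_zero, freeBar_ι, freeBar_algebraMap, freeBar_algebraMap,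
      map_inv₀, barQv_v, inv_inv]
    have h := gen_quad i
    have e1 : (genInv i - scal (v⁻¹) : Hecke n) = gen i - scal v := by
      rw [genInv, scal_sub]; abel
    have e2 : (genInv i + scal v : Hecke n) = gen i + scal (v⁻¹) := by
      rw [genInv, scal_sub]; abel
    rw [← e1, ← e2] at h
    exact h
  | braid i j hij =>
    simp only [map_mul, freeBar_ι]
    have h : genUnit i * genUnit j * genUnit i = genUnit j * genUnit i * genUnit j :=
      Units.ext (gen_braid i j hij)
    have h2 := congrArg (fun u => ((u⁻¹ : (Hecke n)ˣ) : Hecke n)) h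
    simp only [mul_inv_rev, Units.val_mul, ← mul_assoc] at h2
    exact h2
  | comm i j hij =>
    simp only [map_mul, freeBar_ι]
    have h : genUnit i * genUnit j = genUnit j * genUnit i := Units.ext (gen_comm i j hij)
    have h2 := congrArg (fun u => ((u⁻¹ : (Hecke n)ˣ) : Hecke n)) h
    simp only [mul_inv_rev, Units.val_mul] at h2
    exact h2.symm

/-- The bar involution of the Hecke algebra: the ring homomorphism with `v ↦ v⁻¹` and
`T_i ↦ T_i⁻¹`. -/
noncomputable def bar (n : ℕ) : Hecke n →+* Hecke n :=
  RingQuot.lift (T := Hecke n) ⟨((freeBar n : FreeAlgebra Qv (Gen n) →+* HeckeBar n) :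
    FreeAlgebra Qv (Gen n) →+* Hecke n), fun _ _ h => freeBar_rel h⟩

theorem bar_gen {n : ℕ} (i : Gen n) : bar n (gen i) = genInv i := by
  rw [gen, RingQuot.mkAlgHom_def]
  exact (RingQuot.lift_mkRingHom_apply _ _ _).trans (freeBar_ι i)

theorem bar_scal {n : ℕ} (f : Qv) : bar n (scal f) = scal (barQv f) := by
  have h : (scal f : Hecke n) = RingQuot.mkRingHom (HeckeRel n) (algebraMap Qv _ f) := by
    have := (RingQuot.mkAlgHom Qv (HeckeRel n)).commutes f
    rw [RingQuot.mkAlgHom_def] at this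
    exact this.symm
  rw [h]
  exact (RingQuot.lift_mkRingHom_apply _ _ _).trans (freeBar_algebraMap f)

/-! ### Kazhdan–Lusztig elements of the Hecke algebra -/

/-- The conditions defining the Kazhdan–Lusztig basis element `C_w`: it is bar-invariant, and
`C_w - T_w` lies in `⨁_y v ℤ[v] T_y`. -/
def IsKL {n : ℕ} (w : Equiv.Perm (Fin n)) (c : Hecke n) : Prop :=
  bar n c = c ∧ ∃ p : Equiv.Perm (Fin n) → Polynomial ℤ,
    c - stdT w = ∑ y, scal (vMul (p y)) * stdT y

/-- The Kazhdan–Lusztig basis element `C_w`: the element satisfying `IsKL w`. -/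
noncomputable def klC {n : ℕ} (w : Equiv.Perm (Fin n)) : Hecke n := Classical.epsilon (IsKL w)

/-! ### The parabolic module `M^J` -/

/-- The left ideal of the Hecke algebra generated by the `T_j + v⁻¹` with `j ∈ J`. -/
noncomputable def parIdeal {n : ℕ} (J : Set (Gen n)) : Submodule (Hecke n) (Hecke n) :=
  Submodule.span (Hecke n) ((fun j => gen j + scal (v⁻¹)) '' J)

/-- The module `M^J` induced from the one-dimensional representation `T_j ↦ -v⁻¹` (`j ∈ J`) of the
Hecke algebra of `W_J`. As the kernel of that character is generated, as a left ideal, by the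
`T_j + v⁻¹`, the induced module is the quotient of the Hecke algebra by the left ideal
generated by these elements. -/
abbrev ParMod {n : ℕ} (J : Set (Gen n)) : Type := Hecke n ⧸ parIdeal J

/-- The generating vector `m_1` of `M^J`, on which `T_j`, `j ∈ J`, acts by `-v⁻¹`. -/
noncomputable def mOne {n : ℕ} (J : Set (Gen n)) : ParMod J := (parIdeal J).mkQ 1

theorem gen_smul_mOne {n : ℕ} (J : Set (Gen n)) (j : Gen n) (hj : j ∈ J) :
    gen j • mOne J = (scal (-v⁻¹) : Hecke n) • mOne J := by
  rw [mOne, ← map_smul, ← map_smul, ← sub_eq_zero, ← map_sub, Submodule.mkQ_apply,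
    Submodule.Quotient.mk_eq_zero]
  refine Submodule.subset_span ⟨j, hj, ?_⟩
  simp [scal]

/-- The basis vector `m_y = T_y m_1`. -/
noncomputable def mStd {n : ℕ} (J : Set (Gen n)) (y : Equiv.Perm (Fin n)) : ParMod J :=
  stdT y • mOne J

theorem parIdeal_le_comap_bar {n : ℕ} (J : Set (Gen n)) :
    parIdeal J ≤ (parIdeal J).comap (bar n).toSemilinearMap := by
  rw [parIdeal, Submodule.span_le]
  rintro _ ⟨j, hj, rfl⟩
  have h : bar n (gen j + scal (v⁻¹)) = gen j + scal (v⁻¹) := by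
    rw [map_add, bar_gen, bar_scal, map_inv₀, barQv_v, inv_inv, genInv, scal_sub]; abel
  rw [SetLike.mem_coe, Submodule.mem_comap, RingHom.coe_toSemilinearMap]
  change bar n (gen j + scal (v⁻¹)) ∈ Submodule.span (Hecke n) _
  rw [h]
  exact Submodule.subset_span ⟨j, hj, rfl⟩

/-- The bar involution of `M^J`, given by `h m_1 ↦ bar(h) m_1`. -/
noncomputable def barM {n : ℕ} (J : Set (Gen n)) : ParMod J →ₛₗ[bar n] ParMod J :=
  (parIdeal J).mapQ (parIdeal J) (bar n).toSemilinearMap (parIdeal_le_comap_bar J)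

theorem barM_smul_mOne {n : ℕ} (J : Set (Gen n)) (h : Hecke n) :
    barM J (h • mOne J) = bar n h • mOne J := by
  rw [LinearMap.map_smulₛₗ]
  congr 1
  change (parIdeal J).mkQ (bar n 1) = _
  rw [map_one]; rfl

open Classical in
/-- The conditions defining the parabolic Kazhdan–Lusztig basis element `C^J_y`, `y ∈ W^J`: it is
bar-invariant, and `C^J_y - m_y` lies in `⨁_{z ∈ W^J} v ℤ[v] m_z`. -/
def IsParKL {n : ℕ} (J : Set (Gen n)) (y : Equiv.Perm (Fin n)) (c : ParMod J) : Prop :=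
  barM J c = c ∧ ∃ p : Equiv.Perm (Fin n) → Polynomial ℤ,
    c - mStd J y = ∑ z with z ∈ minReps J, (scal (vMul (p z)) : Hecke n) • mStd J z

/-- The parabolic Kazhdan–Lusztig basis element `C^J_y`: the element satisfying `IsParKL J y`. -/
noncomputable def parKL {n : ℕ} (J : Set (Gen n)) (y : Equiv.Perm (Fin n)) : ParMod J :=
  Classical.epsilon (IsParKL J y)

/-! ### Young diagrams -/

/-- `λ` fits inside the `a × b` rectangle (boxes are numbered from `0` in `YoungDiagram`). -/
def FitsIn (μ : YoungDiagram) (a b : ℕ) : Prop := ∀ c ∈ μ, c.1 < a ∧ c.2 < b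

/-- The boxes of a diagram in the order of the products: rows from the bottom one to the top one,
each row read from right to left. -/
def boxes (μ : YoungDiagram) : List (ℕ × ℕ) :=
  (List.range (μ.colLen 0)).reverse.flatMap fun i =>
    (List.range (μ.rowLen i)).reverse.map fun j => (i, j)

theorem add_lt_of_mem {μ : YoungDiagram} {i j : ℕ} (h : (i, j) ∈ μ) :
    i + j < μ.colLen 0 + μ.rowLen 0 := by
  have h1 := YoungDiagram.mem_iff_lt_rowLen.mp h
  have h2 := YoungDiagram.mem_iff_lt_colLen.mp h
  have h3 := μ.rowLen_anti 0 i (Nat.zero_le _)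
  have h4 := μ.colLen_anti 0 j (Nat.zero_le _)
  omega

/-- The shifts: `r_{ij} = max (r_{i,j+1}, r_{i+1,j}) + 1` for a box `(i, j)` of the diagram, and
`r_{ij} = 0` outside the diagram. -/
def shift (μ : YoungDiagram) (i j : ℕ) : ℕ :=
  if h : (i, j) ∈ μ then max (shift μ i (j + 1)) (shift μ (i + 1) j) + 1 else 0
termination_by μ.colLen 0 + μ.rowLen 0 - (i + j)
decreasing_by all_goals (have := add_lt_of_mem h; omega)

/-- `s_i` for a natural number `i`; by convention `1` if `i` is not one of `1, …, n - 1`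
(this does not occur for the boxes of a diagram in the `k × (n - k)` rectangle). -/
def simpleNat (n i : ℕ) : Equiv.Perm (Fin n) := if h : 1 ≤ i ∧ i < n then simple ⟨i, h⟩ else 1

/-- `T_i` for a natural number `i`; by convention `1` if `i` is not one of `1, …, n - 1`. -/
noncomputable def genNat (n i : ℕ) : Hecke n := if h : 1 ≤ i ∧ i < n then gen ⟨i, h⟩ else 1

/-- `w_λ`, the ordered product of the `s_{k+j-i}` over the boxes `(i, j)` of `λ`. -/
def wDiag (n k : ℕ) (μ : YoungDiagram) : Equiv.Perm (Fin n) :=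
  ((boxes μ).map fun c => simpleNat n (k + c.2 - c.1)).prod

/-- `X_λ`, the ordered product of the `T_{k+j-i} - v^{r_{ij}} / [r_{ij}]` over the boxes `(i, j)`
of `λ`. -/
noncomputable def xDiag (n k : ℕ) (μ : YoungDiagram) : Hecke n :=
  ((boxes μ).map fun c =>
    genNat n (k + c.2 - c.1) - scal (v ^ shift μ c.1 c.2 / qInt (shift μ c.1 c.2))).prod

/-- `J = {1, …, k - 1, k + 1, …, n - 1}`, so that `W_J = S_k × S_{n-k}`. -/
def maxJ (n k : ℕ) : Set (Gen n) := {i | i.1 ≠ k}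

end Grassmannian

namespace Grassmannian

/-! A Kazhdan–Lusztig element is determined by bar-invariance together with its class modulo `v
ℤ[v]`. Bar-invariance of `X_λ` holds factor by factor, because `v^r - v^{-r} = [r](v - v⁻¹)`. The
substance is the second condition: although the factors have denominators `[r]`, the coefficients of
`X_λ 1` lie in `v ℤ[v]`, except for a coefficient in `1 + v ℤ[v]` at `w_λ`.

The module `M^J` is modelled by functions on sequences of `k` values `false` and `n - k` values
`true`, and these sequences are extended to Maya diagrams on `ℤ`. There `T_i + v⁻¹` becomes a
Temperley–Lieb operator `U_x`, and since `[r+1]/[r] = v⁻¹ + v^r/[r]` the factor of a box of shift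
`r` becomes `U_x - [r+1]/[r]`. The generating vector becomes the indicator of the vacuum diagram.

Coefficients are read off with caps. If `f` has the values `false, true` at `x, x+1`, and `g` is `f`
with these two places removed, then `φ(f) = (cap_x φ)(g) - v φ(f ∘ adj x)`. The last term lies in `v
ℤ[v]` by induction on `f`. For `φ` the product over `λ` there are two possibilities. If no box of
`λ` can be added at `x`, then `cap_x φ = 0` (`cap_rectOp_vac_of_not_corner`). Otherwise `cap_x φ` is
the product for the partition obtained by deleting the row and the column through the inner corner
(`exists_cap_rectOp_of_corner`), and induction on the size applies (`exists_rectOp_coeff`).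

Both facts come from the ladder identity `cap_x F_{x+1}(r) F_x(r+1) = -([r+2]/[r+1]) cap_{x+1}` and
its mirror image. It says that a cap slides through two adjacent columns, or rows, whose shifts
differ by one, and it is the recursion of quantum integers in disguise. The rule defining `r_{ij}`
ensures that at every inner corner, and between equal rows or columns, such a ladder is present
(`IsShift.col_ladder`, `IsShift.row_ladder`).

The rest is Hecke algebra: length is the number of inversions, products over reduced words are well
defined (`prod_map_eq_of_isReduced`), and the action on functions of sequences gives the
independence of the standard bases and the triangularity of bar, hence uniqueness. Finally `emb`
realises `h 1 ↦ h C_J`: the coefficient of `T_{zu}` is that of `m_z` times `(-v)^{l(w_0^J) - l(u)}`.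
Thus the parabolic statement implies the one in the Hecke algebra. -/

/-! ### Temperley–Lieb operators on functions of Maya diagrams -/

/-- The transposition of the adjacent integers `x` and `x + 1`. -/
def adj (x : ℤ) : Equiv.Perm ℤ := Equiv.swap x (x + 1)

/-- The Temperley–Lieb operator at the places `x`, `x + 1`. -/
noncomputable def tlU (x : ℤ) : Module.End Qv ((ℤ → Bool) → Qv) where
  toFun φ f := if f x = f (x + 1) then 0 else φ (f ∘ adj x) + (if f x then v else v⁻¹) * φ f
  map_add' φ ψ := by ext f; simp only [Pi.add_apply]; split_ifs <;> ring
  map_smul' c φ := by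
    ext f; simp only [Pi.smul_apply, smul_eq_mul, RingHom.id_apply]; split_ifs <;> ring

/-- Insertion of the values `a`, `b` at the places `x`, `x + 1`; the part to the left moves one step
to the left, and the part to the right one step to the right. -/
def ins (x : ℤ) (a b : Bool) (g : ℤ → Bool) : ℤ → Bool := fun y =>
  if y < x then g (y + 1) else if y = x then a else if y = x + 1 then b else g (y - 1)

/-- The cap operator joining the places `x` and `x + 1`. -/
noncomputable def cap (x : ℤ) : Module.End Qv ((ℤ → Bool) → Qv) where
  toFun φ g := φ (ins x false true g) + v * φ (ins x true false g)
  map_add' φ ψ := by ext f; simp only [Pi.add_apply]; ring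
  map_smul' c φ := by
    ext f; simp only [Pi.smul_apply, smul_eq_mul, RingHom.id_apply]; ring

theorem tlU_apply (x : ℤ) (φ : (ℤ → Bool) → Qv) (f : ℤ → Bool) :
    tlU x φ f = if f x = f (x + 1) then 0 else
      φ (f ∘ adj x) + (if f x then v else v⁻¹) * φ f := rfl

theorem cap_apply (x : ℤ) (φ : (ℤ → Bool) → Qv) (g : ℤ → Bool) :
    cap x φ g = φ (ins x false true g) + v * φ (ins x true false g) := rfl

theorem adj_apply (x y : ℤ) : adj x y = if y = x then x + 1 else if y = x + 1 then x else y :=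
  Equiv.swap_apply_def _ _ _

theorem ins_self (x : ℤ) (a b : Bool) (g : ℤ → Bool) : ins x a b g x = a := by simp [ins]

theorem ins_succ (x : ℤ) (a b : Bool) (g : ℤ → Bool) : ins x a b g (x + 1) = b := by simp [ins]

theorem ins_of_lt {x y : ℤ} (a b : Bool) (g : ℤ → Bool) (h : y < x) :
    ins x a b g y = g (y + 1) := by simp [ins, h]

theorem ins_of_gt {x y : ℤ} (a b : Bool) (g : ℤ → Bool) (h : x + 1 < y) :
    ins x a b g y = g (y - 1) := by
  rw [ins, if_neg (by omega), if_neg (by omega), if_neg (by omega)]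

theorem ins_comp_adj_self (x : ℤ) (a b : Bool) (g : ℤ → Bool) :
    ins x a b g ∘ adj x = ins x b a g := by
  funext y
  simp only [ins, Function.comp, adj_apply]
  grind

theorem ins_comp_adj_of_lt {x y : ℤ} (a b : Bool) (g : ℤ → Bool) (h : y + 1 < x) :
    ins x a b g ∘ adj y = ins x a b (g ∘ adj (y + 1)) := by
  funext z
  simp only [ins, Function.comp, adj_apply]
  grind

theorem ins_comp_adj_of_gt {x y : ℤ} (a b : Bool) (g : ℤ → Bool) (h : x + 1 < y) :
    ins x a b g ∘ adj y = ins x a b (g ∘ adj (y - 1)) := by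
  funext z
  simp only [ins, Function.comp, adj_apply]
  grind

/-! ### Relations between caps and Temperley–Lieb operators -/

theorem cap_mul_tlU_self (x : ℤ) : cap x * tlU x = (v + v⁻¹) • cap x := by
  ext φ g
  simp only [Module.End.mul_apply, cap_apply, tlU_apply, LinearMap.smul_apply, Pi.smul_apply,
    ins_self, ins_succ, ins_comp_adj_self, smul_eq_mul]
  have := v_ne_zero
  simp only [Bool.false_eq_true, Bool.true_eq_false, if_false, if_true]
  field_simp
  ring

theorem cap_mul_tlU_of_lt {x y : ℤ} (h : y + 1 < x) : cap x * tlU y = tlU (y + 1) * cap x := by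
  ext φ g
  simp only [Module.End.mul_apply, cap_apply, tlU_apply, ins_comp_adj_of_lt _ _ _ h,
    ins_of_lt _ _ _ h, ins_of_lt _ _ _ (show y < x by omega)]
  split_ifs <;> ring

theorem cap_mul_tlU_of_gt {x y : ℤ} (h : x + 1 < y) : cap x * tlU y = tlU (y - 1) * cap x := by
  ext φ g
  simp only [Module.End.mul_apply, cap_apply, tlU_apply, ins_comp_adj_of_gt _ _ _ h,
    ins_of_gt _ _ _ h, ins_of_gt _ _ _ (show x + 1 < y + 1 by omega), add_sub_cancel_right,
    sub_add_cancel]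
  split_ifs <;> ring

/-- `tlU` is a cap followed by a cup, so this is the straightening of a zigzag, and
`cap_mul_tlU_self` is the value `v + v⁻¹` of a closed loop. The two cases are the two possible
values on the strand that is straightened. -/
theorem cap_mul_tlU_succ (x : ℤ) : cap x * tlU (x + 1) = cap (x + 1) := by
  ext φ g
  have e1 : ins x false true g (x + 1 + 1) = g (x + 1) := by
    rw [ins_of_gt _ _ _ (by omega), add_sub_cancel_right]
  have e2 : ins x true false g (x + 1 + 1) = g (x + 1) := by
    rw [ins_of_gt _ _ _ (by omega), add_sub_cancel_right]
  simp only [Module.End.mul_apply, cap_apply, tlU_apply, ins_succ, e1, e2]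
  have := v_ne_zero
  rcases hg : g (x + 1)
  · have h1 : ins x false true g ∘ adj (x + 1) = ins (x + 1) false true g := by
      funext z
      simp only [ins, Function.comp, adj_apply]
      grind
    have h2 : ins x false true g = ins (x + 1) true false g := by
      funext z
      simp only [ins]
      grind
    rw [h1, ← h2]
    simp
  · have h1 : ins x true false g ∘ adj (x + 1) = ins (x + 1) true false g := by
      funext z
      simp only [ins, Function.comp, adj_apply]
      grind
    have h2 : ins x true false g = ins (x + 1) false true g := by
      funext z
      simp only [ins]
      grind
    rw [h1, ← h2]
    simp
    field_simp
    ring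

theorem cap_mul_tlU_pred (x : ℤ) : cap x * tlU (x - 1) = cap (x - 1) := by
  ext φ g
  have e1 : ins x false true g (x - 1) = g x := by
    rw [ins_of_lt _ _ _ (by omega), sub_add_cancel]
  have e2 : ins x true false g (x - 1) = g x := by
    rw [ins_of_lt _ _ _ (by omega), sub_add_cancel]
  simp only [Module.End.mul_apply, cap_apply, tlU_apply, sub_add_cancel, ins_self, e1, e2]
  have := v_ne_zero
  rcases hg : g x
  · have h1 : ins x true false g ∘ adj (x - 1) = ins (x - 1) true false g := by
      funext z
      simp only [ins, Function.comp, adj_apply]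
      grind
    have h2 : ins x true false g = ins (x - 1) false true g := by
      funext z
      simp only [ins]
      grind
    rw [h1, ← h2]
    simp
    field_simp
    ring
  · have h1 : ins x false true g ∘ adj (x - 1) = ins (x - 1) false true g := by
      funext z
      simp only [ins, Function.comp, adj_apply]
      grind
    have h2 : ins x false true g = ins (x - 1) true false g := by
      funext z
      simp only [ins]
      grind
    rw [h1, ← h2]
    simp

theorem tlU_comm {x y : ℤ} (h : y + 1 < x) : tlU x * tlU y = tlU y * tlU x := by
  ext φ f
  have h1 : ∀ g : ℤ → Bool, (g ∘ adj x) y = g y := fun g => by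
    simp only [Function.comp, adj_apply]; grind
  have h2 : ∀ g : ℤ → Bool, (g ∘ adj x) (y + 1) = g (y + 1) := fun g => by
    simp only [Function.comp, adj_apply]; grind
  have h3 : ∀ g : ℤ → Bool, (g ∘ adj y) x = g x := fun g => by
    simp only [Function.comp, adj_apply]; grind
  have h4 : ∀ g : ℤ → Bool, (g ∘ adj y) (x + 1) = g (x + 1) := fun g => by
    simp only [Function.comp, adj_apply]; grind
  have h5 : (f ∘ adj x) ∘ adj y = (f ∘ adj y) ∘ adj x := by
    funext z
    simp only [Function.comp, adj_apply]; grind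
  simp only [Module.End.mul_apply, tlU_apply, h1, h2, h3, h4, h5]
  split_ifs <;> ring

/-- The Maya diagram of the empty partition. -/
def vacSeq : ℤ → Bool := fun x => decide (0 ≤ x)

/-- The indicator function of a Maya diagram. -/
noncomputable def mayaInd (g : ℤ → Bool) : (ℤ → Bool) → Qv :=
  open Classical in fun f => if f = g then 1 else 0

/-- The vacuum changes its value only between the places `-1` and `0`, so a cap anywhere else joins
equal values. -/
theorem cap_vac_of_ne {x : ℤ} (h : x ≠ -1) : cap x (mayaInd vacSeq) = 0 := by
  ext g
  have h1 : ins x false true g ≠ vacSeq := by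
    intro e
    have e1 := congrFun e x
    have e2 := congrFun e (x + 1)
    simp [ins_self, ins_succ, vacSeq] at e1 e2
    omega
  have h2 : ins x true false g ≠ vacSeq := by
    intro e
    have e1 := congrFun e x
    have e2 := congrFun e (x + 1)
    simp [ins_self, ins_succ, vacSeq] at e1 e2
    omega
  simp [cap_apply, mayaInd, h1, h2]

theorem cap_vac : cap (-1) (mayaInd vacSeq) = mayaInd vacSeq := by
  ext g
  have h1 : ins (-1) false true g = vacSeq ↔ g = vacSeq := by
    constructor
    · intro e
      funext y
      rcases lt_or_ge y 0 with hy | hy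
      · have := congrFun e (y - 1)
        rw [ins_of_lt _ _ _ (by omega), sub_add_cancel] at this
        rw [this]; simp [vacSeq]; omega
      · have := congrFun e (y + 1)
        rw [ins_of_gt _ _ _ (by omega), add_sub_cancel_right] at this
        rw [this]; simp [vacSeq]; omega
    · rintro rfl
      funext y
      simp only [ins, vacSeq]
      split_ifs <;> simp <;> omega
  have h2 : ins (-1) true false g ≠ vacSeq := by
    intro e
    have e1 := congrFun e (-1)
    simp [ins_self, vacSeq] at e1
  rw [cap_apply]
  simp only [mayaInd, if_neg h2, mul_zero, add_zero]
  by_cases hg : g = vacSeq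
  · rw [if_pos hg, if_pos (h1.2 hg)]
  · rw [if_neg hg, if_neg (mt h1.1 hg)]

/-! ### Quantum integers -/

theorem v_pow_ne_one {m : ℕ} (hm : m ≠ 0) : v ^ m ≠ 1 := by
  intro h
  have h1 : algebraMap (Polynomial ℚ) (RatFunc ℚ) (Polynomial.X ^ m) =
      algebraMap (Polynomial ℚ) (RatFunc ℚ) (Polynomial.C 1) := by
    rw [map_pow, RatFunc.algebraMap_X, map_one, map_one]; exact h
  have h2 := RatFunc.algebraMap_injective ℚ h1
  exact Polynomial.X_pow_sub_C_ne_zero (Nat.pos_of_ne_zero hm) (1 : ℚ) (sub_eq_zero.mpr h2)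

theorem v_sq_ne_one : v ^ 2 ≠ 1 := v_pow_ne_one two_ne_zero

theorem v_sub_inv_ne_zero : v - v⁻¹ ≠ 0 := by
  intro h
  apply v_sq_ne_one
  rw [sub_eq_zero] at h
  nth_rw 1 [pow_two, h]
  exact inv_mul_cancel₀ v_ne_zero

theorem qInt_ne_zero {r : ℕ} (hr : r ≠ 0) : qInt r ≠ 0 := by
  rw [qInt]
  refine div_ne_zero ?_ v_sub_inv_ne_zero
  intro h
  apply v_pow_ne_one (m := r + r) (by omega)
  rw [sub_eq_zero] at h
  nth_rw 1 [pow_add, h]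
  rw [← mul_pow, inv_mul_cancel₀ v_ne_zero, one_pow]

theorem qInt_one : qInt 1 = 1 := by
  rw [qInt, pow_one, pow_one, div_self v_sub_inv_ne_zero]

theorem qInt_add_two (r : ℕ) : qInt (r + 2) = (v + v⁻¹) * qInt (r + 1) - qInt r := by
  have := v_ne_zero
  simp only [qInt]
  rw [mul_div_assoc', ← sub_div]
  congr 1
  simp only [pow_succ]
  field_simp
  ring

theorem qInt_succ (r : ℕ) : qInt (r + 1) = v⁻¹ * qInt r + v ^ r := by
  have h1 := v_ne_zero
  have h2 := v_sub_inv_ne_zero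
  simp only [qInt]
  rw [mul_div_assoc', div_add' _ _ _ h2]
  congr 1
  simp only [pow_succ]
  ring

/-- The ratio `[r + 1] / [r]` of consecutive quantum integers. -/
noncomputable def qRatio (r : ℕ) : Qv := qInt (r + 1) / qInt r

/-- This is the constant of a factor after the change from `T` to `U = T + v⁻¹`. -/
theorem qRatio_eq {r : ℕ} (hr : r ≠ 0) : qRatio r = v⁻¹ + v ^ r / qInt r := by
  have := qInt_ne_zero hr
  rw [qRatio, qInt_succ]
  field_simp

theorem qRatio_one : qRatio 1 = v + v⁻¹ := by
  rw [qRatio_eq one_ne_zero, qInt_one]; ring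

/-- The recursion `[r+2] = (v + v⁻¹)[r+1] - [r]` divided by `[r]`. It is the only relation between
consecutive shifts that the ladder identity needs. -/
theorem qRatio_mul_sub {r : ℕ} (hr : r ≠ 0) :
    qRatio r * (v + v⁻¹ - qRatio (r + 1)) = 1 := by
  have h1 := qInt_ne_zero hr
  have h2 := qInt_ne_zero (r := r + 1) (by omega)
  rw [qRatio, qRatio, qInt_add_two]
  field_simp
  ring

/-! ### The factors and their products over rectangles -/

/-- The factor `U_x - [r + 1] / [r]`; by convention it is `1` for `r = 0`. -/
noncomputable def factor (x : ℤ) (r : ℕ) : Module.End Qv ((ℤ → Bool) → Qv) :=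
  if r = 0 then 1 else tlU x - qRatio r • 1

theorem factor_zero (x : ℤ) : factor x 0 = 1 := if_pos rfl

theorem factor_of_ne {r : ℕ} (x : ℤ) (hr : r ≠ 0) : factor x r = tlU x - qRatio r • 1 := if_neg hr

theorem factor_commute_of_lt {x y : ℤ} (h : y + 1 < x) (r s : ℕ) :
    Commute (factor x r) (factor y s) := by
  unfold factor
  have h1 : Commute (tlU x) (tlU y) := tlU_comm h
  have h2 : ∀ (c : Qv) (a : Module.End Qv ((ℤ → Bool) → Qv)), Commute (c • 1) a := fun c a =>
    (Commute.one_left a).smul_left c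
  split_ifs
  · exact Commute.one_left _
  · exact Commute.one_left _
  · exact Commute.one_right _
  · exact (h1.sub_left (h2 _ _)).sub_right ((h2 _ _).symm)

theorem cap_mul_factor_of_lt {x y : ℤ} (h : y + 1 < x) (r : ℕ) :
    cap x * factor y r = factor (y + 1) r * cap x := by
  unfold factor
  split_ifs
  · simp
  · rw [mul_sub, sub_mul, cap_mul_tlU_of_lt h]; simp

theorem cap_mul_factor_of_gt {x y : ℤ} (h : x + 1 < y) (r : ℕ) :
    cap x * factor y r = factor (y - 1) r * cap x := by
  unfold factor
  split_ifs
  · simp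
  · rw [mul_sub, sub_mul, cap_mul_tlU_of_gt h]; simp

/-- The constant `[2]/[1]` is exactly the loop value. This is what kills a cap at a removable box,
whose shift is `1`. -/
theorem cap_mul_factor_one (x : ℤ) : cap x * factor x 1 = 0 := by
  rw [factor_of_ne x one_ne_zero, mul_sub, cap_mul_tlU_self, qRatio_one]; simp

theorem cap_mul_factor_succ {r : ℕ} (x : ℤ) (hr : r ≠ 0) :
    cap x * factor (x + 1) r = cap (x + 1) - qRatio r • cap x := by
  rw [factor_of_ne _ hr, mul_sub, cap_mul_tlU_succ]; simp

theorem cap_mul_factor_pred {r : ℕ} (x : ℤ) (hr : r ≠ 0) :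
    cap x * factor (x - 1) r = cap (x - 1) - qRatio r • cap x := by
  rw [factor_of_ne _ hr, mul_sub, cap_mul_tlU_pred]; simp

theorem cap_mul_factor_self (x : ℤ) {r : ℕ} (hr : r ≠ 0) :
    cap x * factor x r = (v + v⁻¹ - qRatio r) • cap x := by
  rw [factor_of_ne _ hr, mul_sub, cap_mul_tlU_self, mul_smul_comm, mul_one]
  exact (sub_smul _ _ _).symm

/-- The ladder identity. Expanding both factors gives a multiple of `cap (x + 1)` and two multiples
of `cap x`; the latter cancel by `qRatio_mul_sub`. The mirror image follows. -/
theorem cap_mul_factor_succ_mul {r : ℕ} (x : ℤ) (hr : r ≠ 0) :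
    cap x * factor (x + 1) r * factor x (r + 1) = (-qRatio (r + 1)) • cap (x + 1) := by
  have h := cap_mul_factor_pred (x + 1) (r := r + 1) (by omega)
  rw [add_sub_cancel_right] at h
  rw [cap_mul_factor_succ x hr, sub_mul, smul_mul_assoc, h, cap_mul_factor_self x (by omega),
    smul_smul, qRatio_mul_sub hr, one_smul, sub_sub_cancel_left]
  exact (neg_smul _ _).symm

theorem cap_mul_factor_pred_mul {r : ℕ} (x : ℤ) (hr : r ≠ 0) :
    cap x * factor (x - 1) r * factor x (r + 1) = (-qRatio (r + 1)) • cap (x - 1) := by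
  have h := cap_mul_factor_succ (x - 1) (r := r + 1) (by omega)
  rw [sub_add_cancel] at h
  rw [cap_mul_factor_pred x hr, sub_mul, smul_mul_assoc, h, cap_mul_factor_self x (by omega),
    smul_smul, qRatio_mul_sub hr, one_smul, sub_sub_cancel_left]
  exact (neg_smul _ _).symm

/-- The product of the factors of the boxes `(i, b - 1), …, (i, 0)` of the `i`-th row. -/
noncomputable def rowOp (r : ℕ → ℕ → ℕ) (i : ℕ) : ℕ → Module.End Qv ((ℤ → Bool) → Qv)
  | 0 => 1
  | j + 1 => factor (j - i - 1) (r i j) * rowOp r i j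

/-- The product of the factors of the boxes `(a - 1, j), …, (0, j)` of the `j`-th column. -/
noncomputable def colOp (r : ℕ → ℕ → ℕ) (j : ℕ) : ℕ → Module.End Qv ((ℤ → Bool) → Qv)
  | 0 => 1
  | i + 1 => factor (j - i - 1) (r i j) * colOp r j i

/-- The product of the factors of the boxes of a rectangle with `a` rows and `b` columns. -/
noncomputable def rectOp (r : ℕ → ℕ → ℕ) (b : ℕ) : ℕ → Module.End Qv ((ℤ → Bool) → Qv)
  | 0 => 1
  | i + 1 => rowOp r i b * rectOp r b i

theorem rowOp_commute_factor (r : ℕ → ℕ → ℕ) (i : ℕ) {b : ℕ} {y : ℤ} (s : ℕ)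
    (h : (b : ℤ) - i ≤ y) : Commute (rowOp r i b) (factor y s) := by
  induction b with
  | zero => exact Commute.one_left _
  | succ b ih =>
    push_cast at h
    exact ((factor_commute_of_lt (by omega) _ _).symm).mul_left (ih (by omega))

theorem colOp_commute_factor (r : ℕ → ℕ → ℕ) (j : ℕ) {a : ℕ} {y : ℤ} (s : ℕ)
    (h : y + 2 ≤ (j : ℤ) - a) : Commute (colOp r j a) (factor y s) := by
  induction a with
  | zero => exact Commute.one_left _
  | succ a ih =>
    push_cast at h
    exact (factor_commute_of_lt (by omega) _ _).mul_left (ih (by omega))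

/-- Under `h` the places of the row factors and those of the column factors differ by at least two.
-/
theorem rowOp_commute_colOp (r : ℕ → ℕ → ℕ) {i j a b : ℕ} (h : (b : ℤ) - i ≤ j - a) :
    Commute (rowOp r i b) (colOp r j a) := by
  induction a with
  | zero => exact Commute.one_right _
  | succ a ih =>
    push_cast at h
    exact (rowOp_commute_factor r i _ (by omega)).mul_right (ih (by omega))

theorem rectOp_zero_col (r : ℕ → ℕ → ℕ) (a : ℕ) : rectOp r 0 a = 1 := by
  induction a with
  | zero => rfl
  | succ a ih => rw [rectOp, ih, rowOp, one_mul]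

theorem rectOp_succ_col (r : ℕ → ℕ → ℕ) (a b : ℕ) :
    rectOp r (b + 1) a = colOp r b a * rectOp r b a := by
  induction a with
  | zero => simp [rectOp, colOp]
  | succ a ih =>
    have h : Commute (rowOp r a b) (colOp r b a) := rowOp_commute_colOp r le_rfl
    rw [rectOp, rowOp, colOp, rectOp, ih, mul_assoc, ← mul_assoc (rowOp r a b), h.eq]
    simp only [mul_assoc]

/-! ### Moving caps through rows, columns and rectangles -/

/-- All factors of the row lie at places at most `x - 2`, and the cap moves them one step to the
right. As the place of a box is `j - i - 1`, this is the passage from row `i + 1` to row `i`. In the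
companion `cap_mul_colOp` the factors lie to the right of the cap and column `j + 1` becomes column
`j`. -/
theorem cap_mul_rowOp {r r' : ℕ → ℕ → ℕ} {i b : ℕ} {x : ℤ} (h : (b : ℤ) - (i + 1) ≤ x)
    (hr : ∀ j < b, r' i j = r (i + 1) j) :
    cap x * rowOp r (i + 1) b = rowOp r' i b * cap x := by
  induction b with
  | zero => simp [rowOp]
  | succ b ih =>
    push_cast at h
    rw [rowOp, rowOp, hr b (by omega), ← mul_assoc, cap_mul_factor_of_lt (by push_cast; omega),
      mul_assoc, ih (by omega) (fun j hj => hr j (by omega)), ← mul_assoc]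
    congr 3
    push_cast
    ring

theorem cap_mul_colOp {r r' : ℕ → ℕ → ℕ} {j a : ℕ} {x : ℤ} (h : x + 1 ≤ (j : ℤ) - a)
    (hr : ∀ i < a, r' i j = r i (j + 1)) :
    cap x * colOp r (j + 1) a = colOp r' j a * cap x := by
  induction a with
  | zero => simp [colOp]
  | succ a ih =>
    push_cast at h
    rw [colOp, colOp, hr a (by omega), ← mul_assoc, cap_mul_factor_of_gt (by push_cast; omega),
      mul_assoc, ih (by omega) (fun j hj => hr j (by omega)), ← mul_assoc]
    congr 3
    push_cast
    ring

theorem exists_cap_mul_rowOp (r : ℕ → ℕ → ℕ) {i b : ℕ} {x : ℤ} (h : (b : ℤ) - i ≤ x) :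
    ∃ Z, cap x * rowOp r i b = Z * cap x := by
  induction b with
  | zero => exact ⟨1, by simp [rowOp]⟩
  | succ b ih =>
    push_cast at h
    obtain ⟨Z, hZ⟩ := ih (by omega)
    refine ⟨factor (b - i - 1 + 1) (r i b) * Z, ?_⟩
    rw [rowOp, ← mul_assoc, cap_mul_factor_of_lt (by omega), mul_assoc, hZ, mul_assoc]

theorem exists_cap_mul_colOp (r : ℕ → ℕ → ℕ) {j a : ℕ} {x : ℤ} (h : x + 2 ≤ (j : ℤ) - a) :
    ∃ Z, cap x * colOp r j a = Z * cap x := by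
  induction a with
  | zero => exact ⟨1, by simp [colOp]⟩
  | succ a ih =>
    push_cast at h
    obtain ⟨Z, hZ⟩ := ih (by omega)
    refine ⟨factor (j - a - 1 - 1) (r a j) * Z, ?_⟩
    rw [colOp, ← mul_assoc, cap_mul_factor_of_gt (by omega), mul_assoc, hZ, mul_assoc]

theorem rowOp_eq_of_zero {r : ℕ → ℕ → ℕ} {i c b : ℕ} (hcb : c ≤ b)
    (h : ∀ j, c ≤ j → j < b → r i j = 0) : rowOp r i b = rowOp r i c := by
  induction b, hcb using Nat.le_induction with
  | base => rfl
  | succ b hb ih =>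
    rw [rowOp, h b hb (by omega), factor_zero, one_mul, ih fun j h1 h2 => h j h1 (by omega)]

theorem rowOp_congr {r r' : ℕ → ℕ → ℕ} {i b : ℕ} (h : ∀ j < b, r i j = r' i j) :
    rowOp r i b = rowOp r' i b := by
  induction b with
  | zero => rfl
  | succ b ih => rw [rowOp, rowOp, h b (by omega), ih fun j hj => h j (by omega)]

theorem rectOp_congr {r r' : ℕ → ℕ → ℕ} {a b : ℕ} (h : ∀ i < a, ∀ j < b, r i j = r' i j) :
    rectOp r b a = rectOp r' b a := by
  induction a with
  | zero => rfl
  | succ a ih =>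
    rw [rectOp, rectOp, rowOp_congr (h a (by omega)), ih fun i hi => h i (by omega)]

/-- Since the aim is to show that a product vanishes on the vacuum, the operator `Z` left behind by
the commuting factors is irrelevant; only the rows that the cap still has to cross are kept. -/
theorem exists_cap_mul_rectOp_row {r : ℕ → ℕ → ℕ} {a b p c : ℕ} {x : ℤ} (hpa : p ≤ a)
    (hcb : c ≤ b) (hx : (c : ℤ) - p ≤ x)
    (h : ∀ i j, p ≤ i → i < a → c ≤ j → j < b → r i j = 0) :
    ∃ Z, cap x * rectOp r b a = Z * (cap x * rectOp r b p) := by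
  induction a, hpa using Nat.le_induction with
  | base => exact ⟨1, by simp⟩
  | succ a ha ih =>
    obtain ⟨Z, hZ⟩ := ih fun i j h1 h2 => h i j h1 (by omega)
    obtain ⟨Y, hY⟩ := exists_cap_mul_rowOp r (i := a) (b := c) (x := x) (by omega)
    refine ⟨Y * Z, ?_⟩
    rw [rectOp, rowOp_eq_of_zero hcb fun j h1 h2 => h a j ha (by omega) h1 h2, ← mul_assoc, hY,
      mul_assoc, hZ, mul_assoc]

theorem exists_cap_mul_rectOp_col {r : ℕ → ℕ → ℕ} {a b q : ℕ} {x : ℤ} (hqb : q ≤ b)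
    (hx : x + 2 ≤ (q : ℤ) - a) :
    ∃ Z, cap x * rectOp r b a = Z * (cap x * rectOp r q a) := by
  induction b, hqb using Nat.le_induction with
  | base => exact ⟨1, by simp⟩
  | succ b hb ih =>
    obtain ⟨Z, hZ⟩ := ih
    obtain ⟨Y, hY⟩ := exists_cap_mul_colOp r (j := b) (a := a) (x := x) (by omega)
    refine ⟨Y * Z, ?_⟩
    rw [rectOp_succ_col, ← mul_assoc, hY, mul_assoc, hZ, mul_assoc]

theorem cap_rectOp_vac_of_ge (r : ℕ → ℕ → ℕ) {a b : ℕ} {x : ℤ} (hx : (b : ℤ) ≤ x) :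
    (cap x * rectOp r b a) (mayaInd vacSeq) = 0 := by
  obtain ⟨Z, hZ⟩ := exists_cap_mul_rectOp_row (r := r) (a := a) (b := b) (p := 0) (c := b) (x := x)
    (by omega) le_rfl (by simpa using hx) (by intros; omega)
  rw [hZ, rectOp, mul_one, Module.End.mul_apply, cap_vac_of_ne (by omega), map_zero]

theorem cap_rectOp_vac_of_le (r : ℕ → ℕ → ℕ) {a b : ℕ} {x : ℤ} (hx : x + 2 ≤ -(a : ℤ)) :
    (cap x * rectOp r b a) (mayaInd vacSeq) = 0 := by
  obtain ⟨Z, hZ⟩ := exists_cap_mul_rectOp_col (r := r) (a := a) (b := b) (q := 0) (x := x)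
    (by omega) (by simpa using hx)
  rw [hZ, rectOp_zero_col, mul_one, Module.End.mul_apply, cap_vac_of_ne (by omega), map_zero]

/-- Each row contributes one rung, two neighbouring boxes with shifts `r` and `r + 1`, which moves
the cap one step to the right. The lowest rung comes first; its left factor is brought next to the
cap through the remainder of the column `q + 1`, with which it commutes. -/
theorem cap_mul_colOp_ladder {r : ℕ → ℕ → ℕ} {p q : ℕ} (h0 : ∀ i < p, r i (q + 1) ≠ 0)
    (h : ∀ i < p, r i q = r i (q + 1) + 1) :
    ∃ c : Qv, cap (q - p) * colOp r (q + 1) p * colOp r q p = c • cap q := by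
  induction p with
  | zero => exact ⟨1, by simp [colOp]⟩
  | succ p ih =>
    obtain ⟨c, hc⟩ := ih (fun i hi => h0 i (by omega)) (fun i hi => h i (by omega))
    refine ⟨-qRatio (r p (q + 1) + 1) * c, ?_⟩
    have e1 : ((q + 1 : ℕ) : ℤ) - p - 1 = (q - (p + 1 : ℕ) : ℤ) + 1 := by push_cast; ring
    have e2 : (q : ℤ) - p - 1 = (q - (p + 1 : ℕ) : ℤ) := by push_cast; ring
    have e3 : (q - (p + 1 : ℕ) : ℤ) + 1 = q - p := by push_cast; ring
    have h1 : Commute (colOp r (q + 1) p) (factor (q - (p + 1 : ℕ)) (r p (q + 1) + 1)) :=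
      colOp_commute_factor r _ _ (by push_cast; omega)
    rw [colOp, colOp, h p (by omega), e1, e2, mul_assoc, mul_assoc, ← mul_assoc (colOp r (q + 1) p),
      h1.eq, ← mul_assoc, ← mul_assoc, ← mul_assoc, cap_mul_factor_succ_mul _ (h0 p (by omega)), e3,
      smul_mul_assoc, smul_mul_assoc, hc, smul_smul]

theorem cap_mul_rowOp_ladder {r : ℕ → ℕ → ℕ} {p q : ℕ} (h0 : ∀ j < q, r (p + 1) j ≠ 0)
    (h : ∀ j < q, r p j = r (p + 1) j + 1) :
    ∃ c : Qv, cap (q - p - 2) * rowOp r (p + 1) q * rowOp r p q = c • cap (-p - 2) := by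
  induction q with
  | zero => exact ⟨1, by simp [rowOp]⟩
  | succ q ih =>
    obtain ⟨c, hc⟩ := ih (fun i hi => h0 i (by omega)) (fun i hi => h i (by omega))
    refine ⟨-qRatio (r (p + 1) q + 1) * c, ?_⟩
    have e1 : (q : ℤ) - (p + 1 : ℕ) - 1 = (((q + 1 : ℕ) : ℤ) - p - 2) - 1 := by push_cast; ring
    have e2 : (q : ℤ) - p - 1 = ((q + 1 : ℕ) : ℤ) - p - 2 := by push_cast; ring
    have e3 : (((q + 1 : ℕ) : ℤ) - p - 2) - 1 = q - p - 2 := by push_cast; ring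
    have h1 : Commute (rowOp r (p + 1) q)
        (factor (((q + 1 : ℕ) : ℤ) - p - 2) (r (p + 1) q + 1)) :=
      rowOp_commute_factor r _ _ (by push_cast; omega)
    rw [rowOp, rowOp, h q (by omega), e1, e2, mul_assoc, mul_assoc, ← mul_assoc (rowOp r (p + 1) q),
      h1.eq, ← mul_assoc, ← mul_assoc, ← mul_assoc, cap_mul_factor_pred_mul _ (h0 q (by omega)), e3,
      smul_mul_assoc, smul_mul_assoc, hc, smul_smul]

/-- After climbing the ladder the cap stands to the right of all remaining columns, and there it
annihilates the vacuum. The row version pushes the cap out on the left. -/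
theorem cap_colOp_rectOp_vac {r : ℕ → ℕ → ℕ} {p q : ℕ} (h0 : ∀ i < p, r i (q + 1) ≠ 0)
    (h : ∀ i < p, r i q = r i (q + 1) + 1) :
    (cap (q - p) * rectOp r (q + 2) p) (mayaInd vacSeq) = 0 := by
  obtain ⟨c, hc⟩ := cap_mul_colOp_ladder h0 h
  rw [rectOp_succ_col, rectOp_succ_col, ← mul_assoc, ← mul_assoc, hc, smul_mul_assoc,
    LinearMap.smul_apply, cap_rectOp_vac_of_ge r le_rfl, smul_zero]

theorem cap_rowOp_rectOp_vac {r : ℕ → ℕ → ℕ} {p q b : ℕ} (h0 : ∀ j < q, r (p + 1) j ≠ 0)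
    (h : ∀ j < q, r p j = r (p + 1) j + 1) :
    (cap (q - p - 2) * rowOp r (p + 1) q * rowOp r p q * rectOp r b p) (mayaInd vacSeq) = 0 := by
  obtain ⟨c, hc⟩ := cap_mul_rowOp_ladder h0 h
  rw [hc, smul_mul_assoc, LinearMap.smul_apply, cap_rectOp_vac_of_le r (by omega), smul_zero]

/-! ### Shifts of a partition -/

/-- The recursion for the shifts `r_{ij}` of a partition, whose boxes are those with
`r_{ij} ≠ 0`. -/
structure IsShift (r : ℕ → ℕ → ℕ) : Prop where
  right_zero : ∀ i j, r i j = 0 → r i (j + 1) = 0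
  down_zero : ∀ i j, r i j = 0 → r (i + 1) j = 0
  eq_max : ∀ i j, r i j ≠ 0 → r i j = max (r i (j + 1)) (r (i + 1) j) + 1

namespace IsShift

variable {r : ℕ → ℕ → ℕ}

theorem right_zero_of_le (hr : IsShift r) {i j j' : ℕ} (h : j ≤ j') (h0 : r i j = 0) :
    r i j' = 0 := by
  induction j', h using Nat.le_induction with
  | base => exact h0
  | succ k _ ih => exact hr.right_zero _ _ ih

theorem down_zero_of_le (hr : IsShift r) {i i' j : ℕ} (h : i ≤ i') (h0 : r i j = 0) :
    r i' j = 0 := by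
  induction i', h using Nat.le_induction with
  | base => exact h0
  | succ k _ ih => exact hr.down_zero _ _ ih

theorem ne_zero_of_le (hr : IsShift r) {i i' j j' : ℕ} (hi : i ≤ i') (hj : j ≤ j')
    (h : r i' j' ≠ 0) : r i j ≠ 0 := fun h0 =>
  h (hr.down_zero_of_le hi (hr.right_zero_of_le hj h0))

theorem col_ladder (hr : IsShift r) {p q : ℕ} (h0 : ∀ i ≤ p, r i (q + 1) ≠ 0)
    (h : r (p + 1) q ≤ r p (q + 1)) : ∀ i ≤ p, r i q = r i (q + 1) + 1 := by
  intro i hi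
  induction hi using Nat.decreasingInduction with
  | self =>
    have := hr.eq_max p q (hr.ne_zero_of_le le_rfl (Nat.le_succ q) (h0 p le_rfl))
    omega
  | of_succ i hi ih =>
    have h1 := hr.eq_max i q (hr.ne_zero_of_le le_rfl (Nat.le_succ q) (h0 i (by omega)))
    have h2 := hr.eq_max i (q + 1) (h0 i (by omega))
    omega

theorem row_ladder (hr : IsShift r) {p q : ℕ} (h0 : ∀ j ≤ q, r (p + 1) j ≠ 0)
    (h : r p (q + 1) ≤ r (p + 1) q) : ∀ j ≤ q, r p j = r (p + 1) j + 1 := by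
  intro j hj
  induction hj using Nat.decreasingInduction with
  | self =>
    have := hr.eq_max p q (hr.ne_zero_of_le (Nat.le_succ p) le_rfl (h0 q le_rfl))
    omega
  | of_succ j hj ih =>
    have h1 := hr.eq_max p j (hr.ne_zero_of_le (Nat.le_succ p) le_rfl (h0 j (by omega)))
    have h2 := hr.eq_max (p + 1) j (h0 j (by omega))
    omega

end IsShift

theorem cap_row_vac (r : ℕ → ℕ → ℕ) (q : ℕ) (h0 : ∀ j < q, r 0 j ≠ 0) :
    (cap (q - 1) * rowOp r 0 q) (mayaInd vacSeq) = mayaInd vacSeq := by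
  induction q with
  | zero => simpa [rowOp] using cap_vac
  | succ q ih =>
    obtain ⟨Z, hZ⟩ := exists_cap_mul_rowOp r (i := 0) (b := q) (x := q) (by simp)
    have e1 : ((q + 1 : ℕ) : ℤ) - 1 = q := by push_cast; ring
    have e2 : (q : ℤ) - (0 : ℕ) - 1 = q - 1 := by push_cast; ring
    rw [rowOp, e1, e2, ← mul_assoc, cap_mul_factor_pred _ (h0 q (by omega)), sub_mul,
      smul_mul_assoc, hZ, LinearMap.sub_apply, ih fun j hj => h0 j (by omega),
      LinearMap.smul_apply, Module.End.mul_apply, cap_vac_of_ne (by omega)]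
    simp

theorem cap_col_vac (r : ℕ → ℕ → ℕ) (p : ℕ) (h0 : ∀ i < p, r i 0 ≠ 0) :
    (cap (-p - 1) * colOp r 0 p) (mayaInd vacSeq) = mayaInd vacSeq := by
  induction p with
  | zero => simpa [colOp] using cap_vac
  | succ p ih =>
    obtain ⟨Z, hZ⟩ := exists_cap_mul_colOp r (j := 0) (a := p) (x := -p - 2) (by push_cast; omega)
    have e1 : -((p + 1 : ℕ) : ℤ) - 1 = -p - 2 := by push_cast; ring
    have e2 : ((0 : ℕ) : ℤ) - p - 1 = -p - 2 + 1 := by push_cast; ring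
    have e3 : -(p : ℤ) - 2 + 1 = -p - 1 := by ring
    rw [colOp, e1, e2, ← mul_assoc, cap_mul_factor_succ _ (h0 p (by omega)), sub_mul,
      smul_mul_assoc, hZ, e3, LinearMap.sub_apply, ih fun j hj => h0 j (by omega),
      LinearMap.smul_apply, Module.End.mul_apply, cap_vac_of_ne (by omega)]
    simp

/-- The core of the corner case: the hook formed by row `p` and column `q` is absorbed by the cap,
and every shift in the rectangle drops by one. At each step the larger of the two shifts next to the
inner end of the hook decides whether a column or a row is peeled off: its maximality gives the
ladder that kills one of the two terms of `cap * factor`. -/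
theorem cap_corner_vac {r : ℕ → ℕ → ℕ} (hr : IsShift r) (p q : ℕ) (hp : ∀ j < q, r p j ≠ 0)
    (hq : ∀ i < p, r i q ≠ 0) :
    (cap (q - p - 1) * rowOp r p q * colOp r q p * rectOp r q p) (mayaInd vacSeq) =
      rectOp (fun i j => r i j - 1) q p (mayaInd vacSeq) := by
  induction hm : p + q generalizing p q with
  | zero =>
    obtain rfl : p = 0 := by omega
    obtain rfl : q = 0 := by omega
    simpa [rowOp, colOp, rectOp] using cap_vac
  | succ m ih =>
  rcases p with _ | p
  · simpa [colOp, rectOp] using cap_row_vac r q hp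
  rcases q with _ | q
  · have := cap_col_vac r (p + 1) hq
    simpa [rowOp, rectOp_zero_col] using this
  have hcomm : Commute (rowOp r (p + 1) (q + 1)) (colOp r (q + 1) (p + 1)) :=
    rowOp_commute_colOp r (by push_cast; omega)
  rcases le_total (r (p + 1) q) (r p (q + 1)) with hle | hle
  -- The maximum at `(p, q)` is attained on the right, so columns `q` and `q + 1` form a ladder.
  · have hl := hr.col_ladder (fun i hi => hq i (by omega)) hle
    obtain ⟨Z, hZ⟩ := exists_cap_mul_rowOp r (i := p + 1) (b := q) (x := q - p - 1)
      (by push_cast; omega)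
    have hc : Commute (rowOp r (p + 1) q) (colOp r (q + 1) (p + 1)) :=
      rowOp_commute_colOp r (by push_cast; omega)
    have hs : cap (q - p - 1 - 1) * colOp r (q + 1) (p + 1) =
        colOp (fun i j => r i j - 1) q (p + 1) * cap (q - p - 1 - 1) :=
      cap_mul_colOp (by push_cast; omega) fun i hi => by simp [hl i (by omega)]
    -- The term in which the cap stays in place: it passes the rest of the row and dies on the
    -- ladder.
    have h1 : (cap (q - p - 1 : ℤ) * rowOp r (p + 1) q * colOp r (q + 1) (p + 1) *
        rectOp r (q + 1) (p + 1)) (mayaInd vacSeq) = 0 := by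
      have h2 := cap_colOp_rectOp_vac (r := r) (p := p + 1) (q := q) (fun i hi => hq i (by omega))
        (fun i hi => hl i (by omega))
      have e : (q : ℤ) - (p + 1 : ℕ) = q - p - 1 := by push_cast; ring
      rw [rectOp_succ_col, e] at h2
      rw [hZ, mul_assoc, mul_assoc, Module.End.mul_apply, ← mul_assoc, mul_assoc, h2, map_zero]
    -- The term in which the cap moves left: it passes column `q + 1`, which takes the place of
    -- column `q` with the right shifts because of the ladder. What remains is the corner `(p + 1,
    -- q)`.
    have h3 : (cap (q - p - 1 - 1 : ℤ) * rowOp r (p + 1) q * colOp r (q + 1) (p + 1) *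
        rectOp r (q + 1) (p + 1)) (mayaInd vacSeq) =
          rectOp (fun i j => r i j - 1) (q + 1) (p + 1) (mayaInd vacSeq) := by
      have h4 := ih (p + 1) q (fun j hj => hp j (by omega))
        (fun i hi => hr.ne_zero_of_le le_rfl (Nat.le_succ q) (hq i hi)) (by omega)
      have e : (q : ℤ) - (p + 1 : ℕ) - 1 = q - p - 1 - 1 := by push_cast; ring
      rw [e] at h4
      rw [rectOp_succ_col, rectOp_succ_col, Module.End.mul_apply (colOp _ _ _), ← h4,
        ← Module.End.mul_apply]
      congr 1
      rw [← mul_assoc, mul_assoc (cap _), hc.eq, ← mul_assoc (cap _), hs]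
      simp only [mul_assoc]
    have e1 : ((q + 1 : ℕ) : ℤ) - (p + 1 : ℕ) - 1 = q - p - 1 := by push_cast; ring
    have e2 : (q : ℤ) - (p + 1 : ℕ) - 1 = q - p - 1 - 1 := by push_cast; ring
    rw [rowOp, e1, e2, ← mul_assoc, cap_mul_factor_pred _ (hp q (by omega)), sub_mul, sub_mul,
      sub_mul, smul_mul_assoc, smul_mul_assoc, smul_mul_assoc, LinearMap.sub_apply, h3,
      LinearMap.smul_apply, h1, smul_zero, sub_zero]
  · have hl := hr.row_ladder (fun i hi => hp i (by omega)) hle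
    obtain ⟨Z, hZ⟩ := exists_cap_mul_colOp r (j := q + 1) (a := p) (x := q - p - 1)
      (by push_cast; omega)
    have hc : Commute (rowOp r (p + 1) (q + 1)) (colOp r (q + 1) p) :=
      rowOp_commute_colOp r (by push_cast; omega)
    have hc' : Commute (rowOp r p (q + 1)) (colOp r (q + 1) p) :=
      rowOp_commute_colOp r (by push_cast; omega)
    have hs : cap (q - p - 1 + 1) * rowOp r (p + 1) (q + 1) =
        rowOp (fun i j => r i j - 1) p (q + 1) * cap (q - p - 1 + 1) :=
      cap_mul_rowOp (by push_cast; omega) fun i hi => by simp [hl i (by omega)]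
    have h1 : (cap (q - p - 1 : ℤ) * colOp r (q + 1) p * rowOp r (p + 1) (q + 1) *
        rectOp r (q + 1) (p + 1)) (mayaInd vacSeq) = 0 := by
      have h2 := cap_rowOp_rectOp_vac (r := r) (p := p) (q := q + 1) (b := q + 1)
        (fun i hi => hp i (by omega)) (fun i hi => hl i (by omega))
      have e : ((q + 1 : ℕ) : ℤ) - p - 2 = q - p - 1 := by push_cast; ring
      rw [e] at h2
      rw [hZ, mul_assoc, mul_assoc, Module.End.mul_apply, rectOp, ← mul_assoc, ← mul_assoc, h2,
        map_zero]
    have h3 : (cap (q - p - 1 + 1 : ℤ) * colOp r (q + 1) p * rowOp r (p + 1) (q + 1) *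
        rectOp r (q + 1) (p + 1)) (mayaInd vacSeq) =
          rectOp (fun i j => r i j - 1) (q + 1) (p + 1) (mayaInd vacSeq) := by
      have h4 := ih p (q + 1) (fun j hj => hr.ne_zero_of_le (Nat.le_succ p) le_rfl (hp j hj))
        (fun i hi => hq i (by omega)) (by omega)
      have e : ((q + 1 : ℕ) : ℤ) - p - 1 = q - p - 1 + 1 := by push_cast; ring
      rw [e] at h4
      rw [rectOp, rectOp, Module.End.mul_apply (rowOp _ _ _), ← h4,
        ← Module.End.mul_apply]
      congr 1
      rw [← mul_assoc, mul_assoc (cap _), ← hc.eq, ← mul_assoc (cap _), hs, mul_assoc (cap _) (rowOp r p _), hc'.eq]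
      simp only [mul_assoc]
    have e1 : ((q + 1 : ℕ) : ℤ) - (p + 1 : ℕ) - 1 = q - p - 1 := by push_cast; ring
    have e2 : ((q + 1 : ℕ) : ℤ) - p - 1 = q - p - 1 + 1 := by push_cast; ring
    -- In this case the column factors are moved in front of the row factors, so that the cap meets
    -- the lowest box of the column first.
    rw [mul_assoc (cap _), hcomm.eq, colOp, e1, e2, ← mul_assoc, ← mul_assoc,
      cap_mul_factor_succ _ (hq p (by omega)), sub_mul, sub_mul,
      sub_mul, smul_mul_assoc, smul_mul_assoc, smul_mul_assoc, LinearMap.sub_apply, h3,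
      LinearMap.smul_apply, h1, smul_zero, sub_zero]

/-- The shifts of the partition obtained by deleting the row `p` and the column `q` through an
inner corner. -/
def delShift (r : ℕ → ℕ → ℕ) (p q i j : ℕ) : ℕ :=
  if i < p then if j < q then r i j - 1 else r i (j + 1) else if j < q then r (i + 1) j else 0

/-- Beyond the hook handled by `cap_corner_vac`, the columns to the right and the rows below only
slide by one step when the cap passes them. -/
theorem cap_rectOp_delShift {r : ℕ → ℕ → ℕ} (hr : IsShift r) {p q a b : ℕ}
    (hp : ∀ j < q, r p j ≠ 0) (hq : ∀ i < p, r i q ≠ 0) (h0 : r p q = 0) (ha : p ≤ a)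
    (hb : q ≤ b) :
    (cap (q - p - 1) * rectOp r (b + 1) (a + 1)) (mayaInd vacSeq) =
      rectOp (delShift r p q) b a (mayaInd vacSeq) := by
  have hz : ∀ i j, p ≤ i → q ≤ j → r i j = 0 := fun i j hi hj =>
    hr.down_zero_of_le hi (hr.right_zero_of_le hj h0)
  induction a, ha using Nat.le_induction with
  | base =>
    rw [rectOp, rowOp_eq_of_zero (c := q) (by omega) fun j hj _ => hz p j le_rfl hj, ← mul_assoc]
    induction b, hb using Nat.le_induction with
    | base =>
      rw [rectOp_succ_col, ← mul_assoc, cap_corner_vac hr p q hp hq]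
      congr 1
      refine rectOp_congr fun i hi j hj => ?_
      simp [delShift, hi, hj]
    | succ b hb ih =>
      have hc : Commute (rowOp r p q) (colOp r (b + 1) p) :=
        rowOp_commute_colOp r (by push_cast; omega)
      rw [rectOp_succ_col r, rectOp_succ_col (delShift r p q), Module.End.mul_apply (colOp _ _ _),
        ← ih, ← Module.End.mul_apply]
      congr 1
      rw [mul_assoc (cap _), ← mul_assoc (rowOp r p q), hc.eq, ← mul_assoc, ← mul_assoc,
        cap_mul_colOp (r' := delShift r p q) (by omega) fun i hi => by
          rw [delShift, if_pos hi, if_neg (by omega)]]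
      simp only [mul_assoc]
  | succ a ha ih =>
    rw [rectOp, rowOp_eq_of_zero (c := q) (by omega) fun j hj _ => hz _ j (by omega) hj,
      rectOp.eq_2 (delShift r p q), Module.End.mul_apply (rowOp _ _ _), ← ih,
      ← Module.End.mul_apply]
    congr 1
    rw [← mul_assoc, cap_mul_rowOp (r' := delShift r p q) (by omega) fun j hj => by
      rw [delShift, if_neg (by omega), if_pos hj], rowOp_eq_of_zero (c := q) hb fun j hj _ => by
      rw [delShift, if_neg (by omega), if_neg (by omega)]]
    simp only [mul_assoc]

/-- Subtracting one above and to the left of the corner is compatible with the maximum. Next to the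
deleted column, `r_{iq}` is replaced by `r_{i,q+1}`: either `r_{iq} = r_{i,q+1} + 1`, or `r_{iq} =
r_{i+1,q} + 1`, which is at most the competing shift `r_{i+1,q-1}`. The same holds next to the
deleted row. -/
theorem IsShift.delShift {r : ℕ → ℕ → ℕ} (hr : IsShift r) {p q : ℕ}
    (hp : ∀ j < q, r p j ≠ 0) (hq : ∀ i < p, r i q ≠ 0) (h0 : r p q = 0) :
    IsShift (delShift r p q) := by
  have hz : ∀ i j, p ≤ i → q ≤ j → r i j = 0 := fun i j hi hj =>
    hr.down_zero_of_le hi (hr.right_zero_of_le hj h0)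
  -- Such a box has a right neighbour in the diagram, so the truncated subtraction leaves a nonzero
  -- shift.
  have h2 : ∀ i j, i < p → j < q → 2 ≤ r i j := by
    intro i j hi hj
    have h3 := hr.eq_max i j (hr.ne_zero_of_le le_rfl hj.le (hq i hi))
    have h4 := hr.ne_zero_of_le (i := i) (j := j + 1) le_rfl hj (hq i hi)
    omega
  refine ⟨fun i j h => ?_, fun i j h => ?_, fun i j h => ?_⟩
  · unfold Grassmannian.delShift at h ⊢
    split_ifs at h ⊢ <;> first
      | rfl
      | omega
      | (have := h2 i j ‹_› ‹_›; omega)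
      | exact hr.right_zero _ _ h
  · unfold Grassmannian.delShift at h ⊢
    split_ifs at h ⊢ <;> first
      | rfl
      | omega
      | (have := h2 i j ‹_› ‹_›; omega)
      | exact hr.down_zero _ _ h
  · unfold Grassmannian.delShift at h ⊢
    have key : ∀ i j, r i j = 0 ∨ r i j = max (r i (j + 1)) (r (i + 1) j) + 1 := fun i j =>
      or_iff_not_imp_left.mpr (hr.eq_max i j)
    rcases lt_or_ge i p with hi | hi <;> rcases lt_or_ge j q with hj | hj
    · have k0 := h2 i j hi hj
      have k1 := key i j
      have k2 := key i (j + 1)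
      have k3 := key (i + 1) j
      have k4 := hr.right_zero (i + 1) j
      have k5 := hr.down_zero i (j + 1)
      simp only [hi, hj, if_true]
      rcases Nat.lt_or_eq_of_le (Nat.succ_le_of_lt hi) with h3 | h3 <;>
        rcases Nat.lt_or_eq_of_le (Nat.succ_le_of_lt hj) with h4 | h4
      · have k6 := h2 i (j + 1) hi h4
        have k7 := h2 (i + 1) j h3 hj
        simp only [Nat.succ_eq_add_one] at h3 h4
        simp only [h3, h4, if_true]
        omega
      · subst h4
        have k6 := hq i hi
        have k7 := h2 (i + 1) j h3 hj
        have k8 := hq (i + 1) h3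
        simp only [Nat.succ_eq_add_one] at h3 k6 k7 k8 ⊢
        simp only [h3, if_true, lt_irrefl, if_false]
        omega
      · subst h3
        have k6 := hp j hj
        have k7 := h2 i (j + 1) hi h4
        have k8 := hp (j + 1) h4
        simp only [Nat.succ_eq_add_one] at h4 k6 k7 k8 ⊢
        simp only [h4, if_true, lt_irrefl, if_false]
        omega
      · subst h3 h4
        have k6 := hp j hj
        have k7 := hq i hi
        simp only [Nat.succ_eq_add_one] at h0 k6 k7 ⊢
        simp only [lt_irrefl, if_false]
        omega
    · have k1 := key i (j + 1)
      simp only [hi, if_true, not_lt.mpr hj, not_lt.mpr (hj.trans (Nat.le_succ j)), if_false] at h ⊢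
      split_ifs with h3
      · omega
      · have := hz (i + 1) (j + 1) (by omega) (by omega)
        omega
    · have k1 := key (i + 1) j
      simp only [hj, if_true, not_lt.mpr hi, not_lt.mpr (hi.trans (Nat.le_succ i)), if_false] at h ⊢
      split_ifs with h3
      · omega
      · have := hz (i + 1) (j + 1) (by omega) (by omega)
        omega
    · simp [not_lt.mpr hi, not_lt.mpr hj] at h

/-! ### The Maya diagram of a partition -/

open Classical in
/-- The Maya diagram of a partition with row lengths `L 0, L 1, …`. -/
noncomputable def mayaOf (L : ℕ → ℕ) : ℤ → Bool := fun x => decide (¬ ∃ i : ℕ, x = L i - i - 1)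

theorem mayaOf_eq_false {L : ℕ → ℕ} {x : ℤ} : mayaOf L x = false ↔ ∃ i : ℕ, x = L i - i - 1 := by
  simp [mayaOf]

theorem mayaOf_eq_true {L : ℕ → ℕ} {x : ℤ} : mayaOf L x = true ↔ ∀ i : ℕ, x ≠ L i - i - 1 := by
  simp [mayaOf]

theorem mayaOf_zero {L : ℕ → ℕ} (h : ∀ i, L i = 0) : mayaOf L = vacSeq := by
  funext x
  rcases lt_or_ge x 0 with hx | hx
  · rw [mayaOf_eq_false.mpr ⟨(-x - 1).toNat, by rw [h]; omega⟩]
    simp [vacSeq, hx]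
  · rw [mayaOf_eq_true.mpr fun i => by rw [h]; omega]
    simp [vacSeq, hx]

/-- The row lengths after deleting the row `p` and the column `L p`. -/
def delLen (L : ℕ → ℕ) (p i : ℕ) : ℕ := if i < p then L i - 1 else L (i + 1)

/-- The deleted row accounts for the value `false` at `x`, the deleted column for the value `true`
at `x + 1`. Lower rows lose one in their index and move right; upper rows lose one box and move
left. -/
theorem mayaOf_delLen {L : ℕ → ℕ} (hL : Antitone L) {p : ℕ} (hp : ∀ i < p, L p < L i) :
    mayaOf L = ins (L p - p - 1) false true (mayaOf (delLen L p)) := by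
  have hmono : ∀ i j, i ≤ j → L j ≤ L i := fun i j h => hL h
  funext y
  rcases lt_trichotomy y ((L p : ℤ) - p - 1) with hy | hy | hy
  · rw [ins_of_lt _ _ _ hy, Bool.eq_iff_iff, mayaOf_eq_true, mayaOf_eq_true, ← not_iff_not]
    push Not
    constructor
    · rintro ⟨i, hi⟩
      have h1 : p < i := by
        by_contra h1
        have := hmono i p (by omega)
        omega
      refine ⟨i - 1, ?_⟩
      rw [delLen, if_neg (by omega), show i - 1 + 1 = i by omega]
      omega
    · rintro ⟨i, hi⟩
      unfold delLen at hi
      split_ifs at hi with h1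
      · have := hp i h1
        omega
      · exact ⟨i + 1, by push_cast; omega⟩
  · rw [hy, ins_self, mayaOf_eq_false]
    exact ⟨p, rfl⟩
  · rcases eq_or_ne y ((L p : ℤ) - p - 1 + 1) with h0 | h0
    · rw [h0, ins_succ, mayaOf_eq_true]
      intro i
      rcases lt_or_ge i p with h1 | h1
      · have := hp i h1
        omega
      · have := hmono p i h1
        omega
    rw [ins_of_gt _ _ _ (by omega), Bool.eq_iff_iff, mayaOf_eq_true, mayaOf_eq_true, ← not_iff_not]
    push Not
    constructor
    · rintro ⟨i, hi⟩
      have h1 : i < p := by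
        by_contra h1
        have := hmono p i (by omega)
        omega
      have := hp i h1
      refine ⟨i, ?_⟩
      rw [delLen, if_pos h1]
      omega
    · rintro ⟨i, hi⟩
      unfold delLen at hi
      split_ifs at hi with h1
      · have := hp i h1
        exact ⟨i, by omega⟩
      · have := hmono p (i + 1) (by omega)
        omega

theorem rectOp_eq_of_zero {r : ℕ → ℕ → ℕ} {a b a' b' : ℕ} (ha : a ≤ a') (hb : b ≤ b')
    (h : ∀ i j, a ≤ i ∨ b ≤ j → r i j = 0) : rectOp r b' a' = rectOp r b a := by
  induction a', ha using Nat.le_induction with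
  | base =>
    induction a with
    | zero => rfl
    | succ a ih =>
      clear ih
      have : ∀ c, rectOp r b' c = rectOp r b c := by
        intro c
        induction c with
        | zero => rfl
        | succ c ih => rw [rectOp, rectOp, ih, rowOp_eq_of_zero hb fun j hj _ => h _ _ (Or.inr hj)]
      exact this _
  | succ c hc ih =>
    rw [rectOp, ih, rowOp_eq_of_zero (c := 0) (by omega) fun j _ _ => h _ _ (Or.inl hc), rowOp,
      one_mul]

/-! ### Caps applied to the product over a partition -/

section

variable {r : ℕ → ℕ → ℕ} {L : ℕ → ℕ}

theorem IsShift.antitone (hr : IsShift r) (hL : ∀ i j, r i j ≠ 0 ↔ j < L i) : Antitone L := by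
  refine antitone_nat_of_succ_le fun i => ?_
  by_contra h
  push Not at h
  exact (hL (i + 1) (L i)).mpr h (hr.down_zero _ _ (by simpa using (hL i (L i)).not))

/-- The values at `x, x + 1` describe the boundary of the partition. Equal values mean two equal
rows or two equal columns (or a place beyond the diagram), and a ladder kills the cap; `true, false`
is a removable box, whose shift is `1`. The margin of two in `ha` and `hb` keeps the rows and
columns involved inside the `N × N` rectangle. -/
theorem cap_rectOp_vac_of_not_corner (hr : IsShift r) (hL : ∀ i j, r i j ≠ 0 ↔ j < L i) {N : ℕ}
    (ha : ∀ i, N ≤ i + 2 → L i = 0) (hb : ∀ i, L i + 2 ≤ N) {x : ℤ}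
    (hx : ¬ (mayaOf L x = false ∧ mayaOf L (x + 1) = true)) :
    cap x (rectOp r N N (mayaInd vacSeq)) = 0 := by
  have hanti : ∀ i j, i ≤ j → L j ≤ L i := fun i j h => hr.antitone hL h
  have hz : ∀ i j, L i ≤ j → r i j = 0 := fun i j h => by
    by_contra h1
    exact absurd ((hL i j).mp h1) (by omega)
  rw [← Module.End.mul_apply]
  rcases hx1 : mayaOf L (x + 1)
  · obtain ⟨p, hp⟩ := mayaOf_eq_false.mp hx1
    have hp1 := hanti p (p + 1) (by omega)
    rcases hx0 : mayaOf L x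
    -- Values `false, false`: rows `p` and `p + 1` have equal length.
    · obtain ⟨i, hi⟩ := mayaOf_eq_false.mp hx0
      have hip : p < i := by
        by_contra h1
        have := hanti i p (by omega)
        omega
      have h2 := hanti (p + 1) i (by omega)
      have hLp : L (p + 1) = L p := by omega
      rcases le_or_gt (p + 2) N with hN | hN
      · obtain ⟨Z, hZ⟩ := exists_cap_mul_rectOp_row (r := r) (a := N) (b := N) (p := p + 2)
          (c := L p) (x := x) hN (by have := hb p; omega) (by push_cast; omega)
          fun i j h3 _ h4 _ => hz i j ((hanti p i (by omega)).trans h4)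
        have h3 := cap_rowOp_rectOp_vac (r := r) (p := p) (q := L p) (b := N)
          (fun j hj => (hL _ _).mpr (by omega)) (by
            rcases hq : L p with _ | q
            · intro j hj; omega
            intro j hj
            exact hr.row_ladder (q := q) (fun j hj => (hL _ _).mpr (by omega))
              (by rw [hz p (q + 1) (by omega)]; omega) j (by omega))
        have hrow : ∀ i, L i = L p → rowOp r i N = rowOp r i (L p) := fun i hi =>
          rowOp_eq_of_zero (by have := hb p; omega) fun j h3 _ => hz _ _ (by omega)
        rw [hZ, rectOp, rectOp, hrow _ hLp, hrow _ rfl, show x = L p - p - 2 by omega, Module.End.mul_apply,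
          ← mul_assoc, ← mul_assoc, h3, map_zero]
      · have h3 := ha p (by omega)
        have h4 := hb p
        rw [rectOp_eq_of_zero (a := N - 2) (b := N - 2) (Nat.sub_le _ _) (Nat.sub_le _ _)
          fun i j hij => hz i j ?_]
        · exact cap_rectOp_vac_of_le r (by omega)
        · rcases hij with hij | hij
          · rw [ha i (by omega)]; omega
          · have := hb i
            omega
    -- Values `true, false`: the last box `(p, q)` of row `p` is removable and its factor sits at
    -- `x`.
    · rw [mayaOf_eq_true] at hx0
      have h1 := hx0 (p + 1)
      obtain ⟨q, hq⟩ : ∃ q, L p = q + 1 := by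
        refine Nat.exists_eq_succ_of_ne_zero fun h0 => ?_
        omega
      have hpN : p + 1 ≤ N := by
        by_contra h2
        have := ha p (by omega)
        omega
      have hbp := hb p
      have h3 : L (p + 1) ≤ q := by omega
      obtain ⟨Z, hZ⟩ := exists_cap_mul_rectOp_row (r := r) (a := N) (b := N) (p := p + 1)
        (c := q) (x := x) hpN (by omega) (by push_cast; omega)
        fun i j h4 _ h5 _ => hz i j (((hanti (p + 1) i h4).trans h3).trans h5)
      have h4 : r p q = 1 := by
        rw [hr.eq_max p q ((hL _ _).mpr (by omega)), hz p (q + 1) (by omega), hz (p + 1) q h3]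
        rfl
      rw [hZ, rectOp, rowOp_eq_of_zero (c := q + 1) (by omega) fun j h3 _ => hz _ _ (by omega),
        rowOp, h4, show (q : ℤ) - p - 1 = x by omega, mul_assoc (factor _ _), ← mul_assoc (cap x),
        cap_mul_factor_one, zero_mul, mul_zero, LinearMap.zero_apply]
  · have hx0 : mayaOf L x = true := by
      rcases h : mayaOf L x
      · exact absurd ⟨h, hx1⟩ hx
      · rfl
    rw [mayaOf_eq_true] at hx0 hx1
    rcases le_or_gt (N : ℤ) x with hNx | hNx
    · exact cap_rectOp_vac_of_ge r hNx
    have hex : ∃ p : ℕ, (L p : ℤ) - p - 1 ≤ x := by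
      refine ⟨(N - x).toNat, ?_⟩
      have := hb (N - x).toNat
      omega
    classical
    -- Values `true, true`: `p` is the first row whose entry lies to the left of the cap. With `q =
    -- x + p`, the columns `q` and `q + 1` both have length `p`.
    obtain ⟨p, hp, hmin⟩ : ∃ p : ℕ, (L p : ℤ) - p - 1 ≤ x ∧ ∀ i < p, x + 1 < (L i : ℤ) - i - 1 := by
      refine ⟨Nat.find hex, Nat.find_spec hex, fun i hi => ?_⟩
      have h1 := Nat.find_min hex hi
      have h2 := hx1 i
      omega
    have hp0 := hx0 p
    obtain ⟨q, hq⟩ : ∃ q : ℕ, (q : ℤ) = x + p := ⟨(x + p).toNat, by omega⟩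
    have hpN : p ≤ N := by
      rcases p with _ | p
      · omega
      by_contra h1
      have h2 := hmin p (by omega)
      have h3 := ha p (by omega)
      have h4 := hb p
      have h5 := hx0 (p + 1)
      omega
    have hqN : q ≤ N := by
      rcases p with _ | p
      · omega
      have h2 := hmin p (by omega)
      have h4 := hb p
      omega
    obtain ⟨Z, hZ⟩ := exists_cap_mul_rectOp_row (r := r) (a := N) (b := N) (p := p)
      (c := q) (x := x) hpN hqN (by omega)
      fun i j h4 _ h5 _ => hz i j ((hanti p i h4).trans (by omega))
    rw [hZ, Module.End.mul_apply]
    rcases p with _ | p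
    · rw [rectOp, mul_one, cap_vac_of_ne (by omega), map_zero]
    have h2 := hmin p (by omega)
    have h3 := hb p
    obtain ⟨Y, hY⟩ := exists_cap_mul_rectOp_col (r := r) (a := p + 1) (b := N) (q := q + 2) (x := x)
      (by omega) (by push_cast; omega)
    have h4 : ∀ i < p + 1, r i (q + 1) ≠ 0 := fun i hi =>
      (hL _ _).mpr (by have := hanti i p (by omega); omega)
    have h5 := cap_colOp_rectOp_vac (r := r) (p := p + 1) (q := q) h4 fun i hi =>
      hr.col_ladder (p := p) (fun i hi => h4 i (by omega))
        (by rw [hz (p + 1) q (by omega)]; omega) i (by omega)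
    rw [hY, Module.End.mul_apply, show x = q - (p + 1 : ℕ) by push_cast; omega, h5, map_zero,
      map_zero]

theorem exists_cap_rectOp_of_corner (hr : IsShift r) (hL : ∀ i j, r i j ≠ 0 ↔ j < L i) {N : ℕ}
    (ha : ∀ i, N ≤ i → L i = 0) (hb : ∀ i, L i ≤ N) {x : ℤ} (hxN : -(N : ℤ) - 1 ≤ x)
    (hx0 : mayaOf L x = false) (hx1 : mayaOf L (x + 1) = true) :
    ∃ p, p ≤ N ∧ x = L p - p - 1 ∧ (∀ i < p, L p < L i) ∧ IsShift (delShift r p (L p)) ∧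
      (∀ i j, delShift r p (L p) i j ≠ 0 ↔ j < delLen L p i) ∧
      cap x (rectOp r N N (mayaInd vacSeq)) = rectOp (delShift r p (L p)) N N (mayaInd vacSeq) := by
  have hanti : ∀ i j, i ≤ j → L j ≤ L i := fun i j h => hr.antitone hL h
  have hz : ∀ i j, L i ≤ j → r i j = 0 := fun i j h => by
    by_contra h1
    exact absurd ((hL i j).mp h1) (by omega)
  obtain ⟨p, hp⟩ := mayaOf_eq_false.mp hx0
  rw [mayaOf_eq_true] at hx1
  have hpN : p ≤ N := by
    by_contra h
    have := ha p (by omega)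
    omega
  have hlt : ∀ i < p, L p < L i := by
    intro i hi
    have h1 := hanti i (p - 1) (by omega)
    have h2 := hanti (p - 1) p (by omega)
    have h3 := hx1 (p - 1)
    omega
  have hrow : ∀ j < L p, r p j ≠ 0 := fun j hj => (hL _ _).mpr hj
  have hcol : ∀ i < p, r i (L p) ≠ 0 := fun i hi => (hL _ _).mpr (hlt i hi)
  refine ⟨p, hpN, hp, hlt, hr.delShift hrow hcol (hz _ _ le_rfl), ?_, ?_⟩
  · intro i j
    unfold delShift delLen
    split_ifs with h1 h2 h2
    · have h3 := hlt i h1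
      have h4 := hr.eq_max i j ((hL _ _).mpr (by omega))
      have h5 := (hL i (j + 1)).mpr (by omega)
      omega
    · rw [hL]; omega
    · rw [hL]
    · have := hanti p (i + 1) (by omega)
      omega
  -- The deletion lemma lowers both sides of the rectangle by one; padding with empty boxes makes
  -- the size `N + 1` beforehand.
  · rw [← cap_rectOp_delShift hr hrow hcol (hz _ _ le_rfl) hpN (hb p), ← hp,
      rectOp_eq_of_zero (r := r) (Nat.le_succ N) (Nat.le_succ N), Module.End.mul_apply]
    rintro i j (h | h)
    · exact hz _ _ (by rw [ha i h]; omega)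
    · exact hz _ _ ((hb i).trans h)

end

/-! ### The coefficients of the product over a partition -/

theorem vMul_sub (P Q : Polynomial ℤ) : vMul (P - Q) = vMul P - vMul Q := by
  simp only [vMul, map_sub]; ring

theorem vMul_zero : vMul 0 = 0 := by simp [vMul]

theorem mayaInd_self (g : ℤ → Bool) : mayaInd g g = 1 := by simp [mayaInd]

theorem mayaInd_of_ne {f g : ℤ → Bool} (h : f ≠ g) : mayaInd g f = 0 := by simp [mayaInd, h]

theorem exists_v_mul_eq_vMul (f g : ℤ → Bool) (P : Polynomial ℤ) :
    ∃ Q, v * (mayaInd g f + vMul P) = vMul Q := by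
  by_cases h : f = g
  · refine ⟨1 + Polynomial.X * P, ?_⟩
    rw [h, mayaInd_self, vMul, vMul]
    simp
  · refine ⟨Polynomial.X * P, ?_⟩
    rw [mayaInd_of_ne h, vMul, vMul]
    simp

theorem comp_adj_comp_adj (f : ℤ → Bool) (x : ℤ) : (f ∘ adj x) ∘ adj x = f := by
  funext y; simp [adj]

/-! ### Support of the product and the choice of a cap -/

theorem rectOp_support {S : (ℤ → Bool) → Prop} {a b : ℕ} (hvac : S vacSeq)
    (hS : ∀ f x, -(a : ℤ) ≤ x → x + 1 < b → S f → S (f ∘ adj x)) (r : ℕ → ℕ → ℕ)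
    {f : ℤ → Bool} (hf : ¬ S f) : rectOp r b a (mayaInd vacSeq) f = 0 := by
  have hfac : ∀ x s φ, -(a : ℤ) ≤ x → x + 1 < b → (∀ f, ¬ S f → φ f = 0) →
      ∀ f, ¬ S f → factor x s φ f = 0 := by
    intro x s φ h1 h2 hφ f hf
    unfold factor
    split_ifs
    · exact hφ f hf
    · have h3 : ¬ S (f ∘ adj x) := fun h => hf (by simpa [comp_adj_comp_adj] using hS _ x h1 h2 h)
      simp [tlU_apply, hφ f hf, hφ _ h3]
  have hrow : ∀ i c φ, i < a → c ≤ b → (∀ f, ¬ S f → φ f = 0) →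
      ∀ f, ¬ S f → rowOp r i c φ f = 0 := by
    intro i c φ hi hc hφ
    induction c with
    | zero => exact hφ
    | succ c ih => exact hfac _ _ _ (by omega) (by omega) (ih (by omega))
  have hrect : ∀ c, c ≤ a → ∀ f, ¬ S f → rectOp r b c (mayaInd vacSeq) f = 0 := by
    intro c hc
    induction c with
    | zero => exact fun f hf => mayaInd_of_ne fun h => hf (h ▸ hvac)
    | succ c ih => exact hrow c b _ (by omega) le_rfl (ih (by omega))
  exact hrect a le_rfl f hf

/-- Maya diagrams that agree with the vacuum outside the places `-a, …, b - 1`. -/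
def InWindow (a b : ℕ) (f : ℤ → Bool) : Prop := ∀ x : ℤ, x < -a ∨ b ≤ x → f x = vacSeq x

theorem inWindow_vacSeq (a b : ℕ) : InWindow a b vacSeq := fun _ _ => rfl

theorem InWindow.comp_adj {a b : ℕ} {f : ℤ → Bool} (h : InWindow a b f) {x : ℤ}
    (h1 : -(a : ℤ) ≤ x) (h2 : x + 1 < b) : InWindow a b (f ∘ adj x) := by
  intro y hy
  rw [← h y hy, Function.comp, adj_apply, if_neg (by omega), if_neg (by omega)]

theorem inWindow_mayaOf {a b : ℕ} {L : ℕ → ℕ} (ha : ∀ i, a ≤ i → L i = 0) (hb : ∀ i, L i ≤ b) :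
    InWindow a b (mayaOf L) := by
  rintro x (hx | hx)
  · rw [mayaOf_eq_false.mpr ⟨(-x - 1).toNat, by rw [ha _ (by omega)]; omega⟩]
    simp [vacSeq]
    omega
  · rw [mayaOf_eq_true.mpr fun i => by have := hb i; omega]
    simp [vacSeq]
    omega

/-- Just left of the window the value is `false`, and at its right end `b` it is `true`, so the
change `false, true` occurs somewhere, possibly across an edge of the window. -/
theorem InWindow.exists_corner {a b : ℕ} {f : ℤ → Bool} (h : InWindow a b f) :
    ∃ x : ℤ, -(a : ℤ) - 1 ≤ x ∧ x < b ∧ f x = false ∧ f (x + 1) = true := by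
  by_contra hc
  push Not at hc
  have key : ∀ m : ℕ, m ≤ a + b + 1 → f (-(a : ℤ) - 1 + m) = false := by
    intro m hm
    induction m with
    | zero =>
      rw [h _ (by left; push_cast; omega)]
      simp [vacSeq]
      omega
    | succ m ih =>
      have h1 := hc (-(a : ℤ) - 1 + m) (by omega) (by omega) (ih (by omega))
      rw [Nat.cast_succ, ← add_assoc]
      simpa using h1
  have h1 := key (a + b + 1) le_rfl
  rw [h _ (by right; push_cast; omega)] at h1
  simp [vacSeq] at h1

/-- The sum of the places in the window at which the value is `true`. -/
noncomputable def windowSum (a b : ℕ) (f : ℤ → Bool) : ℕ :=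
  ∑ y ∈ Finset.Ico (-(a : ℤ)) b, if f y then (y + a).toNat else 0

theorem windowSum_comp_adj_lt {a b : ℕ} {f : ℤ → Bool} {x : ℤ} (h1 : -(a : ℤ) ≤ x)
    (h2 : x + 1 < b) (hx : f x = false) (hx1 : f (x + 1) = true) :
    windowSum a b (f ∘ adj x) < windowSum a b f := by
  have e : windowSum a b (f ∘ adj x) =
      ∑ y ∈ Finset.Ico (-(a : ℤ)) b, if f y then (adj x y + a).toNat else 0 := by
    refine Finset.sum_equiv (adj x) (fun y => ?_) (fun y _ => ?_)
    · rw [Finset.mem_Ico, Finset.mem_Ico, adj_apply]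
      split_ifs <;> omega
    · have h3 : adj x (adj x y) = y := by simp [adj]
      rw [h3]
      rfl
  rw [e]
  refine Finset.sum_lt_sum (fun y hy => ?_) ⟨x + 1, Finset.mem_Ico.mpr ⟨by omega, h2⟩, ?_⟩
  · split_ifs with hf
    · rw [adj_apply]
      split_ifs with h3 h4
      · rw [h3, hx] at hf
        simp at hf
      · omega
      · exact le_rfl
    · exact le_rfl
  · rw [if_pos hx1, if_pos hx1, adj_apply, if_neg (by omega), if_pos rfl]
    omega

theorem ins_eq_self {f : ℤ → Bool} {x : ℤ} {a b : Bool} (h0 : f x = a) (h1 : f (x + 1) = b) :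
    ins x a b (fun y => if y ≤ x then f (y - 1) else f (y + 1)) = f := by
  funext y
  simp only [ins]
  grind

theorem ins_injective (x : ℤ) (a b : Bool) : Function.Injective (ins x a b) := by
  intro f g h
  funext y
  rcases le_or_gt y x with hy | hy
  · have := congrFun h (y - 1)
    rwa [ins_of_lt _ _ _ (by omega), ins_of_lt _ _ _ (by omega), sub_add_cancel] at this
  · have := congrFun h (y + 1)
    rwa [ins_of_gt _ _ _ (by omega), ins_of_gt _ _ _ (by omega), add_sub_cancel_right] at this

/-- The integrality statement. The outer induction is on the size of a rectangle containing the
partition, the inner one on `windowSum`, which drops when `false, true` is exchanged. The cap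
identity `φ(f) = (cap_x φ)(g) - v φ(f ∘ adj x)` links the two. -/
theorem exists_rectOp_coeff {N a b : ℕ} {r : ℕ → ℕ → ℕ} {L : ℕ → ℕ} (hr : IsShift r)
    (hL : ∀ i j, r i j ≠ 0 ↔ j < L i) (ha : ∀ i, a ≤ i → L i = 0) (hb : ∀ i, L i ≤ b)
    (haN : a + 2 ≤ N) (hbN : b + 2 ≤ N) (f : ℤ → Bool) :
    ∃ P, rectOp r N N (mayaInd vacSeq) f = mayaInd (mayaOf L) f + vMul P := by
  induction hm : a + b using Nat.strong_induction_on generalizing a b r L f with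
  | _ m ih =>
  have hz : ∀ i j, L i ≤ j → r i j = 0 := fun i j h => by
    by_contra h1
    exact absurd ((hL i j).mp h1) (by omega)
  by_cases h0 : ∀ i, L i = 0
  · refine ⟨0, ?_⟩
    rw [mayaOf_zero h0, vMul_zero, add_zero, rectOp_eq_of_zero (a := 0) (b := 0) (Nat.zero_le _)
      (Nat.zero_le _) fun i j _ => hz i j (by rw [h0]; omega)]
    rfl
  have hapos : 0 < a := Nat.pos_of_ne_zero fun h => h0 fun i => ha i (by omega)
  have hbpos : 0 < b := Nat.pos_of_ne_zero fun h => h0 fun i => by have := hb i; omega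
  have hout : ∀ f, ¬ InWindow a b f →
      ∃ P, rectOp r N N (mayaInd vacSeq) f = mayaInd (mayaOf L) f + vMul P := by
    intro f hf
    refine ⟨0, ?_⟩
    rw [mayaInd_of_ne fun h => hf (by rw [h]; exact inWindow_mayaOf ha hb), vMul_zero, add_zero,
      rectOp_eq_of_zero (a := a) (b := b) (by omega) (by omega)]
    · exact rectOp_support (inWindow_vacSeq a b) (fun f x h1 h2 h => h.comp_adj h1 h2) r hf
    · rintro i j (h | h)
      · exact hz _ _ (by rw [ha i h]; omega)
      · exact hz _ _ ((hb i).trans h)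
  induction hs : windowSum a b f using Nat.strong_induction_on generalizing f with
  | _ s ihs =>
  by_cases hf : InWindow a b f
  swap
  · exact hout f hf
  obtain ⟨x, hxa, hxb, hx0, hx1⟩ := hf.exists_corner
  obtain ⟨P, hP⟩ : ∃ P, rectOp r N N (mayaInd vacSeq) (f ∘ adj x) =
      mayaInd (mayaOf L) (f ∘ adj x) + vMul P := by
    by_cases hin : -(a : ℤ) ≤ x ∧ x + 1 < b
    · exact ihs _ (by rw [← hs]; exact windowSum_comp_adj_lt hin.1 hin.2 hx0 hx1) _ rfl
    -- A corner across an edge of the window: the exchange leaves the window, where the product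
    -- vanishes.
    · refine hout _ fun h => ?_
      rcases not_and_or.mp hin with h1 | h1
      · have := h x (by left; omega)
        rw [Function.comp, adj_apply, if_pos rfl, hx1] at this
        simp [vacSeq] at this
        omega
      · have := h (x + 1) (by right; omega)
        rw [Function.comp, adj_apply, if_neg (by omega), if_pos rfl, hx0] at this
        simp [vacSeq] at this
        omega
  obtain ⟨Q, hQ⟩ := exists_v_mul_eq_vMul (f ∘ adj x) (mayaOf L) P
  rw [← hP] at hQ
  set g : ℤ → Bool := fun y => if y ≤ x then f (y - 1) else f (y + 1) with hg
  have hfg : ins x false true g = f := ins_eq_self hx0 hx1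
  have hcap : rectOp r N N (mayaInd vacSeq) f =
      cap x (rectOp r N N (mayaInd vacSeq)) g - vMul Q := by
    rw [cap_apply, ← hQ, hfg, ← hfg, ins_comp_adj_self]
    ring
  by_cases hc : mayaOf L x = false ∧ mayaOf L (x + 1) = true
  · obtain ⟨p, hpN, hxp, hlt, hr', hL', e⟩ := exists_cap_rectOp_of_corner hr hL (N := N)
      (fun i hi => ha i (by omega)) (fun i => (hb i).trans (by omega)) (by omega) hc.1 hc.2
    have hanti := hr.antitone hL
    obtain ⟨R, hR⟩ : ∃ R, rectOp (delShift r p (L p)) N N (mayaInd vacSeq) g =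
        mayaInd (mayaOf (delLen L p)) g + vMul R := by
      -- Deleting a row inside the rectangle lowers `a`. Otherwise `L p = 0`, so the column `0` is
      -- deleted and `b` drops.
      rcases lt_or_ge p a with hpa | hpa
      · refine ih (a - 1 + b) (by omega) hr' hL' (a := a - 1) (b := b) (fun i hi => ?_)
          (fun i => ?_) (by omega) hbN _ rfl
        · rw [delLen, if_neg (by omega), ha _ (by omega)]
        · unfold delLen
          split_ifs
          · exact (Nat.sub_le _ _).trans (hb i)
          · exact hb _
      · refine ih (a + (b - 1)) (by omega) hr' hL' (a := a) (b := b - 1) (fun i hi => ?_)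
          (fun i => ?_) haN (by omega) _ rfl
        · unfold delLen
          split_ifs
          · rw [ha i hi]
          · exact ha _ (by omega)
        · unfold delLen
          split_ifs
          · have := hb i
            omega
          · rw [ha _ (by omega)]
            omega
    refine ⟨R - Q, ?_⟩
    have hind : mayaInd (mayaOf (delLen L p)) g = mayaInd (mayaOf L) f := by
      have h1 := mayaOf_delLen hanti hlt
      rw [← hxp] at h1
      by_cases h2 : g = mayaOf (delLen L p)
      · have h3 : f = mayaOf L := by rw [h1, ← h2, hfg]
        rw [h2, h3, mayaInd_self, mayaInd_self]
      · have h3 : f ≠ mayaOf L := fun h => h2 (ins_injective x false true (by rw [hfg, h, h1]))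
        rw [mayaInd_of_ne h2, mayaInd_of_ne h3]
    rw [hcap, e, hR, hind, vMul_sub]
    ring
  · refine ⟨0 - Q, ?_⟩
    rw [hcap, cap_rectOp_vac_of_not_corner hr hL (fun i hi => ha i (by omega))
      (fun i => by have := hb i; omega) hc, mayaInd_of_ne (f := f) (g := mayaOf L), vMul_sub,
      vMul_zero, Pi.zero_apply]
    · ring
    · rintro rfl
      exact hc ⟨hx0, hx1⟩

/-! ### Inversions and lengths -/

section

variable {n : ℕ} {A : Type} [LinearOrder A]

/-- The first place moved by a simple transposition. -/
def lo (i : Gen n) : Fin n := ⟨i.1 - 1, lt_of_le_of_lt (Nat.sub_le _ _) i.2.2⟩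

/-- The second place moved by a simple transposition. -/
def hi (i : Gen n) : Fin n := ⟨i.1, i.2.2⟩

theorem val_lo (i : Gen n) : (lo i).1 = i.1 - 1 := rfl

theorem val_hi (i : Gen n) : (hi i).1 = i.1 := rfl

theorem lo_lt_hi (i : Gen n) : lo i < hi i := by
  have := i.2.1
  rw [Fin.lt_def, val_lo, val_hi]
  omega

theorem simple_apply (i : Gen n) (a : Fin n) :
    simple i a = if a = lo i then hi i else if a = hi i then lo i else a :=
  Equiv.swap_apply_def _ _ _

theorem simple_lo (i : Gen n) : simple i (lo i) = hi i := Equiv.swap_apply_left _ _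

theorem simple_hi (i : Gen n) : simple i (hi i) = lo i := Equiv.swap_apply_right _ _

theorem simple_simple (i : Gen n) (a : Fin n) : simple i (simple i a) = a := by
  simp [simple]

theorem simple_mul_self (i : Gen n) : simple i * simple i = 1 := Equiv.ext (simple_simple i)

theorem simple_inv (i : Gen n) : (simple i)⁻¹ = simple i := inv_eq_of_mul_eq_one_left (simple_mul_self i)

theorem simple_mul_cancel (i : Gen n) (w : Equiv.Perm (Fin n)) : simple i * (simple i * w) = w := by
  rw [← mul_assoc, simple_mul_self, one_mul]

theorem comp_simple_comp_simple {B : Type} (f : Fin n → B) (i : Gen n) :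
    (f ∘ simple i) ∘ simple i = f := by
  funext a; simp [simple_simple]

theorem coe_inv_simple_mul (i : Gen n) (w : Equiv.Perm (Fin n)) :
    ⇑(simple i * w)⁻¹ = ⇑w⁻¹ ∘ simple i := by
  rw [mul_inv_rev, simple_inv]; rfl

theorem simple_lt_simple_iff (i : Gen n) {a b : Fin n} (h1 : ¬ (a = lo i ∧ b = hi i))
    (h2 : ¬ (a = hi i ∧ b = lo i)) : simple i a < simple i b ↔ a < b := by
  have := i.2.1
  rw [simple_apply, simple_apply]
  simp only [Fin.ext_iff, val_lo, val_hi] at h1 h2 ⊢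
  split_ifs <;> simp only [Fin.lt_def, val_lo, val_hi] <;> omega

/-- The number of inversions of a sequence. -/
def inv (f : Fin n → A) : ℕ :=
  (Finset.univ.filter fun p : Fin n × Fin n => p.1 < p.2 ∧ f p.2 < f p.1).card

/-- Applying `simple i` to both entries of a pair preserves the order of every pair of places except
that of `lo i` and `hi i`, which becomes the new inversion. -/
theorem inv_comp_of_lt {f : Fin n → A} {i : Gen n} (h : f (lo i) < f (hi i)) :
    inv (f ∘ simple i) = inv f + 1 := by
  have e : (Finset.univ.filter fun p : Fin n × Fin n =>
      p.1 < p.2 ∧ (f ∘ simple i) p.2 < (f ∘ simple i) p.1) =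
      insert (lo i, hi i) ((Finset.univ.filter fun p : Fin n × Fin n =>
        p.1 < p.2 ∧ f p.2 < f p.1).map ((simple i).prodCongr (simple i)).toEmbedding) := by
    ext ⟨a, b⟩
    rw [Finset.mem_insert, Finset.mem_map_equiv]
    simp only [Finset.mem_filter, Finset.mem_univ, true_and, Function.comp, Prod.mk.injEq,
      Equiv.prodCongr_symm, Equiv.prodCongr_apply, Prod.map]
    rw [show (simple i).symm = simple i from simple_inv i]
    by_cases h1 : a = lo i ∧ b = hi i
    · simp [h1, simple_lo, simple_hi, h, lo_lt_hi]
    by_cases h2 : a = hi i ∧ b = lo i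
    · simp [h2, simple_lo, simple_hi, h.le, (lo_lt_hi i).ne]
    rw [simple_lt_simple_iff i h1 h2]
    simp [h1]
  rw [inv, e, Finset.card_insert_of_notMem, Finset.card_map, inv]
  rw [Finset.mem_map_equiv]
  simp only [Finset.mem_filter, Finset.mem_univ, true_and,
    Equiv.prodCongr_symm, Equiv.prodCongr_apply, Prod.map]
  rw [show (simple i).symm = simple i from simple_inv i, simple_lo, simple_hi]
  exact fun h => absurd h.1 (lo_lt_hi i).le.not_gt

theorem inv_comp_of_gt {f : Fin n → A} {i : Gen n} (h : f (hi i) < f (lo i)) :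
    inv (f ∘ simple i) + 1 = inv f := by
  rw [← inv_comp_of_lt (f := f ∘ simple i) (i := i), comp_simple_comp_simple]
  simpa [simple_lo, simple_hi] using h

theorem comp_simple_of_eq {B : Type} {f : Fin n → B} {i : Gen n} (h : f (lo i) = f (hi i)) :
    f ∘ simple i = f := by
  funext a
  rw [Function.comp, simple_apply]
  split_ifs with h1 h2
  · rw [h1, h]
  · rw [h2, h]
  · rfl

theorem inv_comp_le (f : Fin n → A) (i : Gen n) : inv (f ∘ simple i) ≤ inv f + 1 := by
  rcases lt_trichotomy (f (lo i)) (f (hi i)) with h | h | h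
  · exact (inv_comp_of_lt h).le
  · rw [comp_simple_of_eq h]; exact Nat.le_succ _
  · have := inv_comp_of_gt h
    omega

theorem monotone_of_le {f : Fin n → A} (h : ∀ i : Gen n, f (lo i) ≤ f (hi i)) : Monotone f := by
  have key : ∀ (a : Fin n) (m : ℕ) (hm : a.1 + m < n), f a ≤ f ⟨a.1 + m, hm⟩ := by
    intro a m
    induction m with
    | zero => exact fun _ => le_rfl
    | succ m ih =>
      intro hm
      exact (ih (by omega)).trans (h ⟨a.1 + (m + 1), by omega, hm⟩)
  intro a b hab
  have h1 := key a (b.1 - a.1) (by have := b.2; omega)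
  have h2 : (⟨a.1 + (b.1 - a.1), by have := b.2; omega⟩ : Fin n) = b :=
    Fin.ext (by have := Fin.le_def.mp hab; simp; omega)
  rwa [h2] at h1

theorem inv_eq_zero_of_monotone {f : Fin n → A} (h : Monotone f) : inv f = 0 := by
  rw [inv, Finset.card_eq_zero, Finset.filter_eq_empty_iff]
  rintro ⟨a, b⟩ _ ⟨h1, h2⟩
  exact absurd h2 (h h1.le).not_gt

theorem exists_descent_of_ne_one {w : Equiv.Perm (Fin n)} (hw : w ≠ 1) :
    ∃ i : Gen n, w⁻¹ (hi i) < w⁻¹ (lo i) := by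
  by_contra h
  push Not at h
  have h1 : StrictMono ⇑w⁻¹ := (monotone_of_le h).strictMono_of_injective w⁻¹.injective
  have h2 : w⁻¹ = 1 := Equiv.ext fun a => by
    have := h1.range_inj (g := id) strictMono_id |>.mp (by simp)
    exact congrFun this a
  exact hw (inv_eq_one.mp h2)

theorem wordProd_cons (i : Gen n) (l : List (Gen n)) :
    wordProd (i :: l) = simple i * wordProd l := by simp [wordProd]

theorem wordProd_nil : wordProd ([] : List (Gen n)) = 1 := rfl

theorem inv_comp_wordProd_le (f : Fin n → A) (l : List (Gen n)) :
    inv (f ∘ ⇑(wordProd l)⁻¹) ≤ inv f + l.length := by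
  induction l with
  | nil => simp [wordProd_nil]
  | cons i l ih =>
    rw [wordProd_cons, coe_inv_simple_mul, ← Function.comp_assoc]
    have := inv_comp_le (f ∘ ⇑(wordProd l)⁻¹) i
    rw [List.length_cons]
    omega

theorem inv_id : inv (id : Fin n → Fin n) = 0 := inv_eq_zero_of_monotone monotone_id

theorem len_le_length (l : List (Gen n)) : len (wordProd l) ≤ l.length := by
  classical
  exact Nat.find_min' _ ⟨l, rfl, rfl⟩

theorem inv_comp_inv_le (f : Fin n → A) (w : Equiv.Perm (Fin n)) :
    inv (f ∘ ⇑w⁻¹) ≤ inv f + len w := by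
  obtain ⟨l, rfl, hl⟩ := exists_reducedWord w
  rw [← hl]
  exact inv_comp_wordProd_le f l

/-- Each letter changes the number of inversions by at most one, which bounds the length below;
removing descents one after another yields a word of that length. -/
theorem len_eq_inv (w : Equiv.Perm (Fin n)) : len w = inv ⇑w⁻¹ := by
  refine le_antisymm ?_ (by simpa [inv_id] using inv_comp_inv_le (id : Fin n → Fin n) w)
  induction hm : inv ⇑w⁻¹ generalizing w with
  | zero =>
    by_cases hw : w = 1
    · rw [hw]
      exact len_le_length []
    · obtain ⟨i, hi⟩ := exists_descent_of_ne_one hw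
      have := inv_comp_of_gt hi
      omega
  | succ m ih =>
    have hw : w ≠ 1 := by
      rintro rfl
      rw [inv_one, Equiv.Perm.coe_one, inv_id] at hm
      omega
    obtain ⟨i, hi⟩ := exists_descent_of_ne_one hw
    have h1 := inv_comp_of_gt hi
    have h2 := ih (simple i * w) (by rw [coe_inv_simple_mul]; omega)
    obtain ⟨l, hl, hl'⟩ := exists_reducedWord (simple i * w)
    have h3 := len_le_length (i :: l)
    rw [wordProd_cons, hl, simple_mul_cancel, List.length_cons] at h3
    omega

theorem len_one : len (1 : Equiv.Perm (Fin n)) = 0 := Nat.le_zero.mp (len_le_length [])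

theorem len_simple_mul_of_lt {w : Equiv.Perm (Fin n)} {i : Gen n} (h : w⁻¹ (lo i) < w⁻¹ (hi i)) :
    len (simple i * w) = len w + 1 := by
  rw [len_eq_inv, len_eq_inv, coe_inv_simple_mul, inv_comp_of_lt h]

theorem len_simple_mul_of_gt {w : Equiv.Perm (Fin n)} {i : Gen n} (h : w⁻¹ (hi i) < w⁻¹ (lo i)) :
    len (simple i * w) + 1 = len w := by
  rw [len_eq_inv, len_eq_inv, coe_inv_simple_mul, inv_comp_of_gt h]

theorem inv_lo_ne_inv_hi (w : Equiv.Perm (Fin n)) (i : Gen n) : w⁻¹ (lo i) ≠ w⁻¹ (hi i) := fun h =>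
  (lo_lt_hi i).ne (w⁻¹.injective h)

theorem lt_of_len_simple_mul_lt {w : Equiv.Perm (Fin n)} {i : Gen n}
    (h : len (simple i * w) < len w) : w⁻¹ (hi i) < w⁻¹ (lo i) := by
  refine lt_of_not_ge fun h1 => ?_
  have := len_simple_mul_of_lt (lt_of_le_of_ne h1 (inv_lo_ne_inv_hi w i))
  omega

/-! ### Words with the same product -/

theorem hi_eq_lo {i j : Gen n} (h : i.1 + 1 = j.1) : hi i = lo j :=
  Fin.ext (by rw [val_lo, val_hi]; omega)

theorem simple_apply_of_ne {i : Gen n} {a : Fin n} (h1 : a.1 ≠ i.1) (h2 : a.1 + 1 ≠ i.1) :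
    simple i a = a := by
  rw [simple_apply, if_neg, if_neg] <;> rw [Fin.ext_iff] <;> simp only [val_lo, val_hi] <;> omega

theorem simple_braid {i j : Gen n} (h : i.1 + 1 = j.1) :
    simple i * simple j * simple i = simple j * simple i * simple j := by
  have h1 := i.2.1
  have h2 : simple j (lo i) = lo i := simple_apply_of_ne (by rw [val_lo]; omega) (by rw [val_lo]; omega)
  have h3 : simple i (hi j) = hi j := simple_apply_of_ne (by rw [val_hi]; omega) (by rw [val_hi]; omega)
  ext1 a
  simp only [Equiv.Perm.mul_apply]
  by_cases ha : a = lo i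
  · rw [ha, h2, simple_lo, hi_eq_lo h, simple_lo, h3]
  by_cases hb : a = hi i
  · rw [hb, simple_hi, h2, simple_lo, hi_eq_lo h, simple_lo, h3, simple_hi]
  by_cases hc : a = hi j
  · rw [hc, h3, simple_hi, ← hi_eq_lo h, simple_hi, h2]
  rw [Fin.ext_iff, val_lo] at ha
  rw [Fin.ext_iff, val_hi] at hb hc
  have h4 : simple i a = a := simple_apply_of_ne (by omega) (by omega)
  have h5 : simple j a = a := simple_apply_of_ne (by omega) (by omega)
  simp only [h4, h5]

theorem simple_lo_of_lt {i j : Gen n} (h : i.1 + 1 < j.1) : simple i (lo j) = lo j :=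
  simple_apply_of_ne (by rw [val_lo]; omega) (by rw [val_lo]; omega)

theorem simple_hi_of_lt {i j : Gen n} (h : i.1 + 1 < j.1) : simple i (hi j) = hi j :=
  simple_apply_of_ne (by rw [val_hi]; omega) (by rw [val_hi]; omega)

theorem simple_lo_of_gt {i j : Gen n} (h : j.1 + 1 < i.1) : simple i (lo j) = lo j :=
  simple_apply_of_ne (by rw [val_lo]; omega) (by rw [val_lo]; omega)

theorem simple_hi_of_gt {i j : Gen n} (h : j.1 + 1 < i.1) : simple i (hi j) = hi j :=
  simple_apply_of_ne (by rw [val_hi]; omega) (by rw [val_hi]; omega)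

theorem simple_hi_of_succ {i j : Gen n} (h : i.1 + 1 = j.1) : simple i (hi j) = hi j :=
  simple_apply_of_ne (by rw [val_hi]; omega) (by rw [val_hi]; omega)

theorem simple_lo_of_pred {i j : Gen n} (h : j.1 + 1 = i.1) : simple i (lo j) = lo j := by
  have := j.2.1
  exact simple_apply_of_ne (by rw [val_lo]; omega) (by rw [val_lo]; omega)

theorem simple_comm {i j : Gen n} (h : i.1 + 1 < j.1) :
    simple i * simple j = simple j * simple i := by
  ext1 a
  simp only [Equiv.Perm.mul_apply]
  by_cases h1 : a = lo i
  · rw [h1, simple_lo, simple_lo_of_gt h, simple_lo, simple_hi_of_gt h]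
  by_cases h2 : a = hi i
  · rw [h2, simple_hi, simple_hi_of_gt h, simple_hi, simple_lo_of_gt h]
  by_cases h3 : a = lo j
  · rw [h3, simple_lo, simple_lo_of_lt h, simple_lo, simple_hi_of_lt h]
  by_cases h4 : a = hi j
  · rw [h4, simple_hi, simple_hi_of_lt h, simple_hi, simple_lo_of_lt h]
  simp [simple_apply, h1, h2, h3, h4]

/-- A word of minimal length among those with the same product. -/
def IsReduced (l : List (Gen n)) : Prop := l.length = len (wordProd l)

theorem IsReduced.of_cons {i : Gen n} {l : List (Gen n)} (h : IsReduced (i :: l)) :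
    IsReduced l ∧ (wordProd (i :: l))⁻¹ (hi i) < (wordProd (i :: l))⁻¹ (lo i) := by
  have h1 := len_le_length l
  unfold IsReduced at h ⊢
  have h2 : simple i * wordProd (i :: l) = wordProd l := by rw [wordProd_cons, simple_mul_cancel]
  have h3 : (wordProd (i :: l))⁻¹ (hi i) < (wordProd (i :: l))⁻¹ (lo i) := by
    refine lt_of_len_simple_mul_lt ?_
    rw [h2, ← h, List.length_cons]
    omega
  refine ⟨?_, h3⟩
  have h4 := len_simple_mul_of_gt h3
  rw [h2, ← h, List.length_cons] at h4
  omega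

/-- Matsumoto's theorem, by induction on length. If the two words begin with different letters `i`
and `j`, both are left descents, so the element also has reduced words beginning with the two sides
of the commutation or braid relation for `i` and `j`. Each given word is compared with the one
sharing its first letter. -/
theorem prod_map_eq_of_isReduced {M : Type} [Monoid M] {t : Gen n → M}
    (hbraid : ∀ i j : Gen n, i.1 + 1 = j.1 → t i * t j * t i = t j * t i * t j)
    (hcomm : ∀ i j : Gen n, i.1 + 1 < j.1 → t i * t j = t j * t i) {l l' : List (Gen n)}
    (hl : IsReduced l) (hl' : IsReduced l') (h : wordProd l = wordProd l') :
    (l.map t).prod = (l'.map t).prod := by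
  induction hm : l.length generalizing l l' with
  | zero =>
    have h1 : l'.length = 0 := by rw [hl', ← h, ← hl, hm]
    rw [List.length_eq_zero_iff.mp hm, List.length_eq_zero_iff.mp h1]
  | succ m ih =>
    have hm' : l'.length = m + 1 := by rw [hl', ← h, ← hl, hm]
    obtain ⟨i, l, rfl⟩ := List.exists_cons_of_length_eq_add_one hm
    obtain ⟨j, l', rfl⟩ := List.exists_cons_of_length_eq_add_one hm'
    obtain ⟨hl1, hi1⟩ := hl.of_cons
    obtain ⟨hl1', hj1⟩ := hl'.of_cons
    rw [← h] at hj1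
    simp only [List.length_cons, Nat.add_right_cancel_iff] at hm hm'
    obtain ⟨w, hw⟩ : ∃ w, w = wordProd (i :: l) := ⟨_, rfl⟩
    have hwl : wordProd l = simple i * w := by rw [hw, wordProd_cons, simple_mul_cancel]
    have hwl' : wordProd l' = simple j * w := by rw [hw, h, wordProd_cons, simple_mul_cancel]
    rw [← hw] at hi1 hj1
    have hlw := len_simple_mul_of_gt hi1
    have hlw' := len_simple_mul_of_gt hj1
    have key_comm : ∀ {i j : Gen n} {l l' : List (Gen n)}, IsReduced l → IsReduced l' →
        wordProd l = simple i * w → wordProd l' = simple j * w → w⁻¹ (hi i) < w⁻¹ (lo i) →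
        w⁻¹ (hi j) < w⁻¹ (lo j) → l.length = m → l'.length = m → i.1 + 1 < j.1 →
        t i * (l.map t).prod = t j * (l'.map t).prod := by
      intro i j l l' hl1 hl1' hwl hwl' hi1 hj1 hm hm' hij
      have hlw := len_simple_mul_of_gt hi1
      have hlw' := len_simple_mul_of_gt hj1
      have h1 := len_simple_mul_of_gt (w := simple i * w) (i := j) (by
        rw [coe_inv_simple_mul, Function.comp, Function.comp, simple_hi_of_lt hij,
          simple_lo_of_lt hij]; exact hj1)
      obtain ⟨k, hk, hk'⟩ := exists_reducedWord (simple j * (simple i * w))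
      have e1 : wordProd (j :: k) = simple i * w := by rw [wordProd_cons, hk, simple_mul_cancel]
      have e2 : wordProd (i :: k) = simple j * w := by
        rw [wordProd_cons, hk, ← mul_assoc, ← mul_assoc, simple_comm hij, mul_assoc (simple j),
          simple_mul_self, mul_one]
      have r1 := ih hl1 (l' := j :: k) (by rw [IsReduced, e1, List.length_cons, hk', h1])
        (by rw [hwl, e1]) hm
      have r2 := ih hl1' (l' := i :: k) (by rw [IsReduced, e2, List.length_cons, hk']; omega)
        (by rw [hwl', e2]) hm'
      rw [r1, r2, List.map_cons, List.map_cons, List.prod_cons, List.prod_cons, ← mul_assoc,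
        ← mul_assoc, hcomm i j hij]
    have key_braid : ∀ {i j : Gen n} {l l' : List (Gen n)}, IsReduced l → IsReduced l' →
        wordProd l = simple i * w → wordProd l' = simple j * w → w⁻¹ (hi i) < w⁻¹ (lo i) →
        w⁻¹ (hi j) < w⁻¹ (lo j) → l.length = m → l'.length = m → i.1 + 1 = j.1 →
        t i * (l.map t).prod = t j * (l'.map t).prod := by
      intro i j l l' hl1 hl1' hwl hwl' hi1 hj1 hm hm' hij
      have hlw := len_simple_mul_of_gt hi1
      have hlw' := len_simple_mul_of_gt hj1
      have h1 := len_simple_mul_of_gt (w := simple i * w) (i := j) (by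
        rw [coe_inv_simple_mul, Function.comp, Function.comp, simple_hi_of_succ hij,
          ← hi_eq_lo hij, simple_hi]
        rw [← hi_eq_lo hij] at hj1
        exact hj1.trans hi1)
      have h2 := len_simple_mul_of_gt (w := simple j * (simple i * w)) (i := i) (by
        rw [coe_inv_simple_mul, coe_inv_simple_mul]
        simp only [Function.comp]
        rw [hi_eq_lo hij, simple_lo, simple_hi_of_succ hij, simple_lo_of_pred hij, simple_lo,
          hi_eq_lo hij]
        exact hj1)
      obtain ⟨k, hk, hk'⟩ := exists_reducedWord (simple i * (simple j * (simple i * w)))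
      have e1 : wordProd (j :: i :: k) = simple i * w := by
        rw [wordProd_cons, wordProd_cons, hk, simple_mul_cancel, simple_mul_cancel]
      have e2 : wordProd (i :: j :: k) = simple j * w := by
        rw [wordProd_cons, wordProd_cons, hk, ← mul_assoc (simple i) (simple j),
          ← mul_assoc (simple i * simple j), simple_braid hij, mul_assoc, mul_assoc,
          simple_mul_cancel, simple_mul_cancel]
      have r1 := ih hl1 (l' := j :: i :: k)
        (by rw [IsReduced, e1, List.length_cons, List.length_cons, hk']; omega) (by rw [hwl, e1]) hm
      have r2 := ih hl1' (l' := i :: j :: k)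
        (by rw [IsReduced, e2, List.length_cons, List.length_cons, hk']; omega)
        (by rw [hwl', e2]) hm'
      rw [r1, r2]
      simp only [List.map_cons, List.prod_cons, ← mul_assoc]
      rw [hbraid i j hij]
    rw [List.map_cons, List.map_cons, List.prod_cons, List.prod_cons]
    rcases lt_trichotomy i.1 j.1 with hij | hij | hij
    · rcases Nat.lt_or_eq_of_le (Nat.succ_le_of_lt hij) with h3 | h3
      · exact key_comm hl1 hl1' hwl hwl' hi1 hj1 hm hm' h3
      · exact key_braid hl1 hl1' hwl hwl' hi1 hj1 hm hm' h3
    · obtain rfl : i = j := Subtype.ext hij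
      rw [ih hl1 hl1' (by rw [hwl, hwl']) hm]
    · rcases Nat.lt_or_eq_of_le (Nat.succ_le_of_lt hij) with h3 | h3
      · exact (key_comm hl1' hl1 hwl' hwl hj1 hi1 hm' hm h3).symm
      · exact (key_braid hl1' hl1 hwl' hwl hj1 hi1 hm' hm h3).symm

theorem stdT_wordProd {l : List (Gen n)} (hl : IsReduced l) :
    stdT (wordProd l) = (l.map gen).prod := by
  obtain ⟨h1, h2⟩ := Classical.choose_spec (exists_reducedWord (wordProd l))
  refine prod_map_eq_of_isReduced gen_braid gen_comm ?_ hl h1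
  change (reducedWord (wordProd l)).length = len (wordProd (reducedWord (wordProd l)))
  exact h2.trans (congrArg len h1).symm

theorem stdT_one : stdT (1 : Equiv.Perm (Fin n)) = 1 :=
  stdT_wordProd (l := []) (by rw [IsReduced, wordProd_nil, len_one]; rfl)

theorem stdT_simple_mul_of_lt {w : Equiv.Perm (Fin n)} {i : Gen n}
    (h : w⁻¹ (lo i) < w⁻¹ (hi i)) : stdT (simple i * w) = gen i * stdT w := by
  obtain ⟨l, hl, hl'⟩ := exists_reducedWord w
  have h1 := len_simple_mul_of_lt h
  have h2 : IsReduced l := by rw [IsReduced, hl, hl']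
  have h3 : IsReduced (i :: l) := by
    rw [IsReduced, wordProd_cons, hl, h1, List.length_cons, hl']
  have h4 := stdT_wordProd h3
  rw [wordProd_cons, hl] at h4
  rw [h4, ← hl, stdT_wordProd h2, List.map_cons, List.prod_cons]

theorem gen_mul_stdT_of_gt {w : Equiv.Perm (Fin n)} {i : Gen n}
    (h : w⁻¹ (hi i) < w⁻¹ (lo i)) :
    gen i * stdT w = stdT (simple i * w) + scal (v - v⁻¹) * stdT w := by
  have h1 : stdT w = gen i * stdT (simple i * w) := by
    rw [← stdT_simple_mul_of_lt, simple_mul_cancel]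
    rw [coe_inv_simple_mul, Function.comp, Function.comp, simple_lo, simple_hi]
    exact h
  rw [h1, ← mul_assoc, gen_sq, add_mul, one_mul, mul_assoc, add_comm]

end

/-! ### The action of the Hecke algebra on functions of sequences -/

section

variable {n : ℕ} {A : Type} [LinearOrder A]

/-- The action of `T_i` on functions of sequences. -/
noncomputable def act (i : Gen n) : Module.End Qv ((Fin n → A) → Qv) where
  toFun φ f := if f (lo i) = f (hi i) then -v⁻¹ * φ f else
    φ (f ∘ simple i) + if f (hi i) < f (lo i) then (v - v⁻¹) * φ f else 0
  map_add' φ ψ := by ext f; simp only [Pi.add_apply]; split_ifs <;> ring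
  map_smul' c φ := by
    ext f; simp only [Pi.smul_apply, smul_eq_mul, RingHom.id_apply]; split_ifs <;> ring

theorem act_apply (i : Gen n) (φ : (Fin n → A) → Qv) (f : Fin n → A) :
    act i φ f = if f (lo i) = f (hi i) then -v⁻¹ * φ f else
      φ (f ∘ simple i) + if f (hi i) < f (lo i) then (v - v⁻¹) * φ f else 0 := rfl

theorem act_apply_of_eq {i : Gen n} (φ : (Fin n → A) → Qv) {f : Fin n → A}
    (h : f (lo i) = f (hi i)) : act i φ f = -v⁻¹ * φ f := if_pos h

theorem act_apply_of_lt {i : Gen n} (φ : (Fin n → A) → Qv) {f : Fin n → A}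
    (h : f (lo i) < f (hi i)) : act i φ f = φ (f ∘ simple i) := by
  rw [act_apply, if_neg h.ne, if_neg h.le.not_gt, add_zero]

theorem act_apply_of_gt {i : Gen n} (φ : (Fin n → A) → Qv) {f : Fin n → A}
    (h : f (hi i) < f (lo i)) : act i φ f = φ (f ∘ simple i) + (v - v⁻¹) * φ f := by
  rw [act_apply, if_neg h.ne', if_pos h]

theorem act_quad (i : Gen n) :
    (act (A := A) i - algebraMap Qv _ v) * (act i + algebraMap Qv _ v⁻¹) = 0 := by
  ext φ f
  simp only [Module.End.mul_apply, LinearMap.sub_apply, LinearMap.add_apply,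
    Module.algebraMap_end_apply, Pi.sub_apply, Pi.add_apply, Pi.smul_apply, smul_eq_mul,
    LinearMap.zero_apply, Pi.zero_apply]
  have h1 : (f ∘ simple i) (lo i) = f (hi i) := by rw [Function.comp, simple_lo]
  have h2 : (f ∘ simple i) (hi i) = f (lo i) := by rw [Function.comp, simple_hi]
  have hv := v_ne_zero
  rcases lt_trichotomy (f (lo i)) (f (hi i)) with h | h | h
  · rw [act_apply_of_lt _ h, Pi.add_apply, Pi.smul_apply, smul_eq_mul,
      act_apply_of_gt _ (by rwa [h1, h2]), act_apply_of_lt _ h, comp_simple_comp_simple]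
    field_simp
    ring
  · rw [act_apply_of_eq _ h, Pi.add_apply, Pi.smul_apply, smul_eq_mul, act_apply_of_eq _ h]
    ring
  · rw [act_apply_of_gt _ h, Pi.add_apply, Pi.smul_apply, smul_eq_mul, Pi.add_apply, Pi.smul_apply,
      smul_eq_mul, act_apply_of_lt _ (by rwa [h1, h2]), act_apply_of_gt _ h,
      comp_simple_comp_simple]
    field_simp
    ring

theorem act_braid {i j : Gen n} (h : i.1 + 1 = j.1) :
    act (A := A) i * act j * act i = act j * act i * act j := by
  ext φ f
  have e : ((f ∘ simple i) ∘ simple j) ∘ simple i = ((f ∘ simple j) ∘ simple i) ∘ simple j := by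
    have := simple_braid h
    simp only [Function.comp_assoc]
    exact congrArg (fun w : Equiv.Perm (Fin n) => f ∘ w) this
  simp only [Module.End.mul_apply, act_apply, Function.comp_apply, ← hi_eq_lo h, simple_hi,
    simple_lo, simple_hi_of_succ h, simple_lo_of_pred h, comp_simple_comp_simple, e]
  simp only [hi_eq_lo h, simple_lo, simple_hi_of_succ h]
  generalize f (lo i) = a
  generalize f (lo j) = b
  generalize f (hi j) = c
  have hv := v_ne_zero
  -- Both sides depend only on the relative order of the three values; the inconsistent combinations
  -- are discarded.
  rcases lt_trichotomy a b with h1 | h1 | h1 <;> rcases lt_trichotomy b c with h2 | h2 | h2 <;>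
    rcases lt_trichotomy a c with h3 | h3 | h3 <;> first | (exfalso; order) | skip
  all_goals
    try subst h1
    try subst h2
    try subst h3
    try simp only [h1, h1.ne, h1.ne', h1.not_gt, if_true, if_false, lt_irrefl]
    try simp only [h2, h2.ne, h2.ne', h2.not_gt, if_true, if_false, lt_irrefl]
    try simp only [h3, h3.ne, h3.ne', h3.not_gt, if_true, if_false]
    try simp only [if_true, if_false, lt_irrefl]
    try field_simp
    try ring

theorem act_comm {i j : Gen n} (h : i.1 + 1 < j.1) :
    act (A := A) i * act j = act j * act i := by
  ext φ f
  have e : (f ∘ simple i) ∘ simple j = (f ∘ simple j) ∘ simple i := by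
    have := simple_comm h
    simp only [Function.comp_assoc]
    exact congrArg (fun w : Equiv.Perm (Fin n) => f ∘ w) this
  simp only [Module.End.mul_apply, act_apply, Function.comp_apply, simple_hi_of_lt h,
    simple_lo_of_lt h, simple_hi_of_gt h, simple_lo_of_gt h, e]
  split_ifs <;> ring

variable (A) in
/-- The representation of the Hecke algebra on functions of sequences. -/
noncomputable def rep : Hecke n →ₐ[Qv] Module.End Qv ((Fin n → A) → Qv) :=
  RingQuot.liftAlgHom Qv ⟨FreeAlgebra.lift Qv act, fun {x y} h => by
    cases h with
    | quad i =>
      rw [map_mul, map_sub, map_add, map_zero, FreeAlgebra.lift_ι_apply, AlgHom.commutes,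
        AlgHom.commutes]
      exact act_quad i
    | braid i j hij =>
      simp only [map_mul, FreeAlgebra.lift_ι_apply]
      exact act_braid hij
    | comm i j hij =>
      simp only [map_mul, FreeAlgebra.lift_ι_apply]
      exact act_comm hij⟩

theorem rep_gen (i : Gen n) : rep A (gen i) = act i := by
  rw [rep, gen, RingQuot.liftAlgHom_mkAlgHom_apply, FreeAlgebra.lift_ι_apply]

theorem rep_scal_mul_apply (c : Qv) (h : Hecke n) (φ : (Fin n → A) → Qv) :
    rep A (scal c * h) φ = c • rep A h φ := by
  rw [map_mul, AlgHom.commutes, Module.End.mul_apply, Module.algebraMap_end_apply]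

theorem rep_gen_mul_apply (i : Gen n) (h : Hecke n) (φ : (Fin n → A) → Qv) :
    rep A (gen i * h) φ = act i (rep A h φ) := by
  rw [map_mul, rep_gen, Module.End.mul_apply]

theorem hecke_induction {P : Hecke n → Prop} (hscal : ∀ c, P (scal c)) (hgen : ∀ i, P (gen i))
    (hadd : ∀ x y, P x → P y → P (x + y)) (hmul : ∀ x y, P x → P y → P (x * y)) (h : Hecke n) :
    P h := by
  obtain ⟨x, rfl⟩ := RingQuot.mkAlgHom_surjective Qv (HeckeRel n) h
  induction x using FreeAlgebra.induction with
  | grade0 c => rw [AlgHom.commutes]; exact hscal c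
  | grade1 i => exact hgen i
  | mul a b ha hb => rw [map_mul]; exact hmul _ _ ha hb
  | add a b ha hb => rw [map_add]; exact hadd _ _ ha hb

/-! ### Action on indicator functions and triangularity of bar -/

theorem act_single_of_lt {i : Gen n} {f : Fin n → A} (h : f (lo i) < f (hi i)) :
    act i (Pi.single f 1) = Pi.single (f ∘ simple i) (1 : Qv) := by
  ext g
  have h0 : (f ∘ simple i) (lo i) = f (hi i) := by rw [Function.comp, simple_lo]
  have h0' : (f ∘ simple i) (hi i) = f (lo i) := by rw [Function.comp, simple_hi]
  have h1 : g ∘ simple i = f ↔ g = f ∘ simple i :=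
    ⟨fun e => by rw [← e, comp_simple_comp_simple], fun e => by rw [e, comp_simple_comp_simple]⟩
  have h2 : g (hi i) ≤ g (lo i) → g ≠ f := by
    rintro h3 rfl
    exact absurd h h3.not_gt
  have h3 : g (lo i) ≤ g (hi i) → g ≠ f ∘ simple i := by
    rintro h3 rfl
    rw [h0, h0'] at h3
    exact absurd h h3.not_gt
  rcases lt_trichotomy (g (lo i)) (g (hi i)) with h4 | h4 | h4
  · rw [act_apply_of_lt _ h4, Pi.single_apply, Pi.single_apply]
    simp only [h1]
  · rw [act_apply_of_eq _ h4, Pi.single_apply, Pi.single_apply, if_neg (h2 h4.ge), if_neg (h3 h4.le),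
      mul_zero]
  · rw [act_apply_of_gt _ h4, Pi.single_apply, Pi.single_apply, Pi.single_apply, if_neg (h2 h4.le)]
    simp only [h1, mul_zero, add_zero]

theorem act_single_of_eq {i : Gen n} {f : Fin n → A} (h : f (lo i) = f (hi i)) :
    act i (Pi.single f 1) = (-v⁻¹) • (Pi.single f 1 : (Fin n → A) → Qv) := by
  ext g
  rw [Pi.smul_apply, smul_eq_mul]
  by_cases h1 : g (lo i) = g (hi i)
  · rw [act_apply_of_eq _ h1]
  · have h2 : g ≠ f := by
      rintro rfl
      exact h1 h
    have h3 : g ∘ simple i ≠ f := by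
      rintro rfl
      rw [Function.comp, Function.comp, simple_lo, simple_hi] at h
      exact h1 h.symm
    rw [act_apply, if_neg h1, Pi.single_eq_of_ne h2, Pi.single_eq_of_ne h3]
    simp

/-- A letter adds at most one inversion, so by `h` every letter of a reduced word adds exactly one,
and each generator acts by the plain exchange. -/
theorem rep_stdT_single {f : Fin n → A} {w : Equiv.Perm (Fin n)}
    (h : inv (f ∘ ⇑w⁻¹) = inv f + len w) :
    rep A (stdT w) (Pi.single f 1) = Pi.single (f ∘ ⇑w⁻¹) 1 := by
  induction hm : len w generalizing w with
  | zero =>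
    obtain ⟨l, rfl, hl⟩ := exists_reducedWord w
    rw [hm] at hl
    rw [List.length_eq_zero_iff.mp hl, wordProd_nil, stdT_one, map_one]
    rfl
  | succ m ih =>
    obtain ⟨i, h0⟩ := exists_descent_of_ne_one (w := w) (by rintro rfl; rw [len_one] at hm; omega)
    have h1 := len_simple_mul_of_gt h0
    have h2 : w = simple i * (simple i * w) := (simple_mul_cancel i w).symm
    have h3 : (f ∘ ⇑(simple i * w)⁻¹) ∘ simple i = f ∘ ⇑w⁻¹ := by
      rw [coe_inv_simple_mul, Function.comp_assoc, comp_simple_comp_simple]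
    have h4 := inv_comp_le (f ∘ ⇑(simple i * w)⁻¹) i
    have h5 := inv_comp_inv_le f (simple i * w)
    rw [h3] at h4
    have h6 : (f ∘ ⇑(simple i * w)⁻¹) (lo i) < (f ∘ ⇑(simple i * w)⁻¹) (hi i) := by
      by_contra h6
      rcases (not_lt.mp h6).eq_or_lt with h7 | h7
      · have := comp_simple_of_eq h7.symm
        rw [h3] at this
        rw [← this] at h5
        omega
      · have := inv_comp_of_gt h7
        rw [h3] at this
        omega
    rw [h2, stdT_simple_mul_of_lt, ← h2, rep_gen_mul_apply, ih (by omega) (by omega),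
      act_single_of_lt h6, h3]
    rw [coe_inv_simple_mul, Function.comp, Function.comp, simple_lo, simple_hi]
    exact h0

/-- Functions of sequences that vanish on the sequences with at least `m` inversions. -/
def InvLT (m : ℕ) (φ : (Fin n → A) → Qv) : Prop := ∀ f, m ≤ inv f → φ f = 0

theorem InvLT.mono {m m' : ℕ} {φ : (Fin n → A) → Qv} (h : InvLT m φ) (hm : m ≤ m') :
    InvLT m' φ := fun f hf => h f (hm.trans hf)

theorem InvLT.act {m : ℕ} {φ : (Fin n → A) → Qv} (h : InvLT m φ) (i : Gen n) :
    InvLT (m + 1) (act i φ) := by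
  intro f hf
  have h1 := inv_comp_le (f ∘ simple i) i
  rw [comp_simple_comp_simple] at h1
  rw [act_apply, h f (by omega), h (f ∘ simple i) (by omega)]
  simp

theorem InvLT.add {m : ℕ} {φ ψ : (Fin n → A) → Qv} (h : InvLT m φ) (h' : InvLT m ψ) :
    InvLT m (φ + ψ) := fun f hf => by rw [Pi.add_apply, h f hf, h' f hf, add_zero]

theorem InvLT.smul {m : ℕ} {φ : (Fin n → A) → Qv} (h : InvLT m φ) (c : Qv) :
    InvLT m (c • φ) := fun f hf => by rw [Pi.smul_apply, h f hf, smul_zero]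

theorem exists_eq_simple_mul {w : Equiv.Perm (Fin n)} {m : ℕ} (h : len w = m + 1) :
    ∃ (i : Gen n) (w' : Equiv.Perm (Fin n)), w = simple i * w' ∧ len w' = m ∧
      stdT w = gen i * stdT w' := by
  obtain ⟨i, hi⟩ := exists_descent_of_ne_one (w := w) (by rintro rfl; rw [len_one] at h; omega)
  have h1 := len_simple_mul_of_gt hi
  refine ⟨i, simple i * w, (simple_mul_cancel i w).symm, by omega, ?_⟩
  rw [← stdT_simple_mul_of_lt, simple_mul_cancel]
  rw [coe_inv_simple_mul, Function.comp, Function.comp, simple_lo, simple_hi]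
  exact hi

theorem eq_one_of_len_eq_zero {w : Equiv.Perm (Fin n)} (h : len w = 0) : w = 1 := by
  by_contra hw
  obtain ⟨i, hi⟩ := exists_descent_of_ne_one hw
  have := len_simple_mul_of_gt hi
  omega

theorem invLT_rep_stdT (f : Fin n → A) (w : Equiv.Perm (Fin n)) :
    InvLT (inv f + len w + 1) (rep A (stdT w) (Pi.single f 1)) := by
  induction hm : len w generalizing w with
  | zero =>
    rw [eq_one_of_len_eq_zero hm, stdT_one, map_one, Module.End.one_apply]
    intro g hg
    exact Pi.single_eq_of_ne (by rintro rfl; omega) _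
  | succ m ih =>
    obtain ⟨i, w', -, h2, h3⟩ := exists_eq_simple_mul hm
    rw [h3, rep_gen_mul_apply]
    exact (ih w' h2).act i

/-- Triangularity of bar: `T_i⁻¹` differs from `T_i` by a scalar, so passing to bar changes only
terms with fewer inversions than the leading one. -/
theorem invLT_rep_bar_stdT (f : Fin n → A) (w : Equiv.Perm (Fin n)) :
    InvLT (inv f + len w) (rep A (bar n (stdT w) - stdT w) (Pi.single f 1)) := by
  induction hm : len w generalizing w with
  | zero =>
    rw [eq_one_of_len_eq_zero hm, stdT_one, map_one, sub_self, map_zero]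
    exact fun _ _ => rfl
  | succ m ih =>
    obtain ⟨i, w', -, h2, h3⟩ := exists_eq_simple_mul hm
    have h4 : bar n (stdT w) - stdT w = gen i * (bar n (stdT w') - stdT w') +
        scal (v⁻¹ - v) * ((bar n (stdT w') - stdT w') + stdT w') := by
      rw [h3, map_mul, bar_gen, genInv]
      rw [scal_sub, scal_sub, sub_mul, sub_mul, mul_sub, sub_add_cancel, sub_mul]
      abel
    rw [h4, map_add, LinearMap.add_apply, rep_gen_mul_apply, rep_scal_mul_apply, map_add (rep A),
      LinearMap.add_apply]
    have h5 := ih w' h2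
    have h6 := invLT_rep_stdT f w'
    rw [h2] at h6
    exact (h5.act i).add (((h5.mono (Nat.le_succ _)).add h6).smul _)

end

/-! ### Bar-invariance and triangularity -/

theorem aeval_v_eq (p : Polynomial ℤ) : Polynomial.aeval v p =
    algebraMap (Polynomial ℚ) (RatFunc ℚ) (p.map (Int.castRingHom ℚ)) := by
  have h : ((Polynomial.aeval v : Polynomial ℤ →ₐ[ℤ] Qv) : Polynomial ℤ →+* Qv) =
      (algebraMap (Polynomial ℚ) (RatFunc ℚ)).comp (Polynomial.mapRingHom (Int.castRingHom ℚ)) := by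
    refine Polynomial.ringHom_ext' (RingHom.ext_int _ _) ?_
    simp [v]
  exact congrArg (fun g : Polynomial ℤ →+* Qv => g p) h

theorem aeval_v_injective {p q : Polynomial ℤ} (h : Polynomial.aeval v p = Polynomial.aeval v q) :
    p = q := by
  rw [aeval_v_eq, aeval_v_eq] at h
  exact Polynomial.map_injective _ Int.cast_injective (RatFunc.algebraMap_injective ℚ h)

theorem barQv_aeval (p : Polynomial ℤ) :
    barQv (Polynomial.aeval v p) = Polynomial.aeval v⁻¹ p := by
  have h : barQv.comp ((Polynomial.aeval v : Polynomial ℤ →ₐ[ℤ] Qv) : Polynomial ℤ →+* Qv) =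
      ((Polynomial.aeval v⁻¹ : Polynomial ℤ →ₐ[ℤ] Qv) : Polynomial ℤ →+* Qv) := by
    refine Polynomial.ringHom_ext' (RingHom.ext_int _ _) ?_
    simp [barQv_v]
  exact congrArg (fun g : Polynomial ℤ →+* Qv => g p) h

/-- For `d` the degree of `p`, bar-invariance reads `p.reverse = X^(d+2) p`, while `p.reverse` has
degree at most `d`. -/
theorem eq_zero_of_barQv_vMul {p : Polynomial ℤ} (h : barQv (vMul p) = vMul p) : p = 0 := by
  have hv := v_ne_zero
  let _ : Invertible (v⁻¹ : Qv) := invertibleOfNonzero (inv_ne_zero hv)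
  have h1 := Polynomial.eval₂_reverse_mul_pow (algebraMap ℤ Qv) v⁻¹ p
  rw [invOf_eq_inv, inv_inv] at h1
  rw [vMul, map_mul, barQv_aeval, barQv_v, Polynomial.aeval_def, ← h1, ← Polynomial.aeval_def] at h
  have h2 : Polynomial.aeval v p.reverse =
      Polynomial.aeval v (Polynomial.X ^ (p.natDegree + 2) * p) := by
    rw [map_mul, map_pow, Polynomial.aeval_X]
    have h3 : v * Polynomial.aeval v p * v ^ (p.natDegree + 1) =
        v⁻¹ * (Polynomial.aeval v p.reverse * v⁻¹ ^ p.natDegree) * v ^ (p.natDegree + 1) := by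
      rw [h]
    rw [inv_pow, pow_succ] at h3
    field_simp at h3
    rw [pow_add, ← h3]
    ring
  have h4 := aeval_v_injective h2
  by_contra hp
  have h5 := congrArg Polynomial.natDegree h4
  rw [Polynomial.natDegree_X_pow_mul _ hp] at h5
  have h6 := p.reverse_natDegree_le
  omega

section

variable {n : ℕ} {A : Type} [LinearOrder A]

theorem rep_sum_single {f : Fin n → A} {E : Finset (Equiv.Perm (Fin n))} (hf : inv f = 0)
    (hE : ∀ w ∈ E, inv (f ∘ ⇑w⁻¹) = len w)
    (hinj : ∀ w ∈ E, ∀ w' ∈ E, f ∘ ⇑w⁻¹ = f ∘ ⇑w'⁻¹ → w = w') (c : Equiv.Perm (Fin n) → Qv)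
    {w : Equiv.Perm (Fin n)} (hw : w ∈ E) :
    rep A (∑ y ∈ E, scal (c y) * stdT y) (Pi.single f 1) (f ∘ ⇑w⁻¹) = c w := by
  rw [map_sum, LinearMap.sum_apply, Finset.sum_apply, Finset.sum_eq_single_of_mem w hw]
  · rw [rep_scal_mul_apply, rep_stdT_single (by rw [hE w hw, hf, zero_add]), Pi.smul_apply,
      Pi.single_eq_same, smul_eq_mul, mul_one]
  · intro y hy hyw
    rw [rep_scal_mul_apply, rep_stdT_single (by rw [hE y hy, hf, zero_add]), Pi.smul_apply,
      Pi.single_eq_of_ne fun h => hyw (hinj w hw y hy h).symm, smul_zero]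

/-- Uniqueness for both kinds of Kazhdan–Lusztig elements: `f` is the identity with `E = S_n`, or
the vacuum with `E = W^J`. At an element of maximal length with nonzero coefficient, triangularity
makes that coefficient bar-invariant. -/
theorem eq_zero_of_rep_bar_eq {f : Fin n → A} {E : Finset (Equiv.Perm (Fin n))} (hf : inv f = 0)
    (hE : ∀ w ∈ E, inv (f ∘ ⇑w⁻¹) = len w)
    (hinj : ∀ w ∈ E, ∀ w' ∈ E, f ∘ ⇑w⁻¹ = f ∘ ⇑w'⁻¹ → w = w')
    {p : Equiv.Perm (Fin n) → Polynomial ℤ}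
    (h : rep A (bar n (∑ w ∈ E, scal (vMul (p w)) * stdT w)) (Pi.single f 1) =
      rep A (∑ w ∈ E, scal (vMul (p w)) * stdT w) (Pi.single f 1)) : ∀ w ∈ E, p w = 0 := by
  classical
  by_contra hc
  push Not at hc
  obtain ⟨w0, hw0, hp0⟩ := hc
  obtain ⟨w, hw, hmax⟩ := (E.filter fun w => p w ≠ 0).exists_max_image len
    ⟨w0, Finset.mem_filter.mpr ⟨hw0, hp0⟩⟩
  rw [Finset.mem_filter] at hw
  have h1 := congrFun h (f ∘ ⇑w⁻¹)
  rw [rep_sum_single hf hE hinj _ hw.1] at h1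
  have h2 : rep A (bar n (∑ w ∈ E, scal (vMul (p w)) * stdT w)) (Pi.single f 1) (f ∘ ⇑w⁻¹) =
      rep A (∑ w ∈ E, scal (barQv (vMul (p w))) * stdT w) (Pi.single f 1) (f ∘ ⇑w⁻¹) := by
    simp only [map_sum, LinearMap.sum_apply, Finset.sum_apply]
    refine Finset.sum_congr rfl fun y hy => ?_
    rw [map_mul, bar_scal, rep_scal_mul_apply, rep_scal_mul_apply, Pi.smul_apply, Pi.smul_apply]
    by_cases hpy : p y = 0
    · rw [hpy, vMul_zero, map_zero, zero_smul, zero_smul]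
    · congr 1
      have h3 := hmax y (Finset.mem_filter.mpr ⟨hy, hpy⟩)
      have h4 := invLT_rep_bar_stdT f y (f ∘ ⇑w⁻¹) (by rw [hE w hw.1, hf]; omega)
      rw [map_sub, LinearMap.sub_apply, Pi.sub_apply, sub_eq_zero] at h4
      exact h4
  rw [h2, rep_sum_single hf hE hinj _ hw.1] at h1
  exact hw.2 (eq_zero_of_barQv_vMul h1)

/-! ### The standard basis -/

theorem gen_mul_mem_span (i : Gen n) {x : Hecke n}
    (hx : x ∈ Submodule.span Qv (Set.range (stdT (n := n)))) :
    gen i * x ∈ Submodule.span Qv (Set.range (stdT (n := n))) := by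
  induction hx using Submodule.span_induction with
  | mem x hx =>
    obtain ⟨w, rfl⟩ := hx
    rcases lt_or_gt_of_ne (inv_lo_ne_inv_hi w i) with h | h
    · rw [← stdT_simple_mul_of_lt h]
      exact Submodule.subset_span ⟨_, rfl⟩
    · rw [gen_mul_stdT_of_gt h, ← Algebra.smul_def]
      exact add_mem (Submodule.subset_span ⟨_, rfl⟩)
        (Submodule.smul_mem _ _ (Submodule.subset_span ⟨_, rfl⟩))
  | zero => rw [mul_zero]; exact zero_mem _
  | add x y _ _ hx hy => rw [mul_add]; exact add_mem hx hy
  | smul c x _ hx => rw [mul_smul_comm]; exact Submodule.smul_mem _ _ hx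

theorem exists_eq_sum_stdT (h : Hecke n) :
    ∃ c : Equiv.Perm (Fin n) → Qv, h = ∑ w, scal (c w) * stdT w := by
  have key : ∀ x ∈ Submodule.span Qv (Set.range (stdT (n := n))),
      h * x ∈ Submodule.span Qv (Set.range (stdT (n := n))) := by
    induction h using hecke_induction with
    | hscal c => intro x hx; rw [← Algebra.smul_def]; exact Submodule.smul_mem _ _ hx
    | hgen i => exact fun x hx => gen_mul_mem_span i hx
    | hadd a b ha hb => intro x hx; rw [add_mul]; exact add_mem (ha x hx) (hb x hx)
    | hmul a b ha hb => intro x hx; rw [mul_assoc]; exact ha _ (hb x hx)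
  have h1 := key 1 (by rw [← stdT_one]; exact Submodule.subset_span ⟨_, rfl⟩)
  rw [mul_one, Submodule.mem_span_range_iff_exists_fun] at h1
  obtain ⟨c, hc⟩ := h1
  exact ⟨c, by rw [← hc]; simp only [Algebra.smul_def]⟩

theorem inv_id_comp (w : Equiv.Perm (Fin n)) : inv ((id : Fin n → Fin n) ∘ ⇑w⁻¹) = len w := by
  rw [len_eq_inv, Function.id_comp]

theorem id_comp_inv_inj (w w' : Equiv.Perm (Fin n))
    (h : (id : Fin n → Fin n) ∘ ⇑w⁻¹ = (id : Fin n → Fin n) ∘ ⇑w'⁻¹) : w = w' := by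
  simp only [Function.id_comp] at h
  exact inv_injective (Equiv.ext (congrFun h))

theorem rep_sum_single_id (c : Equiv.Perm (Fin n) → Qv) (w : Equiv.Perm (Fin n)) :
    rep (Fin n) (∑ y, scal (c y) * stdT y) (Pi.single id 1) ⇑w⁻¹ = c w :=
  rep_sum_single inv_id (fun w _ => inv_id_comp w) (fun w _ w' _ => id_comp_inv_inj w w') c
    (Finset.mem_univ w)

/-- The `T_w` span, and the action on the indicator of the identity recovers each coefficient.
Identities in the Hecke algebra can therefore be checked on functions. -/
theorem eq_of_rep_apply_eq {h h' : Hecke n} (e : ∀ w : Equiv.Perm (Fin n),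
    rep (Fin n) h (Pi.single id 1) ⇑w⁻¹ = rep (Fin n) h' (Pi.single id 1) ⇑w⁻¹) : h = h' := by
  obtain ⟨c, rfl⟩ := exists_eq_sum_stdT h
  obtain ⟨c', rfl⟩ := exists_eq_sum_stdT h'
  refine Finset.sum_congr rfl fun w _ => ?_
  have h1 := e w
  rw [rep_sum_single_id, rep_sum_single_id] at h1
  rw [h1]

theorem IsKL.unique {w : Equiv.Perm (Fin n)} {c c' : Hecke n} (h : IsKL w c) (h' : IsKL w c') :
    c = c' := by
  obtain ⟨hb, p, hp⟩ := h
  obtain ⟨hb', p', hp'⟩ := h'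
  have e : c - c' = ∑ y, scal (vMul (p y - p' y)) * stdT y := by
    rw [← sub_sub_sub_cancel_right c c' (stdT w), hp, hp', ← Finset.sum_sub_distrib]
    refine Finset.sum_congr rfl fun y _ => ?_
    rw [vMul_sub, scal_sub, sub_mul]
  have h1 := eq_zero_of_rep_bar_eq (f := (id : Fin n → Fin n)) inv_id (E := Finset.univ)
    (fun w _ => inv_id_comp w) (fun w _ w' _ => id_comp_inv_inj w w')
    (p := fun y => p y - p' y) (by rw [← e, map_sub, hb, hb'])
  rw [← sub_eq_zero, e]
  refine Finset.sum_eq_zero fun y hy => ?_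
  rw [h1 y hy, vMul_zero, scal, map_zero, zero_mul]

/-! ### Minimal coset representatives -/

/-- The sequence of `k` values `false` followed by values `true`. -/
def vacFin (n k : ℕ) : Fin n → Bool := fun a => decide (k ≤ a.1)

theorem vacFin_eq_iff {k : ℕ} {a b : Fin n} :
    vacFin n k a = vacFin n k b ↔ (k ≤ a.1 ↔ k ≤ b.1) := decide_eq_decide

theorem vacFin_monotone (n k : ℕ) : Monotone (vacFin n k) := by
  intro a b hab
  simp only [vacFin]
  rw [Bool.le_iff_imp]
  simp only [decide_eq_true_eq]
  exact fun h => h.trans hab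

theorem inv_vacFin (n k : ℕ) : inv (vacFin n k) = 0 := inv_eq_zero_of_monotone (vacFin_monotone n k)

theorem vacFin_lo_eq_hi {k : ℕ} {i : Gen n} (h : i.1 ≠ k) :
    vacFin n k (lo i) = vacFin n k (hi i) := by
  have := i.2.1
  rw [vacFin_eq_iff, val_lo, val_hi]
  omega

theorem vacFin_comp_of_mem {k : ℕ} {u : Equiv.Perm (Fin n)} (hu : u ∈ parabolic (maxJ n k)) :
    vacFin n k ∘ ⇑u = vacFin n k := by
  induction hu using Subgroup.closure_induction with
  | mem u hu =>
    obtain ⟨i, hi, rfl⟩ := hu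
    exact comp_simple_of_eq (vacFin_lo_eq_hi hi)
  | one => rfl
  | mul a b _ _ ha hb => rw [Equiv.Perm.coe_mul, ← Function.comp_assoc, ha, hb]
  | inv a _ ha =>
    nth_rw 1 [← ha]
    funext x
    simp

theorem ne_of_descent {k : ℕ} {u : Equiv.Perm (Fin n)} {i : Gen n}
    (hu : vacFin n k ∘ ⇑u⁻¹ = vacFin n k) (hi : u⁻¹ (hi i) < u⁻¹ (lo i)) : i.1 ≠ k := by
  rintro rfl
  have h1 := vacFin_eq_iff.mp (congrFun hu (lo i))
  have h2 := vacFin_eq_iff.mp (congrFun hu (Grassmannian.hi i))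
  have h3 := i.2.1
  rw [val_lo] at h1
  rw [val_hi] at h2
  have h4 := Fin.lt_def.mp hi
  omega

theorem mem_parabolic_of_vacFin_comp {k : ℕ} {u : Equiv.Perm (Fin n)}
    (hu : vacFin n k ∘ ⇑u⁻¹ = vacFin n k) : u ∈ parabolic (maxJ n k) := by
  induction hm : len u generalizing u with
  | zero => rw [eq_one_of_len_eq_zero hm]; exact one_mem _
  | succ m ih =>
    obtain ⟨i, h0⟩ := exists_descent_of_ne_one (w := u) (by rintro rfl; rw [len_one] at hm; omega)
    have h1 := len_simple_mul_of_gt h0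
    have h2 := ne_of_descent hu h0
    have h3 := ih (u := simple i * u) (by
      rw [coe_inv_simple_mul, ← Function.comp_assoc, hu, comp_simple_of_eq (vacFin_lo_eq_hi h2)])
      (by omega)
    rw [← simple_mul_cancel i u]
    exact mul_mem (Subgroup.subset_closure ⟨i, h2, rfl⟩) h3

theorem lt_of_vacFin_lt {k : ℕ} {w : Equiv.Perm (Fin n)} {a b : Fin n}
    (h : (vacFin n k ∘ ⇑w⁻¹) a < (vacFin n k ∘ ⇑w⁻¹) b) : w⁻¹ a < w⁻¹ b :=
  (vacFin_monotone n k).reflect_lt h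

theorem coe_vacFin_simple_mul (k : ℕ) (i : Gen n) (w : Equiv.Perm (Fin n)) :
    vacFin n k ∘ ⇑(simple i * w)⁻¹ = (vacFin n k ∘ ⇑w⁻¹) ∘ simple i := by
  rw [coe_inv_simple_mul, Function.comp_assoc]

theorem inv_vacFin_comp_le (k : ℕ) (w : Equiv.Perm (Fin n)) :
    inv (vacFin n k ∘ ⇑w⁻¹) ≤ len w := by
  have := inv_comp_inv_le (vacFin n k) w
  rwa [inv_vacFin, zero_add] at this

/-- A descent of a sequence-minimal permutation is a descent of its sequence. -/
theorem vacFin_descent {k : ℕ} {w : Equiv.Perm (Fin n)} (hw : inv (vacFin n k ∘ ⇑w⁻¹) = len w)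
    {i : Gen n} (h : w⁻¹ (hi i) < w⁻¹ (lo i)) :
    (vacFin n k ∘ ⇑w⁻¹) (hi i) < (vacFin n k ∘ ⇑w⁻¹) (lo i) := by
  have h1 := len_simple_mul_of_gt h
  have h2 := inv_vacFin_comp_le k (simple i * w)
  rw [coe_vacFin_simple_mul] at h2
  refine lt_of_le_of_ne (vacFin_monotone n k h.le) fun h3 => ?_
  rw [comp_simple_of_eq h3.symm] at h2
  omega

theorem inv_vacFin_simple_mul_of_gt {k : ℕ} {w : Equiv.Perm (Fin n)}
    (hw : inv (vacFin n k ∘ ⇑w⁻¹) = len w) {i : Gen n}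
    (h : (vacFin n k ∘ ⇑w⁻¹) (hi i) < (vacFin n k ∘ ⇑w⁻¹) (lo i)) :
    inv (vacFin n k ∘ ⇑(simple i * w)⁻¹) = len (simple i * w) := by
  have h1 := len_simple_mul_of_gt (lt_of_vacFin_lt h)
  have h2 := inv_comp_of_gt h
  rw [coe_vacFin_simple_mul]
  omega

theorem inv_vacFin_simple_mul_of_lt {k : ℕ} {w : Equiv.Perm (Fin n)}
    (hw : inv (vacFin n k ∘ ⇑w⁻¹) = len w) {i : Gen n}
    (h : (vacFin n k ∘ ⇑w⁻¹) (lo i) < (vacFin n k ∘ ⇑w⁻¹) (hi i)) :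
    inv (vacFin n k ∘ ⇑(simple i * w)⁻¹) = len (simple i * w) := by
  have h1 := len_simple_mul_of_lt (lt_of_vacFin_lt h)
  have h2 := inv_comp_of_lt h
  rw [coe_vacFin_simple_mul]
  omega

/-- Minimality means that no inversion of `w⁻¹` is hidden inside a block of constant value. This
turns `W^J` into a condition on the sequence `vacFin n k ∘ w⁻¹` alone. -/
theorem mem_minReps_iff {k : ℕ} {w : Equiv.Perm (Fin n)} :
    w ∈ minReps (maxJ n k) ↔ inv (vacFin n k ∘ ⇑w⁻¹) = len w := by
  constructor
  · intro hw
    induction hm : len w generalizing w with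
    | zero =>
      rw [eq_one_of_len_eq_zero hm, inv_one, Equiv.Perm.coe_one, Function.comp_id, inv_vacFin]
    | succ m ih =>
      obtain ⟨i, h0⟩ := exists_descent_of_ne_one (w := w) (by rintro rfl; rw [len_one] at hm; omega)
      have h1 := len_simple_mul_of_gt h0
      rcases (vacFin_monotone n k h0.le).lt_or_eq with h2 | h2
      · have h3 := ih (w := simple i * w) (fun u hu => by
          have h4 := hw u hu
          rw [mul_assoc]
          rcases lt_or_gt_of_ne (inv_lo_ne_inv_hi (w * u) i) with h5 | h5
          · have := len_simple_mul_of_lt h5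
            omega
          · have := len_simple_mul_of_gt h5
            omega) (by omega)
        have h4 : inv ((vacFin n k ∘ ⇑w⁻¹) ∘ simple i) + 1 = inv (vacFin n k ∘ ⇑w⁻¹) :=
          inv_comp_of_gt h2
        rw [coe_vacFin_simple_mul] at h3
        omega
      -- A left descent invisible in the sequence satisfies `s_i w = w u` with `u ∈ W_J`, which
      -- contradicts minimality.
      · have h3 : w⁻¹ * simple i * w ∈ parabolic (maxJ n k) := by
          refine mem_parabolic_of_vacFin_comp ?_
          have e : (w⁻¹ * simple i * w)⁻¹ = w⁻¹ * simple i * w := by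
            simp only [mul_inv_rev, inv_inv, simple_inv, mul_assoc]
          rw [e, Equiv.Perm.coe_mul, Equiv.Perm.coe_mul, ← Function.comp_assoc,
            ← Function.comp_assoc, comp_simple_of_eq (f := vacFin n k ∘ ⇑w⁻¹) h2.symm]
          funext x
          simp
        have h4 := hw _ h3
        rw [← mul_assoc, ← mul_assoc, mul_inv_cancel, one_mul] at h4
        omega
  · intro hw u hu
    have h1 := inv_vacFin_comp_le k (w * u)
    rw [mul_inv_rev, Equiv.Perm.coe_mul, ← Function.comp_assoc,
      vacFin_comp_of_mem (inv_mem hu), hw] at h1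
    exact h1

/-- Descents of a minimal representative are visible in its sequence, so two representatives of one
sequence can be reduced simultaneously. -/
theorem eq_of_vacFin_comp_eq {k : ℕ} {w w' : Equiv.Perm (Fin n)}
    (hw : inv (vacFin n k ∘ ⇑w⁻¹) = len w) (hw' : inv (vacFin n k ∘ ⇑w'⁻¹) = len w')
    (h : vacFin n k ∘ ⇑w⁻¹ = vacFin n k ∘ ⇑w'⁻¹) : w = w' := by
  induction hm : len w generalizing w w' with
  | zero =>
    rw [eq_one_of_len_eq_zero hm, eq_one_of_len_eq_zero (w := w') (by rw [← hw', ← h, hw, hm])]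
  | succ m ih =>
    obtain ⟨i, h0⟩ := exists_descent_of_ne_one (w := w) (by rintro rfl; rw [len_one] at hm; omega)
    have h1 := len_simple_mul_of_gt h0
    have h2 := vacFin_descent hw h0
    have h3 := ih (inv_vacFin_simple_mul_of_gt hw h2)
      (inv_vacFin_simple_mul_of_gt hw' (by rwa [← h]))
      (by rw [coe_vacFin_simple_mul, coe_vacFin_simple_mul, h]) (by omega)
    exact mul_left_cancel h3

/-! ### The standard basis of the parabolic module -/

/-- The indicator of the vacuum is killed by the generators of `parIdeal`, so `M^J` maps to
functions of sequences. This gives the independence of the `m_z`. -/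
theorem rep_eq_of_smul_mOne_eq {k : ℕ} {h h' : Hecke n}
    (e : h • mOne (maxJ n k) = h' • mOne (maxJ n k)) :
    rep Bool h (Pi.single (vacFin n k) 1) = rep Bool h' (Pi.single (vacFin n k) 1) := by
  have h1 : h - h' ∈ parIdeal (maxJ n k) := by
    rw [mOne, ← map_smul, ← map_smul, smul_eq_mul, smul_eq_mul, mul_one, mul_one,
      Submodule.mkQ_apply, Submodule.mkQ_apply, Submodule.Quotient.eq] at e
    exact e
  have h2 : ∀ x ∈ parIdeal (maxJ n k), rep Bool x (Pi.single (vacFin n k) 1) = 0 := by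
    intro x hx
    rw [parIdeal] at hx
    induction hx using Submodule.span_induction with
    | mem x hx =>
      obtain ⟨j, hj, rfl⟩ := hx
      rw [map_add, LinearMap.add_apply, rep_gen, act_single_of_eq (vacFin_lo_eq_hi hj),
        AlgHom.commutes, Module.algebraMap_end_apply, ← add_smul, neg_add_cancel, zero_smul]
    | zero => rw [map_zero]; rfl
    | add x y _ _ hx hy => rw [map_add, LinearMap.add_apply, hx, hy, add_zero]
    | smul c x _ hx => rw [smul_eq_mul, map_mul, Module.End.mul_apply, hx, map_zero]
  have h3 := h2 _ h1
  rwa [map_sub, LinearMap.sub_apply, sub_eq_zero] at h3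

theorem stdT_eq_gen_mul_of_gt {j : Gen n} {w : Equiv.Perm (Fin n)}
    (h : w⁻¹ (hi j) < w⁻¹ (lo j)) : stdT w = gen j * stdT (simple j * w) := by
  rw [← stdT_simple_mul_of_lt, simple_mul_cancel]
  rw [coe_inv_simple_mul, Function.comp, Function.comp, simple_lo, simple_hi]
  exact h

/-- The case `s_i w ∈ w W_J` of the action on `m_w`, by induction on length. Let `j` be a descent of
`w`. If `i` and `j` are far apart, `T_i` passes `T_j`. If they are neighbours, then `w = s_j s_i
w''`, and the braid relation turns the action of `T_i` on `m_w` into that of `T_j` on `m_{w''}`. -/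
theorem gen_smul_mStd_of_eq {k : ℕ} {w : Equiv.Perm (Fin n)}
    (hw : inv (vacFin n k ∘ ⇑w⁻¹) = len w) {i : Gen n}
    (h : (vacFin n k ∘ ⇑w⁻¹) (lo i) = (vacFin n k ∘ ⇑w⁻¹) (hi i)) :
    gen i • mStd (maxJ n k) w = (scal (-v⁻¹) : Hecke n) • mStd (maxJ n k) w := by
  induction hm : len w using Nat.strong_induction_on generalizing w i with
  | _ m ih =>
  by_cases hw1 : w = 1
  · subst hw1
    rw [mStd, stdT_one, one_smul]
    refine gen_smul_mOne _ _ fun hik => ?_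
    have := i.2.1
    simp [vacFin, val_lo, val_hi, hik] at h
    omega
  obtain ⟨j, h0⟩ := exists_descent_of_ne_one hw1
  have h1 := len_simple_mul_of_gt h0
  have h2 := vacFin_descent hw h0
  have h3 := inv_vacFin_simple_mul_of_gt hw h2
  have e1 := stdT_eq_gen_mul_of_gt h0
  have hcs : ∀ (x : Hecke n) (c : Qv) (m : ParMod (maxJ n k)),
      x • (scal c : Hecke n) • m = (scal c : Hecke n) • x • m := fun x c m => by
    rw [smul_smul, smul_smul, ← Algebra.commutes]
  have key_comm : gen i * gen j = gen j * gen i →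
      ((vacFin n k ∘ ⇑w⁻¹) ∘ simple j) (lo i) = ((vacFin n k ∘ ⇑w⁻¹) ∘ simple j) (hi i) →
      gen i • mStd (maxJ n k) w = (scal (-v⁻¹) : Hecke n) • mStd (maxJ n k) w := by
    intro hc he
    have h4 := ih _ (by omega) h3 (i := i) (by rw [coe_vacFin_simple_mul]; exact he) rfl
    rw [mStd] at h4 ⊢
    rw [e1, smul_smul, ← mul_assoc, hc, mul_assoc, mul_smul (gen j), mul_smul (gen i), h4,
      hcs, mul_smul (gen j)]
  have key_braid : gen i * gen j * gen i = gen j * gen i * gen j →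
      ((vacFin n k ∘ ⇑w⁻¹) ∘ simple j) (hi i) < ((vacFin n k ∘ ⇑w⁻¹) ∘ simple j) (lo i) →
      (((vacFin n k ∘ ⇑w⁻¹) ∘ simple j) ∘ simple i) (lo j) =
        (((vacFin n k ∘ ⇑w⁻¹) ∘ simple j) ∘ simple i) (hi j) →
      gen i • mStd (maxJ n k) w = (scal (-v⁻¹) : Hecke n) • mStd (maxJ n k) w := by
    intro hc hd he
    rw [← coe_vacFin_simple_mul] at hd he
    have h4 := inv_vacFin_simple_mul_of_gt h3 hd
    have h5 := len_simple_mul_of_gt (lt_of_vacFin_lt hd)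
    have e2 := stdT_eq_gen_mul_of_gt (lt_of_vacFin_lt hd)
    have h6 := ih _ (by omega) h4 (i := j) (by rw [coe_vacFin_simple_mul]; exact he) rfl
    rw [mStd] at h6 ⊢
    have h7 : ∀ m : ParMod (maxJ n k), gen i • gen j • gen i • m = gen j • gen i • gen j • m := by
      intro m
      rw [← mul_smul, ← mul_smul, ← mul_smul, ← mul_smul, hc]
    rw [e1, e2, mul_smul, mul_smul, h7, h6, hcs, hcs]
  rcases lt_trichotomy i.1 j.1 with hij | hij | hij
  · rcases Nat.lt_or_eq_of_le (Nat.succ_le_of_lt hij) with h4 | h4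
    · refine key_comm (gen_comm i j h4) ?_
      simp only [Function.comp_apply] at h ⊢
      rw [simple_lo_of_gt h4, simple_hi_of_gt h4]
      exact h
    · refine key_braid (gen_braid i j h4) ?_ ?_
      · simp only [Function.comp_apply] at h h2 ⊢
        rw [hi_eq_lo h4, simple_lo, simple_lo_of_pred h4, h, hi_eq_lo h4]
        exact h2
      · simp only [Function.comp_apply] at h h2 ⊢
        rw [simple_hi_of_succ h4, simple_hi, ← hi_eq_lo h4, simple_hi, simple_lo_of_pred h4, h]
  · obtain rfl : i = j := Subtype.ext hij
    exact absurd h h2.ne'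
  · rcases Nat.lt_or_eq_of_le (Nat.succ_le_of_lt hij) with h4 | h4
    · refine key_comm (gen_comm j i h4).symm ?_
      simp only [Function.comp_apply] at h ⊢
      rw [simple_lo_of_lt h4, simple_hi_of_lt h4]
      exact h
    · refine key_braid (gen_braid j i h4).symm ?_ ?_
      · simp only [Function.comp_apply] at h h2 ⊢
        rw [← hi_eq_lo h4, simple_hi, simple_hi_of_succ h4, ← h, ← hi_eq_lo h4]
        exact h2
      · simp only [Function.comp_apply] at h h2 ⊢
        rw [simple_lo_of_pred h4, simple_lo, hi_eq_lo h4, simple_lo, simple_hi_of_succ h4, h]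

theorem exists_eq_sum_mStd {k : ℕ} (h : Hecke n) : ∃ c : Equiv.Perm (Fin n) → Qv,
    open Classical in h • mOne (maxJ n k) =
      ∑ z with z ∈ minReps (maxJ n k), (scal (c z) : Hecke n) • mStd (maxJ n k) z := by
  classical
  set S : Submodule Qv (ParMod (maxJ n k)) :=
    Submodule.span Qv (mStd (maxJ n k) '' minReps (maxJ n k)) with hS
  have hsc : ∀ (c : Qv) (m : ParMod (maxJ n k)), (scal c : Hecke n) • m = c • m := fun c m => by
    rw [scal, algebraMap_smul]
  have hgen : ∀ i : Gen n, ∀ m ∈ S, gen i • m ∈ S := by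
    intro i m hm
    induction hm using Submodule.span_induction with
    | mem m hm =>
      obtain ⟨w, hw, rfl⟩ := hm
      have hw' := mem_minReps_iff.mp hw
      rcases lt_trichotomy ((vacFin n k ∘ ⇑w⁻¹) (lo i)) ((vacFin n k ∘ ⇑w⁻¹) (hi i)) with h1 | h1 | h1
      · refine Submodule.subset_span ⟨simple i * w,
          mem_minReps_iff.mpr (inv_vacFin_simple_mul_of_lt hw' h1), ?_⟩
        rw [mStd, mStd, stdT_simple_mul_of_lt (lt_of_vacFin_lt h1), mul_smul]
      · rw [gen_smul_mStd_of_eq hw' h1, hsc]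
        exact Submodule.smul_mem _ _ (Submodule.subset_span ⟨w, hw, rfl⟩)
      · rw [mStd, smul_smul, gen_mul_stdT_of_gt (lt_of_vacFin_lt h1), add_smul, mul_smul, hsc]
        exact add_mem (Submodule.subset_span ⟨simple i * w,
          mem_minReps_iff.mpr (inv_vacFin_simple_mul_of_gt hw' h1), rfl⟩)
          (Submodule.smul_mem _ _ (Submodule.subset_span ⟨w, hw, rfl⟩))
    | zero => rw [smul_zero]; exact zero_mem _
    | add x y _ _ hx hy => rw [smul_add]; exact add_mem hx hy
    | smul c x _ hx =>
      rw [← hsc, smul_smul, ← Algebra.commutes, mul_smul, hsc]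
      exact Submodule.smul_mem _ _ hx
  have key : ∀ m ∈ S, h • m ∈ S := by
    induction h using hecke_induction with
    | hscal c => intro x hx; rw [hsc]; exact Submodule.smul_mem _ _ hx
    | hgen i => exact fun x hx => hgen i x hx
    | hadd a b ha hb => intro x hx; rw [add_smul]; exact add_mem (ha x hx) (hb x hx)
    | hmul a b ha hb => intro x hx; rw [mul_smul]; exact ha _ (hb x hx)
  have h1 := key (mOne (maxJ n k)) (Submodule.subset_span ⟨1, mem_minReps_iff.mpr (by
    rw [inv_one, Equiv.Perm.coe_one, Function.comp_id, inv_vacFin, len_one]), by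
    rw [mStd, stdT_one, one_smul]⟩)
  have h2 : mStd (maxJ n k) '' minReps (maxJ n k) = mStd (maxJ n k) ''
      ((Finset.univ.filter fun z => z ∈ minReps (maxJ n k) : Finset (Equiv.Perm (Fin n))) :
        Set (Equiv.Perm (Fin n))) := by simp
  rw [hS, h2, Submodule.mem_span_image_finset_iff_exists_fun] at h1
  obtain ⟨c, hc⟩ := h1
  refine ⟨fun z => if hz : z ∈ Finset.univ.filter fun z => z ∈ minReps (maxJ n k)
    then c ⟨z, hz⟩ else 0, ?_⟩
  rw [← hc]
  refine Eq.trans (Finset.sum_congr rfl fun z _ => ?_) (Finset.sum_coe_sort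
    (Finset.univ.filter fun z => z ∈ minReps (maxJ n k)) _)
  simp only [hsc, dif_pos z.2]

theorem IsParKL.unique {k : ℕ} {w : Equiv.Perm (Fin n)} {c c' : ParMod (maxJ n k)}
    (h : IsParKL (maxJ n k) w c) (h' : IsParKL (maxJ n k) w c') : c = c' := by
  classical
  obtain ⟨hb, p, hp⟩ := h
  obtain ⟨hb', p', hp'⟩ := h'
  set E := Finset.univ.filter fun z => z ∈ minReps (maxJ n k)
  set d : Hecke n := ∑ z ∈ E, scal (vMul (p z - p' z)) * stdT z with hd
  have e : c - c' = d • mOne (maxJ n k) := by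
    rw [← sub_sub_sub_cancel_right c c' (mStd (maxJ n k) w), hp, hp', ← Finset.sum_sub_distrib,
      hd, Finset.sum_smul]
    refine Finset.sum_congr rfl fun y _ => ?_
    rw [vMul_sub, scal_sub, mul_smul, ← mStd, sub_smul]
  have hE : ∀ w ∈ E, inv (vacFin n k ∘ ⇑w⁻¹) = len w := fun w hw =>
    mem_minReps_iff.mp (Finset.mem_filter.mp hw).2
  have h1 := eq_zero_of_rep_bar_eq (f := vacFin n k) (inv_vacFin n k) (E := E) hE
    (fun w hw w' hw' h => eq_of_vacFin_comp_eq (hE w hw) (hE w' hw') h)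
    (p := fun y => p y - p' y) (by
      refine rep_eq_of_smul_mOne_eq ?_
      rw [← barM_smul_mOne, ← hd, ← e, map_sub, hb, hb'])
  rw [← sub_eq_zero, e, hd, Finset.sum_smul]
  refine Finset.sum_eq_zero fun y hy => ?_
  rw [h1 y hy, vMul_zero, scal, map_zero, zero_mul, zero_smul]

end

/-! ### The Kazhdan–Lusztig element of the longest element of the parabolic subgroup -/

section

variable {n k : ℕ}

theorem mem_parabolic_iff {u : Equiv.Perm (Fin n)} :
    u ∈ parabolic (maxJ n k) ↔ vacFin n k ∘ ⇑u⁻¹ = vacFin n k :=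
  ⟨fun h => vacFin_comp_of_mem (inv_mem h), mem_parabolic_of_vacFin_comp⟩

theorem simple_mul_mem_parabolic_iff {i : Gen n} (h : i.1 ≠ k) {u : Equiv.Perm (Fin n)} :
    simple i * u ∈ parabolic (maxJ n k) ↔ u ∈ parabolic (maxJ n k) :=
  Subgroup.mul_mem_cancel_left _ (Subgroup.subset_closure ⟨i, h, rfl⟩)

theorem longest_mem (J : Set (Gen n)) : longest J ∈ parabolic J :=
  (Classical.choose_spec (exists_longest J)).1

theorem len_le_len_longest {J : Set (Gen n)} {u : Equiv.Perm (Fin n)} (hu : u ∈ parabolic J) :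
    len u ≤ len (longest J) :=
  (Classical.choose_spec (exists_longest J)).2 u hu

theorem descent_of_len_le {u : Equiv.Perm (Fin n)} (hu : u ∈ parabolic (maxJ n k))
    (h : len (longest (maxJ n k)) ≤ len u) {i : Gen n} (hi : i.1 ≠ k) :
    u⁻¹ (Grassmannian.hi i) < u⁻¹ (lo i) := by
  refine (lt_or_gt_of_ne (inv_lo_ne_inv_hi u i)).resolve_left fun h1 => ?_
  have h2 := len_simple_mul_of_lt h1
  have h3 := len_le_len_longest ((simple_mul_mem_parabolic_iff hi).mpr hu)
  omega

theorem inv_lt_inv_of_descents {u : Equiv.Perm (Fin n)}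
    (h : ∀ i : Gen n, i.1 ≠ k → u⁻¹ (hi i) < u⁻¹ (lo i)) {a b : Fin n} (hab : a < b)
    (he : vacFin n k a = vacFin n k b) : u⁻¹ b < u⁻¹ a := by
  obtain ⟨a, ha⟩ := a
  obtain ⟨b, hb⟩ := b
  rw [vacFin_eq_iff] at he
  rw [Fin.mk_lt_mk] at hab
  simp only at he
  induction b, hab using Nat.le_induction with
  | base => exact h ⟨a + 1, by omega, hb⟩ (by change a + 1 ≠ k; omega)
  | succ b hab ih =>
    exact (h ⟨b + 1, by omega, hb⟩ (by change b + 1 ≠ k; omega)).trans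
      (ih (by omega) (by omega))

/-- A left descent of `w⁻¹ * u` would be a pair of neighbours in one block; both inverses reverse
the order inside blocks, so the descent is impossible. -/
theorem eq_of_descents {u w : Equiv.Perm (Fin n)} (hu : u ∈ parabolic (maxJ n k))
    (hw : w ∈ parabolic (maxJ n k)) (hu' : ∀ i : Gen n, i.1 ≠ k → u⁻¹ (hi i) < u⁻¹ (lo i))
    (hw' : ∀ i : Gen n, i.1 ≠ k → w⁻¹ (hi i) < w⁻¹ (lo i)) : u = w := by
  by_contra hne
  obtain ⟨i, h⟩ := exists_descent_of_ne_one (w := w⁻¹ * u) fun h =>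
    hne (eq_of_inv_mul_eq_one h).symm
  have e : ∀ a, (w⁻¹ * u)⁻¹ a = u⁻¹ (w a) := fun a => by simp
  rw [e, e] at h
  have hik : i.1 ≠ k := ne_of_descent (u := w⁻¹ * u)
    (mem_parabolic_iff.mp (mul_mem (inv_mem hw) hu)) (by rwa [e, e])
  have h1 : ∀ a, vacFin n k (w a) = vacFin n k a := congrFun (vacFin_comp_of_mem hw)
  have h2 := vacFin_lo_eq_hi hik
  rcases lt_trichotomy (w (lo i)) (w (hi i)) with h3 | h3 | h3
  · have h4 := inv_lt_inv_of_descents hw' h3 (by rw [h1, h1, h2])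
    have h5 : ∀ a, w⁻¹ (w a) = a := fun a => by simp
    rw [h5, h5] at h4
    exact absurd (lo_lt_hi i) h4.not_gt
  · exact (lo_lt_hi i).ne (w.injective h3)
  · exact absurd (inv_lt_inv_of_descents hu' h3 (by rw [h1, h1, h2])) h.not_gt

theorem eq_longest_of_descents {u : Equiv.Perm (Fin n)} (hu : u ∈ parabolic (maxJ n k))
    (h : ∀ i : Gen n, i.1 ≠ k → u⁻¹ (hi i) < u⁻¹ (lo i)) : u = longest (maxJ n k) :=
  eq_of_descents hu (longest_mem _) h fun _ hi => descent_of_len_le (longest_mem _) le_rfl hi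

theorem eq_longest_of_len_le {u : Equiv.Perm (Fin n)} (hu : u ∈ parabolic (maxJ n k))
    (h : len (longest (maxJ n k)) ≤ len u) : u = longest (maxJ n k) :=
  eq_longest_of_descents hu fun _ hi => descent_of_len_le hu h hi

theorem len_mul_of_mem {z u : Equiv.Perm (Fin n)} (hz : z ∈ minReps (maxJ n k))
    (hu : u ∈ parabolic (maxJ n k)) : len (z * u) = len z + len u := by
  rw [mem_minReps_iff] at hz
  induction hm : len z generalizing z with
  | zero => rw [eq_one_of_len_eq_zero hm, one_mul, zero_add]
  | succ m ih =>
    obtain ⟨i, h0⟩ := exists_descent_of_ne_one (w := z) (by rintro rfl; rw [len_one] at hm; omega)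
    have h1 := len_simple_mul_of_gt h0
    have h2 := vacFin_descent hz h0
    have h3 := ih (inv_vacFin_simple_mul_of_gt hz h2) (by omega)
    rw [mul_assoc] at h3
    have e : vacFin n k ∘ ⇑(z * u)⁻¹ = vacFin n k ∘ ⇑z⁻¹ := by
      rw [mul_inv_rev, Equiv.Perm.coe_mul, ← Function.comp_assoc, vacFin_comp_of_mem (inv_mem hu)]
    have h4 := len_simple_mul_of_gt (w := z * u) (i := i) (lt_of_vacFin_lt (by rwa [e]))
    omega

theorem exists_eq_mul (y : Equiv.Perm (Fin n)) : ∃ z u, z ∈ minReps (maxJ n k) ∧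
    u ∈ parabolic (maxJ n k) ∧ y = z * u ∧ vacFin n k ∘ ⇑y⁻¹ = vacFin n k ∘ ⇑z⁻¹ ∧
    len y = inv (vacFin n k ∘ ⇑y⁻¹) + len u := by
  obtain ⟨u, hu, hmin⟩ := Set.exists_min_image (parabolic (maxJ n k) : Set (Equiv.Perm (Fin n)))
    (fun u => len (y * u)) (Set.toFinite _) ⟨1, one_mem _⟩
  have hz : y * u ∈ minReps (maxJ n k) := fun u' hu' => by
    rw [mul_assoc]
    exact hmin _ (mul_mem hu hu')
  have hy : y = y * u * u⁻¹ := by rw [mul_inv_cancel_right]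
  have e : vacFin n k ∘ ⇑y⁻¹ = vacFin n k ∘ ⇑(y * u)⁻¹ := by
    rw [mul_inv_rev, Equiv.Perm.coe_mul, ← Function.comp_assoc, vacFin_comp_of_mem (inv_mem hu)]
  refine ⟨y * u, u⁻¹, hz, inv_mem hu, hy, e, ?_⟩
  rw [e, mem_minReps_iff.mp hz]
  conv_lhs => rw [hy]
  exact len_mul_of_mem hz (inv_mem hu)

/-! ### The embedding `h 1 ↦ h C_J` of the parabolic module -/

variable (n k) in
open Classical in
/-- The weight of a sequence in the image of the parabolic module in the Hecke algebra. -/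
noncomputable def weight (f : Fin n → Fin n) : Qv :=
  if Function.Injective f then
    (-v) ^ ((len (longest (maxJ n k)) : ℤ) + inv (vacFin n k ∘ f) - inv f) else 0

/-- The embedding of the parabolic module in the Hecke algebra, in terms of functions. -/
noncomputable def emb (φ : (Fin n → Bool) → Qv) : (Fin n → Fin n) → Qv :=
  fun f => φ (vacFin n k ∘ f) * weight n k f

/-- An exchange between the two blocks changes both inversion numbers in the weight equally. One
inside a block changes only `inv f`, and the resulting factor accounts for the eigenvalue `-v⁻¹` of
`T_i` on the parabolic side. -/
theorem act_emb (i : Gen n) (φ : (Fin n → Bool) → Qv) :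
    act i (emb (k := k) φ) = emb (k := k) (act i φ) := by
  have hv := v_ne_zero
  have hv' : -v ≠ 0 := neg_ne_zero.mpr hv
  funext f
  by_cases hf : Function.Injective f
  · have hf' : Function.Injective (f ∘ simple i) := hf.comp (simple i).injective
    rcases lt_trichotomy (f (lo i)) (f (hi i)) with h | h | h
    · rw [act_apply_of_lt _ h]
      have h1 := inv_comp_of_lt h
      rcases (vacFin_monotone n k h.le).lt_or_eq with h2 | h2
      · have h3 := inv_comp_of_lt (f := vacFin n k ∘ f) h2
        rw [emb, emb, act_apply_of_lt (f := vacFin n k ∘ f) _ h2, weight, weight, if_pos hf,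
          if_pos hf', h1, ← Function.comp_assoc, h3]
        congr 2
        push_cast
        ring
      · rw [emb, emb, act_apply_of_eq (f := vacFin n k ∘ f) _ h2, weight, weight, if_pos hf,
          if_pos hf', h1, ← Function.comp_assoc, comp_simple_of_eq (f := vacFin n k ∘ f) h2]
        push_cast
        rw [← sub_sub, zpow_sub_one₀ hv', inv_neg]
        ring
    · exact absurd (hf h) (lo_lt_hi i).ne
    · rw [act_apply_of_gt _ h]
      have h1 := inv_comp_of_gt h
      rcases (vacFin_monotone n k h.le).lt_or_eq with h2 | h2
      · have h3 := inv_comp_of_gt (f := vacFin n k ∘ f) h2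
        rw [emb, emb, emb, act_apply_of_gt (f := vacFin n k ∘ f) _ h2, weight, weight, if_pos hf,
          if_pos hf', ← h1, ← Function.comp_assoc, ← h3]
        push_cast
        rw [← add_assoc, add_sub_add_right_eq_sub]
        ring
      · rw [emb, emb, emb, act_apply_of_eq (f := vacFin n k ∘ f) _ h2.symm, weight, weight,
          if_pos hf, if_pos hf', ← h1, ← Function.comp_assoc,
          comp_simple_of_eq (f := vacFin n k ∘ f) h2.symm]
        push_cast
        rw [← sub_sub, zpow_sub_one₀ hv', inv_neg]
        field_simp
        ring
  · have hf' : ¬ Function.Injective (f ∘ simple i) := fun h => hf (by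
      have := h.comp (simple i).injective
      rwa [comp_simple_comp_simple] at this)
    have h0 : ∀ ψ : (Fin n → Bool) → Qv, emb (k := k) ψ f = 0 := fun ψ => by
      rw [emb, weight, if_neg hf, mul_zero]
    have h1 : emb (k := k) φ (f ∘ simple i) = 0 := by rw [emb, weight, if_neg hf', mul_zero]
    rw [act_apply, h0, h0, h1]
    simp

theorem rep_emb (h : Hecke n) (φ : (Fin n → Bool) → Qv) :
    rep (Fin n) h (emb (k := k) φ) = emb (k := k) (rep Bool h φ) := by
  induction h using hecke_induction generalizing φ with
  | hscal c =>
    rw [AlgHom.commutes, AlgHom.commutes, Module.algebraMap_end_apply, Module.algebraMap_end_apply]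
    funext f
    rw [Pi.smul_apply, emb, emb, Pi.smul_apply, smul_mul_assoc]
  | hgen i => rw [rep_gen, rep_gen, act_emb]
  | hadd x y hx hy =>
    rw [map_add, map_add, LinearMap.add_apply, LinearMap.add_apply, hx, hy]
    funext f
    rw [Pi.add_apply, emb, emb, emb, Pi.add_apply, add_mul]
  | hmul x y hx hy => rw [map_mul, map_mul, Module.End.mul_apply, Module.End.mul_apply, hy, hx]

variable (n k) in
/-- The sum of the `(-v)^{l(w_0^J) - l(u)} T_u` over the elements `u` of `W_J`. -/
noncomputable def antiSym : Hecke n :=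
  ∑ w : Equiv.Perm (Fin n), scal (emb (k := k) (Pi.single (vacFin n k) 1) ⇑w⁻¹) * stdT w

theorem rep_antiSym : rep (Fin n) (antiSym n k) (Pi.single id 1) =
    emb (k := k) (Pi.single (vacFin n k) 1) := by
  funext f
  by_cases hf : Function.Injective f
  · set w : Equiv.Perm (Fin n) := (Equiv.ofBijective f (Finite.injective_iff_bijective.mp hf))⁻¹
      with hw
    have e : f = ⇑w⁻¹ := by rw [hw, inv_inv]; rfl
    rw [e, antiSym, rep_sum_single_id]
  · rw [emb, weight, if_neg hf, mul_zero, antiSym, map_sum, LinearMap.sum_apply, Finset.sum_apply]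
    refine Finset.sum_eq_zero fun w _ => ?_
    rw [rep_scal_mul_apply, rep_stdT_single (by rw [inv_id_comp, inv_id, zero_add]), Pi.smul_apply,
      Pi.single_eq_of_ne, smul_zero]
    rintro rfl
    exact hf w⁻¹.injective

theorem rep_mul_antiSym (h : Hecke n) : rep (Fin n) (h * antiSym n k) (Pi.single id 1) =
    emb (k := k) (rep Bool h (Pi.single (vacFin n k) 1)) := by
  rw [map_mul, Module.End.mul_apply, rep_antiSym, rep_emb]

theorem gen_mul_antiSym {i : Gen n} (hik : i.1 ≠ k) :
    gen i * antiSym n k = scal (-v⁻¹) * antiSym n k := by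
  refine eq_of_rep_apply_eq fun w => congrFun ?_ _
  rw [rep_mul_antiSym, rep_mul_antiSym, rep_gen, act_single_of_eq (vacFin_lo_eq_hi hik),
    AlgHom.commutes, Module.algebraMap_end_apply]

theorem gen_mul_bar_antiSym {i : Gen n} (hik : i.1 ≠ k) :
    gen i * bar n (antiSym n k) = scal (-v⁻¹) * bar n (antiSym n k) := by
  have h := congrArg (bar n) (gen_mul_antiSym hik)
  rw [map_mul, map_mul, bar_gen, bar_scal, map_neg, map_inv₀, barQv_v, inv_inv, genInv, sub_mul,
    sub_eq_iff_eq_add, ← add_mul, scal, scal, ← map_add] at h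
  rw [h]
  congr 2
  ring

theorem rep_bar_stdT_of_not_mem {u : Equiv.Perm (Fin n)} (hu : u ∈ parabolic (maxJ n k))
    {w : Equiv.Perm (Fin n)} (hw : w ∉ parabolic (maxJ n k)) :
    rep (Fin n) (bar n (stdT u)) (Pi.single id 1) ⇑w⁻¹ = 0 := by
  induction hm : len u generalizing u w with
  | zero =>
    rw [eq_one_of_len_eq_zero hm, stdT_one, map_one, map_one, Module.End.one_apply,
      Pi.single_eq_of_ne]
    intro h
    have : w⁻¹ = 1 := Equiv.ext (congrFun h)
    rw [inv_eq_one.mp this] at hw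
    exact hw (one_mem _)
  | succ m ih =>
    obtain ⟨i, h0⟩ := exists_descent_of_ne_one (w := u) (by rintro rfl; rw [len_one] at hm; omega)
    have h1 := len_simple_mul_of_gt h0
    have hik := ne_of_descent (mem_parabolic_iff.mp hu) h0
    have hu' := (simple_mul_mem_parabolic_iff hik).mpr hu
    have h2 := ih hu' hw (by omega)
    have h3 := ih (w := simple i * w) hu' (fun h => hw ((simple_mul_mem_parabolic_iff hik).mp h))
      (by omega)
    rw [coe_inv_simple_mul] at h3
    rw [stdT_eq_gen_mul_of_gt h0, map_mul, bar_gen, genInv, sub_mul, map_sub, LinearMap.sub_apply,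
      Pi.sub_apply, rep_scal_mul_apply, rep_gen_mul_apply, Pi.smul_apply, act_apply, h2, h3]
    simp

theorem emb_single_of_not_mem {w : Equiv.Perm (Fin n)} (hw : w ∉ parabolic (maxJ n k)) :
    emb (k := k) (Pi.single (vacFin n k) 1) ⇑w⁻¹ = 0 := by
  rw [emb, Pi.single_eq_of_ne fun h => hw (mem_parabolic_iff.mpr h), zero_mul]

theorem emb_single_longest :
    emb (k := k) (Pi.single (vacFin n k) 1) ⇑(longest (maxJ n k))⁻¹ = 1 := by
  rw [emb, mem_parabolic_iff.mp (longest_mem (maxJ n k)), Pi.single_eq_same, weight,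
    if_pos (Equiv.injective _), mem_parabolic_iff.mp (longest_mem (maxJ n k)), inv_vacFin,
    ← len_eq_inv]
  simp

/-- Both elements are supported on `W_J` and are eigenvectors of `T_i`, `i ≠ k`, for `-v⁻¹`. Hence
the coefficient `D` of their difference at `w` determines the one at `s_i w` up to a unit, and a
nonzero `D` of maximal length would sit at `longest`, where both coefficients are `1`. -/
theorem bar_antiSym : bar n (antiSym n k) = antiSym n k := by
  set D : Equiv.Perm (Fin n) → Qv := fun w =>
    rep (Fin n) (bar n (antiSym n k)) (Pi.single id 1) ⇑w⁻¹ -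
      rep (Fin n) (antiSym n k) (Pi.single id 1) ⇑w⁻¹ with hD
  have hasc : ∀ (i : Gen n) (w : Equiv.Perm (Fin n)), i.1 ≠ k → w⁻¹ (lo i) < w⁻¹ (hi i) →
      D (simple i * w) = -v⁻¹ * D w := by
    intro i w hik h
    have h1 := congrFun (congrArg (fun x => rep (Fin n) x (Pi.single id 1))
      (gen_mul_antiSym (n := n) hik)) ⇑w⁻¹
    have h2 := congrFun (congrArg (fun x => rep (Fin n) x (Pi.single id 1))
      (gen_mul_bar_antiSym (n := n) hik)) ⇑w⁻¹
    simp only [rep_gen_mul_apply, rep_scal_mul_apply, act_apply_of_lt _ h, Pi.smul_apply,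
      smul_eq_mul] at h1 h2
    simp only [hD, coe_inv_simple_mul]
    rw [h1, h2, mul_sub]
  have hsupp : ∀ w, w ∉ parabolic (maxJ n k) → D w = 0 := by
    intro w hw
    simp only [hD]
    rw [rep_antiSym, emb_single_of_not_mem hw, sub_zero, antiSym]
    simp only [map_sum, LinearMap.sum_apply, Finset.sum_apply]
    refine Finset.sum_eq_zero fun u _ => ?_
    rw [map_mul, bar_scal, rep_scal_mul_apply, Pi.smul_apply]
    by_cases hu : u ∈ parabolic (maxJ n k)
    · rw [rep_bar_stdT_of_not_mem hu hw, smul_zero]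
    · rw [emb_single_of_not_mem hu, map_zero, zero_smul]
  have hlong : D (longest (maxJ n k)) = 0 := by
    simp only [hD]
    rw [rep_antiSym, emb_single_longest, sub_eq_zero]
    have h1 := rep_sum_single_id
      (fun u : Equiv.Perm (Fin n) => barQv (emb (k := k) (Pi.single (vacFin n k) 1) ⇑u⁻¹)) (longest (maxJ n k))
    rw [emb_single_longest, map_one] at h1
    refine Eq.trans ?_ h1
    rw [antiSym]
    simp only [map_sum, LinearMap.sum_apply, Finset.sum_apply]
    refine Finset.sum_congr rfl fun u _ => ?_
    rw [map_mul, bar_scal, rep_scal_mul_apply, rep_scal_mul_apply, Pi.smul_apply, Pi.smul_apply]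
    by_cases hu : u ∈ parabolic (maxJ n k)
    -- No `u ∈ W_J` is longer than `longest`, so at this sequence bar does not change the
    -- coefficient of `T_u`.
    · have h2 := invLT_rep_bar_stdT (id : Fin n → Fin n) u ⇑(longest (maxJ n k))⁻¹
        (by rw [← len_eq_inv, inv_id, zero_add]; exact len_le_len_longest hu)
      rw [map_sub, LinearMap.sub_apply, Pi.sub_apply, sub_eq_zero] at h2
      rw [h2]
    · rw [emb_single_of_not_mem hu, map_zero, zero_smul, zero_smul]
  have hzero : ∀ w, D w = 0 := by
    classical
    by_contra hc
    push Not at hc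
    obtain ⟨w0, hw0⟩ := hc
    obtain ⟨w, hw, hmax⟩ := (Finset.univ.filter fun w => D w ≠ 0).exists_max_image len
      ⟨w0, Finset.mem_filter.mpr ⟨Finset.mem_univ _, hw0⟩⟩
    have hw := (Finset.mem_filter.mp hw).2
    have hwJ : w ∈ parabolic (maxJ n k) := by
      by_contra h
      exact hw (hsupp w h)
    have hwl := eq_longest_of_descents hwJ fun i hik => by
      refine (lt_or_gt_of_ne (inv_lo_ne_inv_hi w i)).resolve_left fun h1 => ?_
      have h2 := hmax (simple i * w) (Finset.mem_filter.mpr ⟨Finset.mem_univ _, by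
        rw [hasc i w hik h1]
        exact mul_ne_zero (neg_ne_zero.mpr (inv_ne_zero v_ne_zero)) hw⟩)
      have h3 := len_simple_mul_of_lt h1
      omega
    rw [hwl] at hw
    exact hw hlong
  exact eq_of_rep_apply_eq fun w => sub_eq_zero.mp (hzero w)

/-- Writing `y = z' u`, the coefficient of `T_y` is that of `m_{z'}` times `(-v)^e` with `e =
l(w_0^J) - l(u)`. It has constant term `1` only if `z' = z` and `e = 0`, that is, `u` is longest. -/
theorem isKL_mul_antiSym {x : Hecke n} (hx : bar n x = x) {z : Equiv.Perm (Fin n)}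
    (hz : z ∈ minReps (maxJ n k))
    (h : ∀ f, ∃ p : Polynomial ℤ, rep Bool x (Pi.single (vacFin n k) 1) f =
      (Pi.single (vacFin n k ∘ ⇑z⁻¹) 1 : (Fin n → Bool) → Qv) f + vMul p) :
    IsKL (z * longest (maxJ n k)) (x * antiSym n k) := by
  refine ⟨by rw [map_mul, hx, bar_antiSym], ?_⟩
  have key : ∀ y : Equiv.Perm (Fin n), ∃ p : Polynomial ℤ,
      rep (Fin n) (x * antiSym n k) (Pi.single id 1) ⇑y⁻¹ =
        rep (Fin n) (stdT (z * longest (maxJ n k))) (Pi.single id 1) ⇑y⁻¹ + vMul p := by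
    intro y
    obtain ⟨p, hp⟩ := h (vacFin n k ∘ ⇑y⁻¹)
    obtain ⟨z', u, hz', hu, rfl, hy, hl⟩ := exists_eq_mul (k := k) y
    obtain ⟨e, he⟩ := Nat.exists_eq_add_of_le (len_le_len_longest hu)
    rw [rep_mul_antiSym, rep_stdT_single (by rw [inv_id_comp, inv_id, zero_add]), emb, weight,
      if_pos (Equiv.injective _), ← len_eq_inv, hl, he, hp]
    have e1 : (((len u + e : ℕ) : ℤ) + inv (vacFin n k ∘ ⇑(z' * u)⁻¹) -
        ((inv (vacFin n k ∘ ⇑(z' * u)⁻¹) + len u : ℕ) : ℤ)) = (e : ℤ) := by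
      push_cast
      ring
    rw [e1, zpow_natCast, Function.id_comp]
    by_cases h1 : z' * u = z * longest (maxJ n k)
    · have h2 : z' = z := by
        refine eq_of_vacFin_comp_eq (mem_minReps_iff.mp hz') (mem_minReps_iff.mp hz) ?_
        rw [← hy, h1, mul_inv_rev, Equiv.Perm.coe_mul, ← Function.comp_assoc,
          vacFin_comp_of_mem (inv_mem (longest_mem _))]
      subst h2
      have h3 := mul_left_cancel h1
      subst h3
      have h4 : e = 0 := by omega
      subst h4
      rw [hy, Pi.single_eq_same, Pi.single_eq_same]
      exact ⟨p, by rw [pow_zero, mul_one]⟩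
    · have h0 : (Pi.single ⇑(z * longest (maxJ n k))⁻¹ 1 : (Fin n → Fin n) → Qv) ⇑(z' * u)⁻¹ = 0 :=
        Pi.single_eq_of_ne (fun h2 => h1 (inv_injective (Equiv.ext (congrFun h2)))) _
      simp only [h0, zero_add]
      by_cases h2 : z' = z
      · subst h2
        obtain ⟨e, rfl⟩ : ∃ e', e = e' + 1 := by
          refine Nat.exists_eq_succ_of_ne_zero ?_
          rintro rfl
          exact h1 (by rw [eq_longest_of_len_le hu (by omega)])
        rw [hy, Pi.single_eq_same]
        -- The coefficient is `(-v)^(e+1) (1 + v p)`, with one factor `v` split off.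
        refine ⟨-(-Polynomial.X) ^ e + p * (-Polynomial.X) ^ (e + 1), ?_⟩
        simp only [vMul, map_add, map_mul, map_neg, map_pow, Polynomial.aeval_X]
        ring
      · rw [Pi.single_eq_of_ne fun h3 => h2 (eq_of_vacFin_comp_eq (mem_minReps_iff.mp hz')
          (mem_minReps_iff.mp hz) (hy.symm.trans h3)), zero_add]
        refine ⟨p * (-Polynomial.X) ^ e, ?_⟩
        simp only [vMul, map_mul, map_neg, map_pow, Polynomial.aeval_X]
        ring
  choose p hp using key
  refine ⟨p, eq_of_rep_apply_eq fun y => ?_⟩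
  rw [rep_sum_single_id, map_sub, LinearMap.sub_apply, Pi.sub_apply, hp, add_sub_cancel_left]

theorem isKL_antiSym : IsKL (longest (maxJ n k)) (antiSym n k) := by
  have h := isKL_mul_antiSym (n := n) (k := k) (x := 1) (z := 1) (map_one _)
    (mem_minReps_iff.mpr (by
      rw [inv_one, Equiv.Perm.coe_one, Function.comp_id, inv_vacFin, len_one])) fun f => ⟨0, by
      rw [map_one, Module.End.one_apply, inv_one, Equiv.Perm.coe_one, Function.comp_id, vMul_zero,
        add_zero]⟩
  rwa [one_mul, one_mul] at h

theorem existsUnique_isKL {w : Equiv.Perm (Fin n)} {c : Hecke n} (h : IsKL w c) :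
    (∃! c, IsKL w c) ∧ c = klC w :=
  ⟨⟨c, h, fun _ h' => h'.unique h⟩, h.unique (Classical.epsilon_spec ⟨c, h⟩)⟩

theorem isParKL_smul_mOne {x : Hecke n} (hx : bar n x = x) {z : Equiv.Perm (Fin n)}
    (hz : z ∈ minReps (maxJ n k))
    (h : ∀ f, ∃ p : Polynomial ℤ, rep Bool x (Pi.single (vacFin n k) 1) f =
      (Pi.single (vacFin n k ∘ ⇑z⁻¹) 1 : (Fin n → Bool) → Qv) f + vMul p) :
    IsParKL (maxJ n k) z (x • mOne (maxJ n k)) := by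
  classical
  refine ⟨by rw [barM_smul_mOne, hx], ?_⟩
  choose p hp using h
  obtain ⟨c, hc⟩ := exists_eq_sum_mStd (k := k) x
  set E := Finset.univ.filter fun z => z ∈ minReps (maxJ n k) with hE
  have hmem : ∀ w ∈ E, inv (vacFin n k ∘ ⇑w⁻¹) = len w := fun w hw =>
    mem_minReps_iff.mp (Finset.mem_filter.mp hw).2
  have h1 : x • mOne (maxJ n k) = (∑ y ∈ E, scal (c y) * stdT y) • mOne (maxJ n k) := by
    rw [hc, Finset.sum_smul]
    exact Finset.sum_congr rfl fun y _ => by rw [mul_smul, mStd]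
  have h2 : ∀ w ∈ E, c w = (Pi.single z 1 : Equiv.Perm (Fin n) → Qv) w +
      vMul (p (vacFin n k ∘ ⇑w⁻¹)) := by
    intro w hw
    have h3 := rep_sum_single (inv_vacFin n k) hmem (fun w hw w' hw' h =>
      eq_of_vacFin_comp_eq (hmem w hw) (hmem w' hw') h) c hw
    rw [← rep_eq_of_smul_mOne_eq h1, hp] at h3
    rw [← h3]
    congr 1
    by_cases h4 : w = z
    · rw [h4, Pi.single_eq_same, Pi.single_eq_same]
    · rw [Pi.single_eq_of_ne h4, Pi.single_eq_of_ne fun h5 =>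
        h4 (eq_of_vacFin_comp_eq (hmem w hw) (mem_minReps_iff.mp hz) h5)]
  refine ⟨fun w => p (vacFin n k ∘ ⇑w⁻¹), ?_⟩
  have h3 : mStd (maxJ n k) z = ∑ w ∈ E,
      (scal ((Pi.single z 1 : Equiv.Perm (Fin n) → Qv) w) : Hecke n) • mStd (maxJ n k) w := by
    rw [Finset.sum_eq_single_of_mem z (Finset.mem_filter.mpr ⟨Finset.mem_univ _, hz⟩)]
    · rw [Pi.single_eq_same, scal, map_one, one_smul]
    · intro w _ hw
      rw [Pi.single_eq_of_ne hw, scal, map_zero, zero_smul]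
  rw [hc, sub_eq_iff_eq_add]
  conv_rhs => rw [h3]
  rw [← Finset.sum_add_distrib]
  refine Finset.sum_congr rfl fun w hw => ?_
  rw [h2 w hw, scal, map_add, add_smul, add_comm]

theorem existsUnique_isParKL {w : Equiv.Perm (Fin n)} {c : ParMod (maxJ n k)}
    (h : IsParKL (maxJ n k) w c) : (∃! c, IsParKL (maxJ n k) w c) ∧ c = parKL (maxJ n k) w :=
  ⟨⟨c, h, fun _ h' => h'.unique h⟩, h.unique (Classical.epsilon_spec ⟨c, h⟩)⟩

end

/-! ### Sequences indexed by a window -/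

section

variable {n k : ℕ}

variable (k) in
/-- The extension of a sequence of length `n`, placed at `-k, …, n - k - 1`, by the values of the
vacuum sequence. -/
def ext (f : Fin n → Bool) : ℤ → Bool := fun y =>
  if h : 0 ≤ y + k ∧ y + k < n then f ⟨(y + k).toNat, by omega⟩ else vacSeq y

theorem ext_apply (f : Fin n → Bool) {a : Fin n} {y : ℤ} (h : y = a.1 - k) : ext k f y = f a := by
  have ha := a.2
  rw [ext, dif_pos (by omega)]
  congr 1
  ext
  simp only
  omega

theorem ext_of_not (f : Fin n → Bool) {y : ℤ} (h : ¬ (0 ≤ y + k ∧ y + k < n)) :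
    ext k f y = vacSeq y := dif_neg h

theorem ext_lo (f : Fin n → Bool) (i : Gen n) : ext k f (i.1 - k - 1) = f (lo i) := by
  have := i.2.1
  exact ext_apply f (by rw [val_lo]; omega)

theorem ext_hi (f : Fin n → Bool) (i : Gen n) : ext k f (i.1 - k - 1 + 1) = f (hi i) :=
  ext_apply f (by rw [val_hi]; omega)

theorem ext_injective : Function.Injective (ext (n := n) k) := by
  intro f g h
  funext a
  rw [← ext_apply (k := k) f rfl, h, ext_apply (k := k) g rfl]

theorem ext_comp_simple (f : Fin n → Bool) (i : Gen n) :
    ext k (f ∘ simple i) = ext k f ∘ adj (i.1 - k - 1) := by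
  have hi1 := i.2.1
  funext y
  rw [Function.comp_apply, adj_apply]
  split_ifs with h1 h2
  · rw [h1, ext_lo, ext_hi, Function.comp_apply, simple_lo]
  · rw [h2, ext_lo, ext_hi, Function.comp_apply, simple_hi]
  · by_cases hy : 0 ≤ y + k ∧ y + k < n
    · have e : y = ((⟨(y + k).toNat, by omega⟩ : Fin n).1 : ℤ) - k := by
        simp only
        omega
      rw [ext_apply _ e, ext_apply _ e, Function.comp_apply, simple_apply_of_ne]
      · simp only
        omega
      · simp only
        omega
    · rw [ext_of_not _ hy, ext_of_not _ hy]

theorem ext_vacFin : ext k (vacFin n k) = vacSeq := by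
  funext y
  by_cases hy : 0 ≤ y + k ∧ y + k < n
  · have e : y = ((⟨(y + k).toNat, by omega⟩ : Fin n).1 : ℤ) - k := by
      simp only
      omega
    rw [ext_apply _ e, vacFin, vacSeq, decide_eq_decide]
    simp only
    omega
  · exact ext_of_not _ hy

variable (n k) in
/-- The restriction of functions along the extension of sequences. -/
def res (φ : (ℤ → Bool) → Qv) : (Fin n → Bool) → Qv := fun f => φ (ext k f)

theorem res_mayaInd {f : Fin n → Bool} {g : ℤ → Bool} (h : ext k f = g) :
    res n k (mayaInd g) = Pi.single f 1 := by
  subst h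
  funext f'
  rw [res]
  by_cases hf : f' = f
  · rw [hf, mayaInd_self, Pi.single_eq_same]
  · rw [Pi.single_eq_of_ne hf, mayaInd_of_ne fun h => hf (ext_injective h)]

/-- The generator `T_i` is `U - v⁻¹` at the place `i - k - 1`. For a box `(i, j)` the index `k + j -
i` gives the place `j - i - 1` used in `rowOp`. -/
theorem act_res (i : Gen n) (φ : (ℤ → Bool) → Qv) :
    act i (res n k φ) = res n k (tlU (i.1 - k - 1) φ - v⁻¹ • φ) := by
  funext f
  rw [act_apply, res, res, res, Pi.sub_apply, tlU_apply, Pi.smul_apply, smul_eq_mul, ext_lo,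
    ext_hi, ext_comp_simple]
  cases h1 : f (lo i) <;> cases h2 : f (hi i) <;> (simp; try ring)

theorem genNat_of_lt {i j : ℕ} (hi : i < k) (hj : j < n - k) :
    ∃ c : Gen n, (c.1 : ℤ) - k - 1 = j - i - 1 ∧ genNat n (k + j - i) = gen c ∧
      simpleNat n (k + j - i) = simple c := by
  have h : 1 ≤ k + j - i ∧ k + j - i < n := by omega
  exact ⟨⟨k + j - i, h⟩, by simp only; omega, dif_pos h, dif_pos h⟩

theorem rep_sub_res {i j r : ℕ} (hi : i < k) (hj : j < n - k) (hr : r ≠ 0)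
    (φ : (ℤ → Bool) → Qv) :
    rep Bool (genNat n (k + j - i) - scal (v ^ r / qInt r)) (res n k φ) =
      res n k (factor (j - i - 1) r φ) := by
  obtain ⟨c, hc, hg, -⟩ := genNat_of_lt hi hj
  rw [hg, map_sub, LinearMap.sub_apply, rep_gen, act_res, AlgHom.commutes,
    Module.algebraMap_end_apply, hc, factor_of_ne _ hr, qRatio_eq hr]
  funext f
  simp only [res, LinearMap.sub_apply, LinearMap.smul_apply, Module.End.one_apply, Pi.sub_apply,
    Pi.smul_apply, smul_eq_mul]
  ring

/-! ### Products over the boxes of a diagram -/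

theorem row_prod_succ {M : Type} [Monoid M] (F : ℕ × ℕ → M) (i b : ℕ) :
    (((List.range (b + 1)).reverse.map fun j => (i, j)).map F).prod =
      F (i, b) * (((List.range b).reverse.map fun j => (i, j)).map F).prod := by
  rw [List.range_succ, List.reverse_append]
  rfl

theorem rect_prod_succ {M : Type} [Monoid M] (F : ℕ × ℕ → M) (L : ℕ → ℕ) (a : ℕ) :
    (((List.range (a + 1)).reverse.flatMap fun i => (List.range (L i)).reverse.map
      fun j => (i, j)).map F).prod =
      (((List.range (L a)).reverse.map fun j => (a, j)).map F).prod *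
      (((List.range a).reverse.flatMap fun i => (List.range (L i)).reverse.map
        fun j => (i, j)).map F).prod := by
  rw [List.range_succ, List.reverse_append, List.reverse_singleton, List.singleton_append,
    List.flatMap_cons, List.map_append, List.prod_append]

theorem mem_boxes {μ : YoungDiagram} {c : ℕ × ℕ} (h : c ∈ boxes μ) : c ∈ μ := by
  simp only [boxes, List.mem_flatMap, List.mem_map, List.mem_reverse, List.mem_range] at h
  obtain ⟨i, -, j, hj, rfl⟩ := h
  exact YoungDiagram.mem_iff_lt_rowLen.mpr hj

theorem shift_eq_zero {μ : YoungDiagram} {i j : ℕ} (h : (i, j) ∉ μ) : shift μ i j = 0 := by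
  rw [shift, dif_neg h]

theorem shift_eq_max {μ : YoungDiagram} {i j : ℕ} (h : (i, j) ∈ μ) :
    shift μ i j = max (shift μ i (j + 1)) (shift μ (i + 1) j) + 1 := by
  rw [shift, dif_pos h]

theorem shift_ne_zero_iff {μ : YoungDiagram} {i j : ℕ} : shift μ i j ≠ 0 ↔ (i, j) ∈ μ := by
  refine ⟨fun h => ?_, fun h => by rw [shift_eq_max h]; exact Nat.succ_ne_zero _⟩
  by_contra h'
  exact h (shift_eq_zero h')

theorem isShift_shift (μ : YoungDiagram) : IsShift (shift μ) where
  right_zero i j h := by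
    contrapose! h
    rw [shift_ne_zero_iff] at h ⊢
    exact μ.up_left_mem le_rfl (Nat.le_succ j) h
  down_zero i j h := by
    contrapose! h
    rw [shift_ne_zero_iff] at h ⊢
    exact μ.up_left_mem (Nat.le_succ i) le_rfl h
  eq_max i j h := shift_eq_max (shift_ne_zero_iff.mp h)

theorem rowLen_le {μ : YoungDiagram} {a b : ℕ} (hμ : FitsIn μ a b) (i : ℕ) : μ.rowLen i ≤ b := by
  by_contra h
  exact (hμ _ (YoungDiagram.mem_iff_lt_rowLen.mpr (not_le.mp h))).2.false

theorem colLen_le {μ : YoungDiagram} {a b : ℕ} (hμ : FitsIn μ a b) : μ.colLen 0 ≤ a := by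
  by_contra h
  exact (hμ _ (YoungDiagram.mem_iff_lt_colLen.mpr (not_le.mp h))).1.false

theorem rowLen_eq_zero {μ : YoungDiagram} {i : ℕ} (h : μ.colLen 0 ≤ i) : μ.rowLen i = 0 := by
  by_contra h'
  exact (YoungDiagram.mem_iff_lt_colLen.mp
    (YoungDiagram.mem_iff_lt_rowLen.mpr (Nat.pos_of_ne_zero h'))).not_ge h

theorem rep_row_res {μ : YoungDiagram} (hμ : FitsIn μ k (n - k)) (i : ℕ) {b : ℕ}
    (hb : b ≤ μ.rowLen i) (φ : (ℤ → Bool) → Qv) :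
    rep Bool (((List.range b).reverse.map fun j => (i, j)).map fun c =>
      genNat n (k + c.2 - c.1) - scal (v ^ shift μ c.1 c.2 / qInt (shift μ c.1 c.2))).prod
      (res n k φ) = res n k (rowOp (shift μ) i b φ) := by
  induction b with
  | zero => simp [rowOp]
  | succ b ih =>
    have hb' : (i, b) ∈ μ := YoungDiagram.mem_iff_lt_rowLen.mpr hb
    rw [row_prod_succ, map_mul, Module.End.mul_apply, ih (Nat.le_of_succ_le hb), rowOp,
      Module.End.mul_apply]
    exact rep_sub_res (hμ _ hb').1 (hμ _ hb').2 (shift_ne_zero_iff.mpr hb') _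

theorem rep_rect_res {μ : YoungDiagram} (hμ : FitsIn μ k (n - k)) (a : ℕ)
    (φ : (ℤ → Bool) → Qv) :
    rep Bool (((List.range a).reverse.flatMap fun i => (List.range (μ.rowLen i)).reverse.map
      fun j => (i, j)).map fun c =>
      genNat n (k + c.2 - c.1) - scal (v ^ shift μ c.1 c.2 / qInt (shift μ c.1 c.2))).prod
      (res n k φ) = res n k (rectOp (shift μ) (n - k) a φ) := by
  induction a with
  | zero => simp [rectOp]
  | succ a ih =>
    rw [rect_prod_succ, map_mul, Module.End.mul_apply, ih, rectOp, Module.End.mul_apply,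
      rowOp_eq_of_zero (rowLen_le hμ a) fun j hj _ => shift_eq_zero fun h =>
        (YoungDiagram.mem_iff_lt_rowLen.mp h).not_ge hj]
    exact rep_row_res hμ a le_rfl _

theorem rep_xDiag {μ : YoungDiagram} (hk : k < n) (hμ : FitsIn μ k (n - k)) (f : Fin n → Bool) :
    ∃ P, rep Bool (xDiag n k μ) (Pi.single (vacFin n k) 1) f =
      mayaInd (mayaOf μ.rowLen) (ext k f) + vMul P := by
  have hL : ∀ i j, shift μ i j ≠ 0 ↔ j < μ.rowLen i := fun i j =>
    shift_ne_zero_iff.trans YoungDiagram.mem_iff_lt_rowLen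
  -- Both `k` and `n - k` are at most `n`, so the side `n + 2` provides the margin of two.
  obtain ⟨P, hP⟩ := exists_rectOp_coeff (N := n + 2) (isShift_shift μ) hL
    (fun i hi => rowLen_eq_zero ((colLen_le hμ).trans hi)) (rowLen_le hμ) (by omega) (by omega)
    (ext k f)
  refine ⟨P, ?_⟩
  rw [← hP, rectOp_eq_of_zero (a := μ.colLen 0) (b := n - k)
    (by have := colLen_le hμ; omega) (by omega), ← res_mayaInd ext_vacFin]
  · exact congrFun (rep_rect_res hμ _ _) f
  · intro i j hij
    refine shift_eq_zero fun h => ?_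
    rcases hij with h1 | h1
    · have := YoungDiagram.mem_iff_lt_rowLen.mp h
      rw [rowLen_eq_zero h1] at this
      omega
    · exact (hμ _ h).2.not_ge h1

theorem barQv_qInt (r : ℕ) : barQv (qInt r) = qInt r := by
  rw [qInt, map_div₀, map_sub, map_sub, map_pow, map_pow, map_inv₀, barQv_v, inv_inv,
    ← neg_sub (v ^ r), ← neg_sub v, neg_div_neg_eq]

theorem v_pow_sub_inv_pow (r : ℕ) : v ^ r - v⁻¹ ^ r = qInt r * (v - v⁻¹) := by
  rw [qInt, div_mul_cancel₀ _ v_sub_inv_ne_zero]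

theorem bar_xDiag {μ : YoungDiagram} (hμ : FitsIn μ k (n - k)) :
    bar n (xDiag n k μ) = xDiag n k μ := by
  rw [xDiag, map_list_prod, List.map_map]
  congr 1
  refine List.map_congr_left fun c hc => ?_
  have hc' := mem_boxes hc
  obtain ⟨i, -, hg, -⟩ := genNat_of_lt (hμ _ hc').1 (hμ _ hc').2
  have hr := qInt_ne_zero (shift_ne_zero_iff.mpr hc')
  rw [Function.comp_apply, hg, map_sub, bar_gen, bar_scal, genInv, map_div₀, map_pow, barQv_v,
    barQv_qInt, sub_sub, scal, scal, ← map_add]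
  congr 2
  rw [eq_div_iff hr, add_mul, div_mul_cancel₀ _ hr, mul_comm, ← v_pow_sub_inv_pow, sub_add_cancel]

/-! ### The permutation of a diagram -/

section

variable {L : ℕ → ℕ} {p : ℕ}

theorem mayaOf_corner (h : ∀ i < p, L p < L i) (h' : ∀ i, p < i → L i ≤ L p) :
    mayaOf L (L p - p - 1 + 1) = true := by
  rw [mayaOf_eq_true]
  intro i hi
  rcases lt_trichotomy i p with h1 | rfl | h1
  · have := h i h1
    omega
  · omega
  · have := h' i h1
    omega

/-- Adding a box to row `p` moves its entry `false` one place to the right, onto a place that is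
`true` because the box is addable. -/
theorem mayaOf_update (h : ∀ i < p, L p < L i) (h' : ∀ i, p < i → L i ≤ L p) :
    mayaOf (Function.update L p (L p + 1)) = mayaOf L ∘ adj (L p - p - 1) := by
  funext y
  rw [Function.comp_apply, adj_apply]
  split_ifs with h1 h2
  · rw [mayaOf_corner h h', mayaOf_eq_true]
    intro i hi
    rcases lt_trichotomy i p with h3 | rfl | h3
    · have := h i h3
      rw [Function.update_of_ne h3.ne] at hi
      omega
    · rw [Function.update_self] at hi
      omega
    · have := h' i h3
      rw [Function.update_of_ne h3.ne'] at hi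
      omega
  · rw [mayaOf_eq_false.mpr ⟨p, rfl⟩, mayaOf_eq_false]
    exact ⟨p, by rw [Function.update_self]; push_cast; omega⟩
  · rw [Bool.eq_iff_iff, mayaOf_eq_true, mayaOf_eq_true]
    refine forall_congr' fun i => ?_
    by_cases hi : i = p
    · subst hi
      rw [Function.update_self]
      push_cast
      omega
    · rw [Function.update_of_ne hi]

end

variable (k) in
/-- The permutation `w` is the minimal coset representative whose sequence is that of the
partition `L`. -/
def IsGrassmannian (w : Equiv.Perm (Fin n)) (L : ℕ → ℕ) : Prop :=
  ext k (vacFin n k ∘ ⇑w⁻¹) = mayaOf L ∧ inv (vacFin n k ∘ ⇑w⁻¹) = len w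

/-- The added box exchanges `false, true`, an ascent of the sequence, so the length and the number
of inversions of the sequence both grow by one and minimality persists. -/
theorem IsGrassmannian.simpleNat_mul {w : Equiv.Perm (Fin n)} {L : ℕ → ℕ} {p : ℕ}
    (hw : IsGrassmannian k w L) (hp : p < k) (hL : L p < n - k) (h : ∀ i < p, L p < L i)
    (h' : ∀ i, p < i → L i ≤ L p) :
    IsGrassmannian k (simpleNat n (k + L p - p) * w) (Function.update L p (L p + 1)) := by
  obtain ⟨c, hc, -, hs⟩ := genNat_of_lt hp hL
  have h1 : (vacFin n k ∘ ⇑w⁻¹) (lo c) = false := by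
    refine (ext_lo (k := k) _ c).symm.trans ?_
    rw [hc, hw.1]
    exact mayaOf_eq_false.mpr ⟨p, rfl⟩
  have h2 : (vacFin n k ∘ ⇑w⁻¹) (hi c) = true := by
    refine (ext_hi (k := k) _ c).symm.trans ?_
    rw [hc, hw.1]
    exact mayaOf_corner h h'
  rw [hs]
  refine ⟨?_, inv_vacFin_simple_mul_of_lt hw.2 (by rw [h1, h2]; decide)⟩
  rw [coe_vacFin_simple_mul, ext_comp_simple, hw.1, hc, mayaOf_update h h']

theorem IsGrassmannian.row_mul {w : Equiv.Perm (Fin n)} {L : ℕ → ℕ} {p : ℕ}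
    (hw : IsGrassmannian k w L) (hp : p < k) (h : ∀ i, p ≤ i → L i = 0) {b : ℕ}
    (hb : b ≤ n - k) (hb' : ∀ i < p, b ≤ L i) :
    IsGrassmannian k ((((List.range b).reverse.map fun j => (p, j)).map fun c =>
      simpleNat n (k + c.2 - c.1)).prod * w) (Function.update L p b) := by
  induction b with
  | zero =>
    rw [← h p le_rfl, Function.update_eq_self, h p le_rfl]
    simpa using hw
  | succ b ih =>
    have h1 := (ih (Nat.le_of_succ_le hb) fun i hi => Nat.le_of_succ_le (hb' i hi)).simpleNat_mul
      hp (by rw [Function.update_self]; omega)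
      (fun i hi => by
        rw [Function.update_self, Function.update_of_ne hi.ne]
        exact hb' i hi)
      (fun i hi => by
        rw [Function.update_of_ne hi.ne', h i hi.le]
        exact Nat.zero_le _)
    rw [Function.update_self, Function.update_idem] at h1
    rw [row_prod_succ, mul_assoc]
    exact h1

theorem isGrassmannian_rect {μ : YoungDiagram} (hμ : FitsIn μ k (n - k)) {a : ℕ}
    (ha : a ≤ k) :
    IsGrassmannian k (((List.range a).reverse.flatMap fun i =>
      (List.range (μ.rowLen i)).reverse.map fun j => (i, j)).map fun c =>
      simpleNat n (k + c.2 - c.1)).prod fun i => if i < a then μ.rowLen i else 0 := by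
  induction a with
  | zero =>
    refine ⟨?_, ?_⟩
    · rw [mayaOf_zero fun i => if_neg (Nat.not_lt_zero i), ← ext_vacFin (n := n) (k := k)]
      rfl
    · simp only [List.range_zero, List.reverse_nil, List.flatMap_nil, List.map_nil, List.prod_nil,
        inv_one, Equiv.Perm.coe_one, Function.comp_id, inv_vacFin, len_one]
  | succ a ih =>
    have h := (ih (Nat.le_of_succ_le ha)).row_mul (p := a) ha
      (fun i hi => if_neg hi.not_gt) (rowLen_le hμ a) (fun i hi => by
        rw [if_pos hi]
        exact μ.rowLen_anti i a hi.le)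
    rw [rect_prod_succ]
    convert h using 1
    funext i
    rcases lt_trichotomy i a with h1 | rfl | h1
    · rw [Function.update_of_ne h1.ne, if_pos h1, if_pos (h1.trans (Nat.lt_succ_self a))]
    · rw [Function.update_self, if_pos (Nat.lt_succ_self i)]
    · rw [Function.update_of_ne h1.ne', if_neg h1.not_gt, if_neg (by omega)]

theorem isGrassmannian_wDiag {μ : YoungDiagram} (hμ : FitsIn μ k (n - k)) :
    IsGrassmannian k (wDiag n k μ) μ.rowLen := by
  have h := isGrassmannian_rect hμ (colLen_le hμ)
  have e : (fun i => if i < μ.colLen 0 then μ.rowLen i else 0) = μ.rowLen := by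
    funext i
    split_ifs with h1
    · rfl
    · exact (rowLen_eq_zero (not_lt.mp h1)).symm
  rwa [e] at h

end

theorem exists_rep_xDiag {n k : ℕ} (hk : k < n) {μ : YoungDiagram} (hμ : FitsIn μ k (n - k))
    (f : Fin n → Bool) :
    ∃ p : Polynomial ℤ, rep Bool (xDiag n k μ) (Pi.single (vacFin n k) 1) f =
      (Pi.single (vacFin n k ∘ ⇑(wDiag n k μ)⁻¹) 1 : (Fin n → Bool) → Qv) f + vMul p := by
  obtain ⟨p, hp⟩ := rep_xDiag hk hμ f
  exact ⟨p, by rw [hp, ← res_mayaInd (isGrassmannian_wDiag hμ).1]; rfl⟩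

end Grassmannian

open Grassmannian in
theorem theorem2p1 (n k : ℕ) (hk : k < n) (μ : YoungDiagram) (hμ : FitsIn μ k (n - k)) :
    (wDiag n k μ ∈ minReps (maxJ n k) ∧
      (∃! c, IsParKL (maxJ n k) (wDiag n k μ) c) ∧
      xDiag n k μ • mOne (maxJ n k) = parKL (maxJ n k) (wDiag n k μ)) ∧
    ((∃! c, IsKL (longest (maxJ n k)) c) ∧
      (∃! c, IsKL (wDiag n k μ * longest (maxJ n k)) c) ∧
      xDiag n k μ * klC (longest (maxJ n k)) =
        klC (wDiag n k μ * longest (maxJ n k))) := by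
  have hw : wDiag n k μ ∈ minReps (maxJ n k) := mem_minReps_iff.mpr (isGrassmannian_wDiag hμ).2
  have h1 := existsUnique_isParKL
    (isParKL_smul_mOne (bar_xDiag hμ) hw (exists_rep_xDiag hk hμ))
  have h2 := existsUnique_isKL (isKL_antiSym (n := n) (k := k))
  have h3 := existsUnique_isKL
    (isKL_mul_antiSym (bar_xDiag hμ) hw (exists_rep_xDiag hk hμ))
  exact ⟨⟨hw, h1.1, h1.2⟩, h2.1, h3.1, by rw [← h2.2, h3.2]⟩
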